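/- Let $\mathbb K=\mathbb C$ (or $\mathbb K=\mathbb R$) and let $n\ge 2$. All manifolds and maps are $\mathbb K$-analytic. For a manifold $Z$ with a distribution $D\subset TZ$, the prolongation $(\mathbb PD, D^1)$ is the manifold of pairs $(z,\ell)$ with $z\in Z$ and $\ell\subset D(z)$ a line, with the distribution $D^1(z,\ell)=d\pi_{(z,\ell)}^{-1}(\ell)$, where $\pi(z,\ell)=z$. The Monster tower is $\mathcal P^0(n)=\mathbb K^n$, $\Delta_0=T\mathbb K^n$, $(\mathcal P^{k+1}(n),\Delta_{k+1})=(\mathbb P\Delta_k,\Delta_k^1)$, with projections $\pi_{k,i}:\mathcal P^k(n)\to\mathcal P^i(n)$. A local diffeomorphism $\phi$ of $Z$ preserving $D$ acts on $\mathbb PD$ by $\phi^1(z,\ell)=(\phi(z),d\phi_z(\ell))$; iterating, a diffeomorphism $\psi$ between open subsets of $\mathbb K^n$ has prolongations $\psi^k$ on $\mathcal P^k(n)$. Points $p,q\in\mathcal P^k(n)$ lie in the same $\mathrm{Diff}(n)$-orbit if $\psi^k(p)=q$ for some such $\psi$ defined near $\pi_{k,0}(p)$. For $i\ge 1$ and $p\in\mathcal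 P^i(n)$ let $F_i(p)$ be the fiber of $\pi_{i,i-1}$ through $p$, let $\mathcal P^0(F_i(p))=F_i(p)$, and let $\mathcal P^{j+1}(F_i(p))\subset\mathcal P^{i+j+1}(n)$ be the set of pairs $(z,\ell)$ with $z\in\mathcal P^j(F_i(p))$ and $\ell\subset\delta_i^j(z):=\Delta_{i+j}(z)\cap T_z\mathcal P^j(F_i(p))$. A point $(z,\ell)\in\mathcal P^{k+1}(n)$ is critical if $\ell$ lies in one of the critical hyperplanes $\delta_i^j(z)$, $i\ge1$, $i+j=k$; it is vertical if $k\ge 1$ and $\ell\subset\ker d\pi_{k,k-1}(z)$. The RVT code of $p\in\mathcal P^k(n)$ is the word $\omega_1\cdots\omega_k$ with $\omega_i=V$ if $\pi_{k,i}(p)$ is vertical, $\omega_i=T$ if it is critical but not vertical, and $\omega_i=R$ otherwise. An RVT class is the set of all points with a given code. Then for all integers $k\ge 1$ and $m\ge 0$, the RVT class $R^kVR^m\subset\mathcal P^{k+1+m}(n)$ is non-empty and consists of a single $\mathrm{Diff}(n)$-orbit. -/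

import Mathlib

open scoped Manifold ContDiff Topology
open Set

universe u

/-- A manifold modelled on `E`, presented by an analytic atlas of injective parametrizations
`par c : E → Pt`, each of them defined on all of `E`. -/
structure ParamManifold (𝕜 E : Type u) [RCLike 𝕜] [NormedAddCommGroup E] [NormedSpace 𝕜 E] where
  Pt : Type u
  ι : Type
  par : ι → E → Pt
  par_injective : ∀ c, Function.Injective (par c)
  /-- the preferred chart at a point -/
  idx : Pt → ι
  mem_range : ∀ p, p ∈ range (par (idx p))
  isOpen_overlap : ∀ c c', IsOpen {a | par c a ∈ range (par c')}
  contDiffOn_transition : ∀ c c', ContDiffOn 𝕜 ω (fun a => Function.invFun (par c') (par c a))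
    {a | par c a ∈ range (par c')}

namespace ParamManifold

variable {𝕜 E : Type u} [RCLike 𝕜] [NormedAddCommGroup E] [NormedSpace 𝕜 E]
  (M : ParamManifold 𝕜 E)

/-- The chart inverse to `par c`; its domain is the range of `par c`, its image is all of `E`. -/
noncomputable def chart (c : M.ι) : PartialEquiv M.Pt E where
  toFun := Function.invFun (M.par c)
  invFun := M.par c
  source := range (M.par c)
  target := univ
  map_source' _ _ := mem_univ _
  map_target' a _ := mem_range_self a
  left_inv' _ h := Function.invFun_eq h
  right_inv' a _ := Function.leftInverse_invFun (M.par_injective c) a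

theorem chart_par (c : M.ι) (a : E) : M.chart c (M.par c a) = a :=
  (M.chart c).right_inv (mem_univ a)

theorem par_chart (c : M.ι) {p : M.Pt} (h : p ∈ range (M.par c)) : M.par c (M.chart c p) = p :=
  (M.chart c).left_inv h

theorem chart_trans_source (c c' : M.ι) :
    ((M.chart c).symm.trans (M.chart c')).source = {a | M.par c a ∈ range (M.par c')} := by
  ext a
  simp [PartialEquiv.trans_source, chart]

noncomputable def core : ChartedSpaceCore E M.Pt where
  atlas := range M.chart
  chartAt p := M.chart (M.idx p)
  mem_chart_source := M.mem_range
  chart_mem_atlas p := mem_range_self _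
  open_source := by
    rintro _ _ ⟨c, rfl⟩ ⟨c', rfl⟩
    rw [chart_trans_source]
    exact M.isOpen_overlap c c'
  continuousOn_toFun := by
    rintro _ _ ⟨c, rfl⟩ ⟨c', rfl⟩
    rw [chart_trans_source]
    exact (M.contDiffOn_transition c c').continuousOn

noncomputable instance : TopologicalSpace M.Pt := M.core.toTopologicalSpace

noncomputable instance : ChartedSpace E M.Pt := M.core.toChartedSpace

/-- The chart `M.chart c` as an open partial homeomorphism. -/
noncomputable def homeo (c : M.ι) : OpenPartialHomeomorph M.Pt E :=
  M.core.openPartialHomeomorph (M.chart c) (mem_range_self c)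

theorem homeo_mem_atlas (c : M.ι) : M.homeo c ∈ atlas E M.Pt :=
  mem_iUnion₂.2 ⟨M.chart c, mem_range_self c, rfl⟩

instance : IsManifold 𝓘(𝕜, E) ω M.Pt := by
  apply isManifold_of_contDiffOn
  intro e e' he he'
  obtain ⟨_, ⟨c, rfl⟩, rfl⟩ := mem_iUnion₂.1 he
  obtain ⟨_, ⟨c', rfl⟩, rfl⟩ := mem_iUnion₂.1 he'
  have := M.contDiffOn_transition c c'
  rw [← chart_trans_source] at this
  simpa using! this

instance : IsManifold 𝓘(𝕜, E) 1 M.Pt := IsManifold.of_le (n := ω) le_top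

/-- The derivative of the parametrization `par c` at `a`. -/
noncomputable abbrev dpar (c : M.ι) (a : E) :
    E →L[𝕜] TangentSpace 𝓘(𝕜, E) (M.par c a) :=
  mfderiv 𝓘(𝕜, E) 𝓘(𝕜, E) (M.par c) a

theorem mdifferentiableAt_par (c : M.ι) (a : E) :
    MDifferentiableAt 𝓘(𝕜, E) 𝓘(𝕜, E) (M.par c) a :=
  mdifferentiableAt_atlas_symm (e := M.homeo c) (M.homeo_mem_atlas c) (mem_univ a)

theorem mdifferentiableAt_chart (c : M.ι) (a : E) :
    MDifferentiableAt 𝓘(𝕜, E) 𝓘(𝕜, E) (M.chart c) (M.par c a) :=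
  mdifferentiableAt_atlas (e := M.homeo c) (M.homeo_mem_atlas c) (mem_range_self a)

theorem isOpen_range_par (c : M.ι) : IsOpen (range (M.par c)) := (M.homeo c).open_source

theorem dchart_dpar (c : M.ι) (a v : E) :
    mfderiv 𝓘(𝕜, E) 𝓘(𝕜, E) (M.chart c) (M.par c a) (M.dpar c a v) = v := by
  have h := mfderiv_comp a (M.mdifferentiableAt_chart c a) (M.mdifferentiableAt_par c a)
  have h2 : (M.chart c) ∘ (M.par c) = id := funext (M.chart_par c)
  rw [h2, mfderiv_id] at h
  exact (DFunLike.congr_fun h v).symm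

theorem dpar_dchart (c : M.ι) (a : E) (v : TangentSpace 𝓘(𝕜, E) (M.par c a)) :
    M.dpar c a (mfderiv 𝓘(𝕜, E) 𝓘(𝕜, E) (M.chart c) (M.par c a) v) = v := by
  have h := mfderiv_comp_of_eq (x := M.par c a) (y := a) (M.mdifferentiableAt_par c a)
    (M.mdifferentiableAt_chart c a) (M.chart_par c a)
  have h2 : (M.par c) ∘ (M.chart c) =ᶠ[𝓝 (M.par c a)] id := by
    filter_upwards [(M.isOpen_range_par c).mem_nhds (mem_range_self a)] with p hp
    exact M.par_chart c hp
  rw [h2.mfderiv_eq, mfderiv_id] at h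
  have key : ∀ b, b = a → ∀ w : E, (M.dpar c b w : E) = M.dpar c a w := by
    rintro _ rfl _
    rfl
  exact (key _ (M.chart_par c a) _).symm.trans (DFunLike.congr_fun h v).symm

theorem dpar_injective (c : M.ι) (a : E) : Function.Injective (M.dpar c a) := fun v w h => by
  rw [← M.dchart_dpar c a v, ← M.dchart_dpar c a w, h]

theorem dpar_transition {c c' : M.ι} {a : E} (h : M.par c a ∈ range (M.par c')) (v : E) :
    (M.dpar c a v : E) = M.dpar c' (M.chart c' (M.par c a))
      (fderiv 𝕜 (fun a => M.chart c' (M.par c a)) a v) := by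
  have hd : DifferentiableAt 𝕜 (fun a => M.chart c' (M.par c a)) a :=
    ((M.contDiffOn_transition c c').contDiffAt ((M.isOpen_overlap c c').mem_nhds h)).differentiableAt
      (by simp)
  have h1 := mfderiv_comp a (M.mdifferentiableAt_par c' (M.chart c' (M.par c a)))
    hd.mdifferentiableAt
  have h2 : (M.par c') ∘ (fun a => M.chart c' (M.par c a)) =ᶠ[𝓝 a] M.par c := by
    filter_upwards [(M.isOpen_overlap c c').mem_nhds h] with b hb
    exact M.par_chart c' hb
  rw [mfderiv_eq_fderiv] at h1
  have h3 := h2.mfderiv_eq (I := 𝓘(𝕜, E)) (I' := 𝓘(𝕜, E))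
  have h4 : (M.dpar c a : E →L[𝕜] E) = _ := h3.symm.trans h1
  exact DFunLike.congr_fun h4 v

end ParamManifold

/-- A manifold with a distribution of rank `d + 1`. The distribution is a subspace `dist p` of each
tangent space; in each chart it is spanned by an analytic frame, for which there is an analytic
dual family of one-forms. -/
structure DistManifold (𝕜 E : Type u) [RCLike 𝕜] [NormedAddCommGroup E] [NormedSpace 𝕜 E]
    (d : ℕ) where
  man : ParamManifold 𝕜 E
  dist : ∀ p : man.Pt, Submodule 𝕜 (TangentSpace 𝓘(𝕜, E) p)
  frame : man.ι → Fin (d + 1) → E → E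
  coframe : man.ι → Fin (d + 1) → E → (E →L[𝕜] 𝕜)
  contDiff_frame : ∀ c j, ContDiff 𝕜 ω (frame c j)
  contDiff_coframe : ∀ c j, ContDiff 𝕜 ω (coframe c j)
  coframe_frame : ∀ c i j a, coframe c i a (frame c j a) = if i = j then 1 else 0
  dist_eq : ∀ c a, dist (man.par c a) =
    Submodule.span 𝕜 (range fun j => man.dpar c a (frame c j a))

namespace DistManifold

variable {𝕜 E : Type u} [RCLike 𝕜] [NormedAddCommGroup E] [NormedSpace 𝕜 E] {d : ℕ}
  (M : DistManifold 𝕜 E d)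

/-- A point of the projectivization `ℙD` of the distribution `D`: a point `z` together with a line
`ℓ ⊂ D(z)`. -/
@[ext]
structure Proj where
  base : M.man.Pt
  line : Submodule 𝕜 (TangentSpace 𝓘(𝕜, E) base)
  finrank_line : Module.finrank 𝕜 line = 1
  line_le : line ≤ M.dist base

/-- Homogeneous coordinates `(h_j)` with `h_i = 1`, the other ones being `u`. -/
def hom (i : Fin (d + 1)) (u : Fin d → 𝕜) : Fin (d + 1) → 𝕜 := i.insertNth (α := fun _ => 𝕜) 1 u

@[simp] theorem hom_same (i : Fin (d + 1)) (u : Fin d → 𝕜) : hom i u i = 1 := by simp [hom]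

@[simp] theorem hom_succAbove (i : Fin (d + 1)) (u : Fin d → 𝕜) (j : Fin d) :
    hom i u (i.succAbove j) = u j := by simp [hom]

theorem contDiff_hom (i j : Fin (d + 1)) : ContDiff 𝕜 ω (fun u : Fin d → 𝕜 => hom i u j) := by
  refine Fin.succAboveCases i ?_ (fun l => ?_) j
  · simpa using contDiff_const
  · simpa using contDiff_apply 𝕜 𝕜 l

/-- The vector `X_i + ∑ u_j X_j` spanning the line with affine coordinates `u`. -/
noncomputable def vec (c : M.man.ι) (i : Fin (d + 1)) (a : E) (u : Fin d → 𝕜) : E :=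
  ∑ j, hom i u j • M.frame c j a

theorem coframe_sum (c : M.man.ι) (j : Fin (d + 1)) (a : E) (h : Fin (d + 1) → 𝕜) :
    M.coframe c j a (∑ l, h l • M.frame c l a) = h j := by
  simp [M.coframe_frame]

theorem coframe_vec (c : M.man.ι) (i j : Fin (d + 1)) (a : E) (u : Fin d → 𝕜) :
    M.coframe c j a (M.vec c i a u) = hom i u j := M.coframe_sum c j a _

theorem vec_ne_zero (c : M.man.ι) (i : Fin (d + 1)) (a : E) (u : Fin d → 𝕜) : M.vec c i a u ≠ 0 := by
  intro h
  have := M.coframe_vec c i i a u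
  simp [h] at this

theorem dpar_mem_dist {c : M.man.ι} {a v : E} :
    M.man.dpar c a v ∈ M.dist (M.man.par c a) ↔ v ∈ Submodule.span 𝕜 (range fun j => M.frame c j a) := by
  have : Submodule.span 𝕜 (range fun j => M.man.dpar c a (M.frame c j a)) =
      (Submodule.span 𝕜 (range fun j => M.frame c j a)).map (M.man.dpar c a).toLinearMap := by
    rw [Submodule.map_span, ← range_comp]
    rfl
  rw [M.dist_eq, this, Submodule.mem_map]
  constructor
  · rintro ⟨w, hw, h⟩
    rwa [← M.man.dpar_injective c a h]
  · exact fun h => ⟨v, h, rfl⟩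

theorem vec_mem (c : M.man.ι) (i : Fin (d + 1)) (a : E) (u : Fin d → 𝕜) :
    M.vec c i a u ∈ Submodule.span 𝕜 (range fun j => M.frame c j a) :=
  Submodule.sum_mem _ fun j _ => Submodule.smul_mem _ _ (Submodule.subset_span ⟨j, rfl⟩)

theorem eq_sum_of_mem {c : M.man.ι} {a v : E}
    (hv : v ∈ Submodule.span 𝕜 (range fun j => M.frame c j a)) :
    v = ∑ j, M.coframe c j a v • M.frame c j a := by
  obtain ⟨h, rfl⟩ := (Submodule.mem_span_range_iff_exists_fun 𝕜).1 hv
  simp only [M.coframe_sum]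

/-- The parametrization of an open subset of `ℙD` by `E × 𝕜ᵈ`: affine coordinates on the lines. -/
noncomputable def projPar (c : M.man.ι × Fin (d + 1)) (x : E × (Fin d → 𝕜)) : M.Proj where
  base := M.man.par c.1 x.1
  line := Submodule.span 𝕜 {M.man.dpar c.1 x.1 (M.vec c.1 c.2 x.1 x.2)}
  finrank_line := finrank_span_singleton fun h => M.vec_ne_zero c.1 c.2 x.1 x.2 <|
    M.man.dpar_injective c.1 x.1 (h.trans (map_zero _).symm)
  line_le := (Submodule.span_singleton_le_iff_mem _ _).2 (M.dpar_mem_dist.2 (M.vec_mem _ _ _ _))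

theorem projPar_injective (c : M.man.ι × Fin (d + 1)) : Function.Injective (M.projPar c) := by
  rintro ⟨a, u⟩ ⟨b, v⟩ h
  have hab : a = b := M.man.par_injective c.1 (congrArg Proj.base h)
  subst hab
  have h2 : Submodule.span 𝕜 {M.man.dpar c.1 a (M.vec c.1 c.2 a u)} =
      Submodule.span 𝕜 {M.man.dpar c.1 a (M.vec c.1 c.2 a v)} := by
    simpa using! (Proj.ext_iff.1 h).2
  obtain ⟨z, hz⟩ := Submodule.mem_span_singleton.1 (h2 ▸ Submodule.mem_span_singleton_self _ :
    M.man.dpar c.1 a (M.vec c.1 c.2 a v) ∈ Submodule.span 𝕜 {M.man.dpar c.1 a (M.vec c.1 c.2 a u)})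
  rw [← map_smul] at hz
  have hz := M.man.dpar_injective c.1 a hz
  have h3 : ∀ j, z * hom c.2 u j = hom c.2 v j := fun j => by
    rw [← M.coframe_vec c.1 c.2 j a u, ← M.coframe_vec c.1 c.2 j a v, ← hz, map_smul, smul_eq_mul]
  have hz1 : z = 1 := by simpa using h3 c.2
  ext j
  · rfl
  · simpa [hz1] using h3 (c.2.succAbove j)

/-- The homogeneous coordinates, in the chart `c'`, of the line with coordinates `x` in the
chart `c`. -/
noncomputable def coord (c : M.man.ι × Fin (d + 1)) (c' : M.man.ι) (j : Fin (d + 1))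
    (x : E × (Fin d → 𝕜)) : 𝕜 :=
  M.coframe c' j (M.man.chart c' (M.man.par c.1 x.1))
    (fderiv 𝕜 (fun a => M.man.chart c' (M.man.par c.1 a)) x.1 (M.vec c.1 c.2 x.1 x.2))

theorem isOpen_base_overlap (c : M.man.ι × Fin (d + 1)) (c' : M.man.ι) :
    IsOpen {x : E × (Fin d → 𝕜) | M.man.par c.1 x.1 ∈ range (M.man.par c')} :=
  (M.man.isOpen_overlap c.1 c').preimage continuous_fst

theorem contDiff_vec (c : M.man.ι) (i : Fin (d + 1)) :
    ContDiff 𝕜 ω (fun x : E × (Fin d → 𝕜) => M.vec c i x.1 x.2) :=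
  ContDiff.sum fun j _ => ((contDiff_hom i j).comp contDiff_snd).smul
    ((M.contDiff_frame c j).comp contDiff_fst)

theorem contDiffOn_base_transition (c : M.man.ι × Fin (d + 1)) (c' : M.man.ι) :
    ContDiffOn 𝕜 ω (fun x : E × (Fin d → 𝕜) => M.man.chart c' (M.man.par c.1 x.1))
      {x : E × (Fin d → 𝕜) | M.man.par c.1 x.1 ∈ range (M.man.par c')} :=
  (M.man.contDiffOn_transition c.1 c').comp contDiffOn_fst fun _ hx => hx

theorem contDiffOn_coord (c : M.man.ι × Fin (d + 1)) (c' : M.man.ι) (j : Fin (d + 1)) :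
    ContDiffOn 𝕜 ω (M.coord c c' j)
      {x : E × (Fin d → 𝕜) | M.man.par c.1 x.1 ∈ range (M.man.par c')} := by
  have h1 := ((M.man.contDiffOn_transition c.1 c').fderiv_of_isOpen (m := ω)
    (M.man.isOpen_overlap c.1 c') le_top).comp (contDiffOn_fst (F := Fin d → 𝕜)
      (s := {x : E × (Fin d → 𝕜) | M.man.par c.1 x.1 ∈ range (M.man.par c')})) fun _ hx => hx
  exact ((M.contDiff_coframe c' j).comp_contDiffOn (M.contDiffOn_base_transition c c')).clm_apply
    (h1.clm_apply (M.contDiff_vec c.1 c.2).contDiffOn)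

theorem fderiv_vec_eq {c : M.man.ι × Fin (d + 1)} {c' : M.man.ι} {x : E × (Fin d → 𝕜)}
    (h : M.man.par c.1 x.1 ∈ range (M.man.par c')) :
    fderiv 𝕜 (fun a => M.man.chart c' (M.man.par c.1 a)) x.1 (M.vec c.1 c.2 x.1 x.2) =
      ∑ j, M.coord c c' j x • M.frame c' j (M.man.chart c' (M.man.par c.1 x.1)) := by
  apply M.eq_sum_of_mem
  rw [← M.dpar_mem_dist]
  have h1 : M.man.dpar c.1 x.1 (M.vec c.1 c.2 x.1 x.2) ∈ M.dist (M.man.par c.1 x.1) :=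
    M.dpar_mem_dist.2 (M.vec_mem _ _ _ _)
  have key : ∀ p q : M.man.Pt, p = q → ∀ v w : E, v = w →
      (show TangentSpace 𝓘(𝕜, E) p from v) ∈ M.dist p →
      (show TangentSpace 𝓘(𝕜, E) q from w) ∈ M.dist q := by
    rintro p _ rfl v _ rfl h
    exact h
  exact key _ _ (M.man.par_chart c' h).symm _ _ (M.man.dpar_transition h _) h1

theorem proj_eq {q q' : M.Proj} (h : q.base = q'.base)
    (h' : (q.line : Submodule 𝕜 E) = q'.line) : q = q' := by
  obtain ⟨b, l, _, _⟩ := q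
  obtain ⟨b', l', _, _⟩ := q'
  obtain rfl : b = b' := h
  obtain rfl : l = l' := h'
  rfl


/-- The affine coordinates, in the chart `c'`, of the line with coordinates `x` in the
chart `c`. -/
noncomputable def projTrans (c c' : M.man.ι × Fin (d + 1)) (x : E × (Fin d → 𝕜)) :
    E × (Fin d → 𝕜) :=
  (M.man.chart c'.1 (M.man.par c.1 x.1),
    fun j => M.coord c c'.1 (c'.2.succAbove j) x / M.coord c c'.1 c'.2 x)

theorem coord_smul_vec {c c' : M.man.ι × Fin (d + 1)} {x : E × (Fin d → 𝕜)}
    (h : M.man.par c.1 x.1 ∈ range (M.man.par c'.1)) (h' : M.coord c c'.1 c'.2 x ≠ 0) :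
    fderiv 𝕜 (fun a => M.man.chart c'.1 (M.man.par c.1 a)) x.1 (M.vec c.1 c.2 x.1 x.2) =
      M.coord c c'.1 c'.2 x •
        M.vec c'.1 c'.2 (M.projTrans c c' x).1 (M.projTrans c c' x).2 := by
  rw [M.fderiv_vec_eq h, vec, Finset.smul_sum]
  refine Finset.sum_congr rfl fun j _ => ?_
  rw [smul_smul]
  congr 1
  refine Fin.succAboveCases c'.2 ?_ (fun l => ?_) j
  · simp
  · simp [projTrans, mul_div_cancel₀ _ h']

theorem projPar_projTrans {c c' : M.man.ι × Fin (d + 1)} {x : E × (Fin d → 𝕜)}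
    (h : M.man.par c.1 x.1 ∈ range (M.man.par c'.1)) (h' : M.coord c c'.1 c'.2 x ≠ 0) :
    M.projPar c' (M.projTrans c c' x) = M.projPar c x := by
  refine M.proj_eq (M.man.par_chart c'.1 h) ?_
  have h1 := M.man.dpar_transition h (M.vec c.1 c.2 x.1 x.2)
  rw [M.coord_smul_vec h h'] at h1
  have key : ∀ (A : E →L[𝕜] E) (z : 𝕜) (v w : E), z ≠ 0 → v = A (z • w) →
      Submodule.span 𝕜 {A w} = Submodule.span 𝕜 {v} := by
    rintro A z _ w hz rfl
    rw [map_smul]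
    exact (Submodule.span_singleton_smul_eq (IsUnit.mk0 _ hz) _).symm
  exact key (M.man.dpar c'.1 (M.projTrans c c' x).1) _ _ _ h' h1

theorem projPar_mem_range {c c' : M.man.ι × Fin (d + 1)} {x : E × (Fin d → 𝕜)} :
    M.projPar c x ∈ range (M.projPar c') ↔
      M.man.par c.1 x.1 ∈ range (M.man.par c'.1) ∧ M.coord c c'.1 c'.2 x ≠ 0 := by
  refine ⟨?_, fun h => ⟨_, M.projPar_projTrans h.1 h.2⟩⟩
  rintro ⟨y, hy⟩
  have hb : M.man.par c'.1 y.1 = M.man.par c.1 x.1 := congrArg Proj.base hy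
  have h : M.man.par c.1 x.1 ∈ range (M.man.par c'.1) := ⟨y.1, hb⟩
  refine ⟨h, fun h0 => ?_⟩
  have hy1 : M.man.chart c'.1 (M.man.par c.1 x.1) = y.1 := by rw [← hb, M.man.chart_par]
  have key : ∀ q q' : M.Proj, q = q' → ∀ (v : TangentSpace 𝓘(𝕜, E) q.base)
      (w : TangentSpace 𝓘(𝕜, E) q'.base), v ∈ q.line → q'.line = Submodule.span 𝕜 {w} →
      ∃ z : 𝕜, ((z • w : TangentSpace 𝓘(𝕜, E) q'.base) : E) = v := by
    rintro q _ rfl v w hv hw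
    rw [hw] at hv
    exact Submodule.mem_span_singleton.1 hv
  obtain ⟨z, hz⟩ := key _ _ hy.symm _ _ (Submodule.mem_span_singleton_self
    (M.man.dpar c.1 x.1 (M.vec c.1 c.2 x.1 x.2))) rfl
  have h2 := M.man.dpar_transition h (M.vec c.1 c.2 x.1 x.2)
  rw [hy1] at h2
  have h3 : M.man.dpar c'.1 y.1 (z • M.vec c'.1 c'.2 y.1 y.2) = M.man.dpar c'.1 y.1
      (fderiv 𝕜 (fun a => M.man.chart c'.1 (M.man.par c.1 a)) x.1 (M.vec c.1 c.2 x.1 x.2)) := by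
    rw [map_smul]
    exact hz.trans h2
  have h4 := M.man.dpar_injective _ _ h3
  rw [coord, hy1, ← h4, map_smul, M.coframe_vec, hom_same, smul_eq_mul, mul_one] at h0
  rw [h0, zero_smul] at h4
  rw [← h4, map_zero] at h2
  exact M.vec_ne_zero c.1 c.2 x.1 x.2 (M.man.dpar_injective c.1 x.1 (h2.trans (map_zero _).symm))

theorem exists_projPar (q : M.Proj) : ∃ i, q ∈ range (M.projPar (M.man.idx q.base, i)) := by
  obtain ⟨p, l, hl, hle⟩ := q
  obtain ⟨a, ha⟩ := M.man.mem_range p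
  generalize M.man.idx p = c at ha
  subst ha
  obtain ⟨v, hv0, hv⟩ := finrank_eq_one_iff'.1 hl
  obtain ⟨w, hw⟩ : ∃ w, M.man.dpar c a w = (v : TangentSpace 𝓘(𝕜, E) (M.man.par c a)) :=
    ⟨_, M.man.dpar_dchart c a _⟩
  have hwm := M.eq_sum_of_mem (M.dpar_mem_dist.1 (hw ▸ hle v.2))
  obtain ⟨i, hi⟩ : ∃ i, M.coframe c i a w ≠ 0 := by
    by_contra! h
    simp only [h, zero_smul, Finset.sum_const_zero] at hwm
    rw [hwm, map_zero] at hw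
    exact hv0 (Subtype.ext hw.symm)
  refine ⟨i, ⟨a, fun j => M.coframe c (i.succAbove j) a w / M.coframe c i a w⟩, ?_⟩
  refine M.proj_eq rfl ?_
  have h1 : w = M.coframe c i a w • M.vec c i a
      (fun j => M.coframe c (i.succAbove j) a w / M.coframe c i a w) := by
    conv_lhs => rw [hwm]
    rw [vec, Finset.smul_sum]
    refine Finset.sum_congr rfl fun j _ => ?_
    rw [smul_smul]
    congr 1
    refine Fin.succAboveCases i ?_ (fun l => ?_) j
    · simp
    · simp [mul_div_cancel₀ _ hi]
  have h2 : l = Submodule.span 𝕜 {M.man.dpar c a w} := by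
    apply le_antisymm
    · intro x hx
      obtain ⟨z, hz⟩ := hv ⟨x, hx⟩
      rw [hw]
      exact Submodule.mem_span_singleton.2 ⟨z, congrArg Subtype.val hz⟩
    · rw [Submodule.span_singleton_le_iff_mem, hw]
      exact v.2
  have h3 : Submodule.span 𝕜 {M.man.dpar c a w} = Submodule.span 𝕜 {M.man.dpar c a (M.vec c i a
      (fun j => M.coframe c (i.succAbove j) a w / M.coframe c i a w))} := by
    conv_lhs => rw [h1, map_smul]
    exact Submodule.span_singleton_smul_eq (IsUnit.mk0 _ hi) _
  exact (h2.trans h3).symm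

/-- The manifold `ℙD`. -/
noncomputable def projManifold : ParamManifold 𝕜 (E × (Fin d → 𝕜)) where
  Pt := M.Proj
  ι := M.man.ι × Fin (d + 1)
  par := M.projPar
  par_injective := M.projPar_injective
  idx q := (M.man.idx q.base, (M.exists_projPar q).choose)
  mem_range q := (M.exists_projPar q).choose_spec
  isOpen_overlap c c' := by
    simp only [M.projPar_mem_range]
    exact (M.contDiffOn_coord c c'.1 c'.2).continuousOn.isOpen_inter_preimage
      (M.isOpen_base_overlap c c'.1) isOpen_ne
  contDiffOn_transition c c' := by
    have h : ContDiffOn 𝕜 ω (M.projTrans c c') {x | M.projPar c x ∈ range (M.projPar c')} := by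
      have hs : {x | M.projPar c x ∈ range (M.projPar c')} ⊆
          {x | M.man.par c.1 x.1 ∈ range (M.man.par c'.1)} := fun x hx =>
        (M.projPar_mem_range.1 hx).1
      exact ((M.contDiffOn_base_transition c c'.1).mono hs).prodMk <| contDiffOn_pi.2 fun j =>
        ((M.contDiffOn_coord c c'.1 _).mono hs).div ((M.contDiffOn_coord c c'.1 _).mono hs)
          fun x hx => (M.projPar_mem_range.1 hx).2
    refine h.congr fun x hx => ?_
    have hx' := M.projPar_mem_range.1 hx
    rw [← M.projPar_projTrans hx'.1 hx'.2]
    exact Function.leftInverse_invFun (M.projPar_injective c') _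

/-- The projection `π : ℙD → Z`. -/
def π (q : M.projManifold.Pt) : M.man.Pt := Proj.base q

/-- The line `ℓ` of a point `(z, ℓ)` of `ℙD`. -/
def lineOf (q : M.projManifold.Pt) : Submodule 𝕜 (TangentSpace 𝓘(𝕜, E) (M.π q)) := Proj.line q

/-- The prolonged distribution `D¹(z, ℓ) = dπ⁻¹(ℓ)`. -/
noncomputable def projDist (q : M.projManifold.Pt) :
    Submodule 𝕜 (TangentSpace 𝓘(𝕜, E × (Fin d → 𝕜)) q) :=
  (M.lineOf q).comap (mfderiv 𝓘(𝕜, E × (Fin d → 𝕜)) 𝓘(𝕜, E) M.π q).toLinearMap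

theorem mdifferentiableAt_π (q : M.projManifold.Pt) :
    MDifferentiableAt 𝓘(𝕜, E × (Fin d → 𝕜)) 𝓘(𝕜, E) M.π q := by
  obtain ⟨x, hx⟩ := M.projManifold.mem_range q
  generalize M.projManifold.idx q = c at hx
  subst hx
  have h1 := M.projManifold.mdifferentiableAt_chart c x
  have h2 : MDifferentiableAt 𝓘(𝕜, E × (Fin d → 𝕜)) 𝓘(𝕜, E)
      (fun y : E × (Fin d → 𝕜) => M.man.par c.1 y.1)
      (M.projManifold.chart c (M.projManifold.par c x)) :=
    (M.man.mdifferentiableAt_par c.1 _).comp _ differentiableAt_fst.mdifferentiableAt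
  refine (h2.comp _ h1).congr_of_eventuallyEq ?_
  filter_upwards [(M.projManifold.isOpen_range_par c).mem_nhds (mem_range_self x)] with p hp
  conv_lhs => rw [← M.projManifold.par_chart c hp]
  rfl

theorem dπ_dpar (c : M.projManifold.ι) (x v : E × (Fin d → 𝕜)) :
    mfderiv 𝓘(𝕜, E × (Fin d → 𝕜)) 𝓘(𝕜, E) M.π (M.projManifold.par c x)
      (M.projManifold.dpar c x v) = M.man.dpar c.1 x.1 v.1 := by
  have h1 := mfderiv_comp x (M.mdifferentiableAt_π (M.projManifold.par c x))
    (M.projManifold.mdifferentiableAt_par c x)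
  have h2 := mfderiv_comp x (M.man.mdifferentiableAt_par c.1 x.1)
    (differentiableAt_fst (𝕜 := 𝕜) (p := x)).mdifferentiableAt
  have h3 : M.π ∘ M.projManifold.par c = M.man.par c.1 ∘ Prod.fst := rfl
  rw [h3, h2, mfderiv_eq_fderiv, fderiv_fst] at h1
  exact (DFunLike.congr_fun h1 v).symm

/-- The frame `X_i + ∑ u_j X_j`, `∂/∂u_j` of the prolonged distribution. -/
noncomputable def projFrame (c : M.man.ι × Fin (d + 1)) (j : Fin (d + 1)) (x : E × (Fin d → 𝕜)) :
    E × (Fin d → 𝕜) :=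
  c.2.insertNth (α := fun _ => E × (Fin d → 𝕜)) (M.vec c.1 c.2 x.1 x.2, 0)
    (fun l => (0, Pi.single l 1)) j

/-- The one-forms `θ_i`, `du_j` dual to the frame of the prolonged distribution. -/
noncomputable def projCoframe (c : M.man.ι × Fin (d + 1)) (j : Fin (d + 1))
    (x : E × (Fin d → 𝕜)) : E × (Fin d → 𝕜) →L[𝕜] 𝕜 :=
  c.2.insertNth (α := fun _ => E × (Fin d → 𝕜) →L[𝕜] 𝕜)
    ((M.coframe c.1 c.2 x.1).comp (ContinuousLinearMap.fst 𝕜 E (Fin d → 𝕜)))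
    (fun l => (ContinuousLinearMap.proj l).comp (ContinuousLinearMap.snd 𝕜 E (Fin d → 𝕜))) j

theorem projFrame_same (c : M.man.ι × Fin (d + 1)) :
    M.projFrame c c.2 = fun x => (M.vec c.1 c.2 x.1 x.2, 0) := by
  ext1 x
  simp [projFrame]

theorem projFrame_succAbove (c : M.man.ι × Fin (d + 1)) (l : Fin d) :
    M.projFrame c (c.2.succAbove l) = fun _ => (0, Pi.single l 1) := by
  ext1 x
  simp [projFrame]

theorem projCoframe_same (c : M.man.ι × Fin (d + 1)) : M.projCoframe c c.2 = fun x =>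
    (M.coframe c.1 c.2 x.1).comp (ContinuousLinearMap.fst 𝕜 E (Fin d → 𝕜)) := by
  ext1 x
  simp [projCoframe]

theorem projCoframe_succAbove (c : M.man.ι × Fin (d + 1)) (l : Fin d) :
    M.projCoframe c (c.2.succAbove l) = fun _ =>
      (ContinuousLinearMap.proj l).comp (ContinuousLinearMap.snd 𝕜 E (Fin d → 𝕜)) := by
  ext1 x
  simp [projCoframe]

theorem mem_span_projFrame {c : M.man.ι × Fin (d + 1)} {x v : E × (Fin d → 𝕜)} :
    v ∈ Submodule.span 𝕜 (range fun j => M.projFrame c j x) ↔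
      v.1 ∈ Submodule.span 𝕜 {M.vec c.1 c.2 x.1 x.2} := by
  rw [Submodule.mem_span_range_iff_exists_fun, Submodule.mem_span_singleton]
  constructor
  · rintro ⟨h, rfl⟩
    refine ⟨h c.2, ?_⟩
    rw [Fin.sum_univ_succAbove _ c.2]
    simp [projFrame, Prod.fst_sum]
  · rintro ⟨z, hz⟩
    refine ⟨c.2.insertNth (α := fun _ => 𝕜) z v.2, ?_⟩
    rw [Fin.sum_univ_succAbove _ c.2]
    refine Prod.ext ?_ ?_
    · simp [projFrame, Prod.fst_sum, hz]
    · simp only [projFrame, Fin.insertNth_apply_same, Fin.insertNth_apply_succAbove, Prod.snd_add,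
        Prod.snd_sum, Prod.smul_snd, smul_zero, zero_add]
      ext l
      simp [Pi.single_apply]

/-- The Cartan prolongation `(ℙD, D¹)` of a manifold with distribution `(Z, D)`. -/
noncomputable def prolong : DistManifold 𝕜 (E × (Fin d → 𝕜)) d where
  man := M.projManifold
  dist := M.projDist
  frame := M.projFrame
  coframe := M.projCoframe
  contDiff_frame c j := by
    refine Fin.succAboveCases c.2 ?_ (fun l => ?_) j
    · exact (M.projFrame_same c) ▸ (M.contDiff_vec c.1 c.2).prodMk contDiff_const
    · exact (M.projFrame_succAbove c l) ▸ contDiff_const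
  contDiff_coframe c j := by
    refine Fin.succAboveCases c.2 ?_ (fun l => ?_) j
    · exact (M.projCoframe_same c) ▸
        ((M.contDiff_coframe c.1 c.2).comp contDiff_fst).clm_comp contDiff_const
    · exact (M.projCoframe_succAbove c l) ▸ contDiff_const
  coframe_frame c i j x := by
    refine Fin.succAboveCases c.2 ?_ (fun l => ?_) j <;>
      refine Fin.succAboveCases c.2 ?_ (fun l' => ?_) i <;>
      simp [projFrame, projCoframe, M.coframe_vec, Pi.single_apply, Fin.succAbove_ne,
        (Fin.succAbove_ne _ _).symm]
  dist_eq c x := by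
    have h1 : Submodule.span 𝕜 (range fun j => M.projManifold.dpar c x (M.projFrame c j x)) =
        (Submodule.span 𝕜 (range fun j => M.projFrame c j x)).map
          (M.projManifold.dpar c x).toLinearMap := by
      rw [Submodule.map_span, ← range_comp]
      rfl
    rw [h1]
    ext w
    obtain ⟨v, rfl⟩ : ∃ v, M.projManifold.dpar c x v = w := ⟨_, M.projManifold.dpar_dchart c x w⟩
    have h2 : M.projManifold.dpar c x v ∈ (Submodule.span 𝕜 (range fun j => M.projFrame c j x)).map
        (M.projManifold.dpar c x).toLinearMap ↔
        v ∈ Submodule.span 𝕜 (range fun j => M.projFrame c j x) := by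
      refine ⟨?_, fun h => ⟨v, h, rfl⟩⟩
      rintro ⟨u, hu, h⟩
      rwa [← M.projManifold.dpar_injective c x h]
    have h4 : M.man.dpar c.1 x.1 v.1 ∈ Submodule.span 𝕜 {M.man.dpar c.1 x.1
        (M.vec c.1 c.2 x.1 x.2)} ↔ v.1 ∈ Submodule.span 𝕜 {M.vec c.1 c.2 x.1 x.2} := by
      rw [Submodule.mem_span_singleton, Submodule.mem_span_singleton]
      refine exists_congr fun z => ?_
      rw [← map_smul]
      exact (M.man.dpar_injective c.1 x.1).eq_iff
    have h5 : M.projManifold.dpar c x v ∈ M.projDist (M.projManifold.par c x) ↔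
        M.man.dpar c.1 x.1 v.1 ∈ Submodule.span 𝕜 {M.man.dpar c.1 x.1
          (M.vec c.1 c.2 x.1 x.2)} := by
      rw [← M.dπ_dpar c x v]
      rfl
    exact h5.trans (h4.trans (M.mem_span_projFrame.symm.trans h2.symm))

end DistManifold

/-! ### Tangent vectors of subsets, prolongation of maps -/

/-- The tangent vectors at `p` to a subset `S` of a manifold: the velocities at `t = 0` of the
analytic curve germs through `p` that stay in `S`. For an embedded submanifold `S` this is its
tangent space `T_p S`. -/
def ParamManifold.tangentSet {𝕜 E : Type u} [RCLike 𝕜] [NormedAddCommGroup E] [NormedSpace 𝕜 E]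
    (M : ParamManifold 𝕜 E) (S : Set M.Pt) (p : M.Pt) : Set (TangentSpace 𝓘(𝕜, E) p) :=
  {v | ∃ γ : 𝕜 → M.Pt, γ 0 = p ∧ ContMDiffAt 𝓘(𝕜, 𝕜) 𝓘(𝕜, E) ω γ 0 ∧ (∀ᶠ t in 𝓝 0, γ t ∈ S) ∧
    (mfderiv 𝓘(𝕜, 𝕜) 𝓘(𝕜, E) γ 0 (1 : 𝕜) : E) = v}

open Classical in
/-- The prolongation `φ¹(z, ℓ) = (φ(z), dφ_z(ℓ))` of a map `φ`. The right-hand side is a point of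
`ℙD` wherever `φ` is a local symmetry of the distribution; elsewhere `φ¹` has the dummy value
`(z, ℓ)`. -/
noncomputable def DistManifold.prolongMap {𝕜 E : Type u} [RCLike 𝕜] [NormedAddCommGroup E]
    [NormedSpace 𝕜 E] {d : ℕ} (M : DistManifold 𝕜 E d) (φ : M.man.Pt → M.man.Pt)
    (q : M.prolong.man.Pt) : M.prolong.man.Pt :=
  if h : Module.finrank 𝕜 ((M.lineOf q).map
      (mfderiv 𝓘(𝕜, E) 𝓘(𝕜, E) φ (M.π q)).toLinearMap) = 1 ∧
      (M.lineOf q).map (mfderiv 𝓘(𝕜, E) 𝓘(𝕜, E) φ (M.π q)).toLinearMap ≤ M.dist (φ (M.π q)) then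
    (⟨φ (M.π q), (M.lineOf q).map (mfderiv 𝓘(𝕜, E) 𝓘(𝕜, E) φ (M.π q)).toLinearMap, h.1, h.2⟩ :
      M.Proj)
  else q

/-! ### The Monster tower of `𝕜ⁿ`, `n = d + 1` -/

namespace Monster

variable (𝕜 : Type u) [RCLike 𝕜] (d : ℕ)

/-- The model vector space `𝕜ⁿ × (𝕜ⁿ⁻¹)ᵏ` of the `k`-th level, `n = d + 1`. -/
def Model : ℕ → Type u
  | 0 => Fin (d + 1) → 𝕜
  | k + 1 => Model k × (Fin d → 𝕜)

noncomputable instance instGroup : ∀ k, NormedAddCommGroup (Model 𝕜 d k)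
  | 0 => inferInstanceAs (NormedAddCommGroup (Fin (d + 1) → 𝕜))
  | k + 1 =>
    letI := instGroup k
    inferInstanceAs (NormedAddCommGroup (Model 𝕜 d k × (Fin d → 𝕜)))

noncomputable instance instSpace : ∀ k, NormedSpace 𝕜 (Model 𝕜 d k)
  | 0 => inferInstanceAs (NormedSpace 𝕜 (Fin (d + 1) → 𝕜))
  | k + 1 =>
    letI := instSpace k
    inferInstanceAs (NormedSpace 𝕜 (Model 𝕜 d k × (Fin d → 𝕜)))

/-- The manifold `𝕜ⁿ`, with one chart. -/
noncomputable def baseManifold : ParamManifold 𝕜 (Fin (d + 1) → 𝕜) where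
  Pt := Fin (d + 1) → 𝕜
  ι := Unit
  par _ := id
  par_injective _ := Function.injective_id
  idx _ := ()
  mem_range p := ⟨p, rfl⟩
  isOpen_overlap _ _ := by simp
  contDiffOn_transition _ _ := by
    have h : (fun a : Fin (d + 1) → 𝕜 => Function.invFun id (id a)) = id :=
      funext fun a => Function.leftInverse_invFun Function.injective_id a
    rw [h]
    exact contDiffOn_id

/-- `(𝕜ⁿ, T𝕜ⁿ)`. -/
noncomputable def base : DistManifold 𝕜 (Fin (d + 1) → 𝕜) d where
  man := baseManifold 𝕜 d
  dist _ := ⊤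
  frame _ j _ := Pi.single j 1
  coframe _ j _ := ContinuousLinearMap.proj j
  contDiff_frame _ _ := contDiff_const
  contDiff_coframe _ _ := contDiff_const
  coframe_frame _ i j _ := by simp [Pi.single_apply]
  dist_eq c a := by
    symm
    rw [eq_top_iff]
    intro w _
    obtain ⟨v, rfl⟩ : ∃ v, (baseManifold 𝕜 d).dpar c a v = w :=
      ⟨_, (baseManifold 𝕜 d).dpar_dchart c a w⟩
    rw [pi_eq_sum_univ' v, map_sum]
    refine Submodule.sum_mem _ fun j _ => ?_
    rw [map_smul]
    refine Submodule.smul_mem _ _ (Submodule.subset_span ⟨j, ?_⟩)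
    congr 1

/-- The `k`-th level `(𝒫ᵏ(n), Δ_k)` of the Monster tower, `n = d + 1`. -/
noncomputable def tower : (k : ℕ) → DistManifold 𝕜 (Model 𝕜 d k) d
  | 0 => base 𝕜 d
  | k + 1 => (tower k).prolong

/-- The points of `𝒫ᵏ(n)`, `n = d + 1`. -/
abbrev P (k : ℕ) : Type u := (tower 𝕜 d k).man.Pt

variable {𝕜 d}

/-- The projection `π_{k+1,k} : 𝒫ᵏ⁺¹(n) → 𝒫ᵏ(n)`. -/
noncomputable def proj (k : ℕ) (q : P 𝕜 d (k + 1)) : P 𝕜 d k := (tower 𝕜 d k).π q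

/-- The line `ℓ` one level down corresponding to a point `(p, ℓ)` of `𝒫ᵏ⁺¹(n)`. -/
noncomputable def line (k : ℕ) (q : P 𝕜 d (k + 1)) :
    Submodule 𝕜 (TangentSpace 𝓘(𝕜, Model 𝕜 d k) (proj k q)) := (tower 𝕜 d k).lineOf q

/-- The projection `π_{k,0} : 𝒫ᵏ(n) → 𝕜ⁿ`. -/
noncomputable def toBase : (k : ℕ) → P 𝕜 d k → (Fin (d + 1) → 𝕜)
  | 0, p => p
  | k + 1, q => toBase k (proj k q)

/-- The `k`-th prolongation `ψᵏ` of a map `ψ`; only its values over points near which `ψ` is a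
diffeomorphism are meaningful. -/
noncomputable def prolongation (ψ : (Fin (d + 1) → 𝕜) → (Fin (d + 1) → 𝕜)) :
    (k : ℕ) → P 𝕜 d k → P 𝕜 d k
  | 0 => ψ
  | k + 1 => (tower 𝕜 d k).prolongMap (prolongation ψ k)

/-- `p ∼ q`: there is a local analytic diffeomorphism `ψ` of `𝕜ⁿ`, defined near `π_{k,0}(p)`, with
`ψᵏ(p) = q`. -/
def Equivalent {k : ℕ} (p q : P 𝕜 d k) : Prop :=
  ∃ ψ : OpenPartialHomeomorph (Fin (d + 1) → 𝕜) (Fin (d + 1) → 𝕜),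
    AnalyticOnNhd 𝕜 ψ ψ.source ∧ AnalyticOnNhd 𝕜 ψ.symm ψ.target ∧
    toBase k p ∈ ψ.source ∧ prolongation ψ k p = q

/-- The `Diff(n)`-orbit of `p`. -/
def orbit {k : ℕ} (p : P 𝕜 d k) : Set (P 𝕜 d k) := {q | Equivalent p q}

/-- The vertical space `V_{k+1}(p) = ker dπ_{k+1,k}(p)`. -/
noncomputable def vertical (k : ℕ) (p : P 𝕜 d (k + 1)) :
    Submodule 𝕜 (TangentSpace 𝓘(𝕜, Model 𝕜 d (k + 1)) p) :=
  LinearMap.ker (mfderiv 𝓘(𝕜, Model 𝕜 d (k + 1)) 𝓘(𝕜, Model 𝕜 d k) (proj k) p).toLinearMap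

/-- Vertical points: the corresponding line one level down is vertical. Points at levels `0` and
`1` are non-vertical. -/
def IsVertical : (k : ℕ) → P 𝕜 d k → Prop
  | 0, _ => False
  | 1, _ => False
  | k + 2, q => line (k + 1) q ≤ vertical k (proj (k + 1) q)

/-- The baby Monster `𝒫ʲ(F) ⊂ 𝒫ⁱ⁺¹⁺ʲ(n)` of the fiber `F` of `π_{i+1,i}` through the point `p` at
level `i + 1`. A point of `𝒫ʲ⁺¹(F)` is a point `z` of `𝒫ʲ(F)` together with a line in
`δ(z) = Δ(z) ∩ T_z 𝒫ʲ(F)`. -/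
def babyMonster {i : ℕ} (p : P 𝕜 d (i + 1)) : (j : ℕ) → Set (P 𝕜 d (i + 1 + j))
  | 0 => {q | proj i q = proj i p}
  | j + 1 => {q | proj (i + 1 + j) q ∈ babyMonster p j ∧ ∀ v ∈ line (i + 1 + j) q,
      v ∈ (tower 𝕜 d (i + 1 + j)).dist (proj (i + 1 + j) q) ∧
      v ∈ (tower 𝕜 d (i + 1 + j)).man.tangentSet (babyMonster p j) (proj (i + 1 + j) q)}

/-- Critical points: the corresponding line one level down lies in a critical hyperplane
`δ(z) = Δ(z) ∩ T_z 𝒫ʲ(F)` of the baby Monster of the fiber `F` through some point `p` of level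
at least one. -/
def IsCritical {k : ℕ} (q : P 𝕜 d k) : Prop :=
  ∃ (i j : ℕ) (p : P 𝕜 d (i + 1)) (q' : P 𝕜 d (i + 1 + (j + 1))),
    q' ∈ babyMonster p (j + 1) ∧ (⟨i + 1 + (j + 1), q'⟩ : Σ k, P 𝕜 d k) = ⟨k, q⟩

/-- The letters of RVT words: regular, vertical, tangency. -/
inductive Letter
  | R
  | V
  | T

open Classical in
/-- `V` for vertical points, `T` for critical points that are not vertical, `R` for regular
points. -/
noncomputable def letter {k : ℕ} (q : P 𝕜 d k) : Letter :=
  if IsVertical k q then Letter.V else if IsCritical q then Letter.T else Letter.R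

/-- The RVT code `ω_1 … ω_k` of a point at level `k`: `ω_i` is the letter of its projection to
level `i`. -/
noncomputable def code : (k : ℕ) → P 𝕜 d k → List Letter
  | 0, _ => []
  | k + 1, q => code k (proj k q) ++ [letter q]

variable (𝕜 d) in
/-- The RVT class of the word `w` at level `k`. -/
def rvtClass (k : ℕ) (w : List Letter) : Set (P 𝕜 d k) := {p | code k p = w}

/-- The word `Rᵏ V Rᵐ`. -/
def wordRVR (k m : ℕ) : List Letter :=
  List.replicate k Letter.R ++ Letter.V :: List.replicate m Letter.R

end Monster

/-! Write `k = n + 1`. A point of the class with `m ≥ 1` lies on the prolongation of a parametrized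
cusp in the base, and all the cusps that arise are equivalent as parametrized germs.

In coordinates, a point of the class has a distinguished index `i` at the first `n + 1` levels, and
an index `j ≠ i` from the letter `V` on. The letter `V` says that one fibre coordinate `v_l`
vanishes. The next `R` says that the corresponding coordinate `w_l` one level up does not vanish,
since `w_l = 0` cuts out the tangency hyperplane. Later letters `R` exclude vertical lines only,
because a critical point is vertical or lies over a critical point (`isCritical_cases`,
`tangent_vert_iff`, `code_cusp`).

Take the integral curve of the `j`-th frame field through the point. Along its projection, `x_i' =
lam` with `lam = v_l`, `lam(0) = 0` and `lam'(0) = w_l ≠ 0`, so a reparametrization gives `x_i = x₀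
+ κt²`. The remaining base coordinates are `(n + 1)`-fold integrals against `2κt dt` of a function
`u` with `u'(0) ≠ 0`. Each integration raises the order of the odd part by two, so they equal `A(t²)
+ t^(2n+3) B(t²)` with `B(0) ≠ 0` (`exists_cusp_through`, `IterInt.normal_form`). The exponent
depends only on `n`, and a fibered diffeomorphism takes any such cusp to any other
(`exists_diffeo_of_cusps`).

A horizontal curve is determined by its base projection when that projection is immersed off `0`
(`eventuallyEq_of_toBase`). Hence the prolonged diffeomorphism matches the lifted curves, and with
them the two given points (`equivalent_of_horizontal`). For `m = 0` the points are lifted to the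
class with one more `R` and the equivalence is projected. Conversely, codes are invariant under
prolonged diffeomorphisms (`code_eq_of_equivalent`). -/

namespace ParamManifold

/-! ### Analytic curves and their velocities in charts. -/

variable {𝕜 E : Type u} [RCLike 𝕜] [NormedAddCommGroup E] [NormedSpace 𝕜 E]
  (M : ParamManifold 𝕜 E)

theorem contMDiff_par (c : M.ι) : ContMDiff 𝓘(𝕜, E) 𝓘(𝕜, E) ω (M.par c) := by
  have h := contMDiffOn_symm_of_mem_maximalAtlas (I := 𝓘(𝕜, E)) (n := ω)
    (IsManifold.subset_maximalAtlas (M.homeo_mem_atlas c))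
  exact contMDiffOn_univ.1 h

theorem contMDiffOn_chart (c : M.ι) :
    ContMDiffOn 𝓘(𝕜, E) 𝓘(𝕜, E) ω (M.chart c) (range (M.par c)) :=
  contMDiffOn_of_mem_maximalAtlas (I := 𝓘(𝕜, E)) (n := ω)
    (IsManifold.subset_maximalAtlas (M.homeo_mem_atlas c))

theorem contMDiffAt_chart (c : M.ι) {p : M.Pt} (hp : p ∈ range (M.par c)) :
    ContMDiffAt 𝓘(𝕜, E) 𝓘(𝕜, E) ω (M.chart c) p :=
  (M.contMDiffOn_chart c).contMDiffAt ((M.isOpen_range_par c).mem_nhds hp)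

/-- The velocity of a curve, as an element of the model space. -/
noncomputable def vel (γ : 𝕜 → M.Pt) (t : 𝕜) : E :=
  (mfderiv 𝓘(𝕜, 𝕜) 𝓘(𝕜, E) γ t (1 : 𝕜) : E)

variable {M}

theorem vel_congr {γ γ' : 𝕜 → M.Pt} {t : 𝕜} (h : γ =ᶠ[𝓝 t] γ') : M.vel γ t = M.vel γ' t := by
  have := h.mfderiv_eq (I := 𝓘(𝕜, 𝕜)) (I' := 𝓘(𝕜, E))
  exact congrArg (fun L : 𝕜 →L[𝕜] E => L 1) this

theorem vel_par (c : M.ι) {a : 𝕜 → E} {a' : E} {t : 𝕜} (h : HasDerivAt a a' t) :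
    M.vel (fun t => M.par c (a t)) t = M.dpar c (a t) a' := by
  have h1 := mfderiv_comp t (M.mdifferentiableAt_par c (a t))
    h.differentiableAt.mdifferentiableAt
  rw [mfderiv_eq_fderiv, h.hasFDerivAt.fderiv] at h1
  have h2 := DFunLike.congr_fun h1 (1 : 𝕜)
  refine Eq.trans h2 ?_
  change M.dpar c (a t) ((1 : 𝕜) • a') = _
  rw [one_smul]

theorem exists_curve_chart {γ : 𝕜 → M.Pt} {t : 𝕜} (hγ : ContMDiffAt 𝓘(𝕜, 𝕜) 𝓘(𝕜, E) ω γ t)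
    {c : M.ι} (hc : γ t ∈ range (M.par c)) :
    ∃ a : 𝕜 → E, ContDiffAt 𝕜 ω a t ∧ γ =ᶠ[𝓝 t] fun s => M.par c (a s) := by
  refine ⟨fun s => M.chart c (γ s), ?_, ?_⟩
  · exact ((M.contMDiffAt_chart c hc).comp t hγ).contDiffAt
  · filter_upwards [hγ.continuousAt ((M.isOpen_range_par c).mem_nhds hc)] with s hs
    exact (M.par_chart c hs).symm

theorem contMDiffAt_par_comp (c : M.ι) {a : 𝕜 → E} {t : 𝕜} (h : ContDiffAt 𝕜 ω a t) :
    ContMDiffAt 𝓘(𝕜, 𝕜) 𝓘(𝕜, E) ω (fun s => M.par c (a s)) t :=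
  (M.contMDiff_par c).contMDiffAt.comp t h.contMDiffAt

theorem vel_comp {F : Type u} [NormedAddCommGroup F] [NormedSpace 𝕜 F] {N : ParamManifold 𝕜 F}
    {φ : M.Pt → N.Pt} {γ : 𝕜 → M.Pt} {t : 𝕜}
    (hφ : MDifferentiableAt 𝓘(𝕜, E) 𝓘(𝕜, F) φ (γ t))
    (hγ : MDifferentiableAt 𝓘(𝕜, 𝕜) 𝓘(𝕜, E) γ t) :
    N.vel (fun s => φ (γ s)) t = (mfderiv 𝓘(𝕜, E) 𝓘(𝕜, F) φ (γ t) : E →L[𝕜] F) (M.vel γ t) := by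
  have h1 := mfderiv_comp t hφ hγ
  exact DFunLike.congr_fun h1 (1 : 𝕜)

theorem exists_dpar_eq (c : M.ι) (a : E) (w : E) : ∃ v, (M.dpar c a v : E) = w :=
  ⟨_, M.dpar_dchart c a w⟩

end ParamManifold

/-! ### Points of `ℙD` in coordinates, and horizontal curves. -/

namespace DistManifold

variable {𝕜 E : Type u} [RCLike 𝕜] [NormedAddCommGroup E] [NormedSpace 𝕜 E] {d : ℕ}
  (M : DistManifold 𝕜 E d)

/-- The projection `ℙD → Z`. -/
noncomputable def pr (q : M.prolong.man.Pt) : M.man.Pt := M.π q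

/-- The line of a point of `ℙD`, in the model space. -/
noncomputable def ln (q : M.prolong.man.Pt) : Submodule 𝕜 E := M.lineOf q

/-- The distribution, in the model space. -/
def ds (p : M.man.Pt) : Submodule 𝕜 E := M.dist p

theorem contMDiffAt_pr (q : M.prolong.man.Pt) :
    ContMDiffAt 𝓘(𝕜, E × (Fin d → 𝕜)) 𝓘(𝕜, E) ω M.pr q := by
  obtain ⟨x, hx⟩ := M.projManifold.mem_range q
  generalize M.projManifold.idx q = c at hx
  subst hx
  have h1 := M.projManifold.contMDiffAt_chart c (mem_range_self x)
  have h2 : ContMDiffAt 𝓘(𝕜, E × (Fin d → 𝕜)) 𝓘(𝕜, E) ω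
      (fun y : E × (Fin d → 𝕜) => M.man.par c.1 y.1)
      (M.projManifold.chart c (M.projManifold.par c x)) :=
    (M.man.contMDiff_par c.1).contMDiffAt.comp _ contDiffAt_fst.contMDiffAt
  refine (h2.comp _ h1).congr_of_eventuallyEq ?_
  filter_upwards [(M.projManifold.isOpen_range_par c).mem_nhds (mem_range_self x)] with p hp
  conv_lhs => rw [← M.projManifold.par_chart c hp]
  rfl

/-- The differential of the projection `ℙD → Z`. -/
noncomputable def dpr (q : M.prolong.man.Pt) : E × (Fin d → 𝕜) →L[𝕜] E :=
  mfderiv 𝓘(𝕜, E × (Fin d → 𝕜)) 𝓘(𝕜, E) M.pr q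

variable {M} in
theorem mem_prolong_ds {q : M.prolong.man.Pt} {v : E × (Fin d → 𝕜)} :
    v ∈ M.prolong.ds q ↔ M.dpr q v ∈ M.ln q := Iff.rfl

theorem ln_le (q : M.prolong.man.Pt) : M.ln q ≤ M.ds (M.pr q) := Proj.line_le q

variable {M} in
-- Viewed in the common model space, lines at equal base points can be compared without transport
-- between tangent spaces.
theorem prolong_ext {q q' : M.prolong.man.Pt} (h : M.pr q = M.pr q') (h' : M.ln q = M.ln q') :
    q = q' := M.proj_eq h h'

/-- The chart of `ℙD` over `c` with distinguished index `i`. -/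
def pidx (c : M.man.ι) (i : Fin (d + 1)) : M.prolong.man.ι := (c, i)

theorem exists_pidx (c : M.prolong.man.ι) : ∃ c' i, c = M.pidx c' i := ⟨c.1, c.2, rfl⟩

@[simp] theorem pr_par (c : M.man.ι) (i : Fin (d + 1)) (x : E × (Fin d → 𝕜)) :
    M.pr (M.prolong.man.par (M.pidx c i) x) = M.man.par c x.1 := rfl

/-- The derivative of a parametrization, as a map of the model space. -/
noncomputable def dP (c : M.man.ι) (a : E) : E →L[𝕜] E := M.man.dpar c a

theorem dP_injective (c : M.man.ι) (a : E) : Function.Injective (M.dP c a) :=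
  M.man.dpar_injective c a

theorem exists_dP_eq (c : M.man.ι) (a w : E) : ∃ v, M.dP c a v = w := M.man.exists_dpar_eq c a w

@[simp] theorem ln_par (c : M.man.ι) (i : Fin (d + 1)) (x : E × (Fin d → 𝕜)) :
    M.ln (M.prolong.man.par (M.pidx c i) x) =
      Submodule.span 𝕜 {M.dP c x.1 (M.vec c i x.1 x.2)} := rfl

@[simp] theorem dpr_dP (c : M.man.ι) (i : Fin (d + 1)) (x v : E × (Fin d → 𝕜)) :
    M.dpr (M.prolong.man.par (M.pidx c i) x) (M.prolong.dP (M.pidx c i) x v) = M.dP c x.1 v.1 :=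
  M.dπ_dpar (c, i) x v

theorem mem_ds_par {c : M.man.ι} {a v : E} :
    M.dP c a v ∈ M.ds (M.man.par c a) ↔
      v ∈ Submodule.span 𝕜 (range fun j => M.frame c j a) := M.dpar_mem_dist

theorem vel_par (c : M.man.ι) {a : 𝕜 → E} {a' : E} {t : 𝕜} (h : HasDerivAt a a' t) :
    M.man.vel (fun t => M.man.par c (a t)) t = M.dP c (a t) a' := ParamManifold.vel_par c h

/-- A point of `ℙD` over a chart, in homogeneous coordinates. -/
theorem exists_hom_coords {c : M.man.ι} (q : M.prolong.man.Pt) {a : E}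
    (ha : M.pr q = M.man.par c a) :
    ∃ h : Fin (d + 1) → 𝕜, M.ln q =
        Submodule.span 𝕜 {M.dP c a (∑ j, h j • M.frame c j a)} ∧
      (∃ i, h i ≠ 0) ∧ ∀ i, h i ≠ 0 →
        q = M.prolong.man.par (M.pidx c i) (a, fun j => h (i.succAbove j) / h i) := by
  obtain ⟨p, l, hl, hle⟩ := q
  obtain rfl : p = M.man.par c a := ha
  obtain ⟨v, hv0, hv⟩ := finrank_eq_one_iff'.1 hl
  obtain ⟨w, hw⟩ : ∃ w, M.man.dpar c a w = (v : TangentSpace 𝓘(𝕜, E) (M.man.par c a)) :=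
    ⟨_, M.man.dpar_dchart c a _⟩
  have hwm := M.eq_sum_of_mem (M.dpar_mem_dist.1 (hw ▸ hle v.2))
  have h2 : l = Submodule.span 𝕜 {M.man.dpar c a w} := by
    apply le_antisymm
    · intro x hx
      obtain ⟨z, hz⟩ := hv ⟨x, hx⟩
      rw [hw]
      exact Submodule.mem_span_singleton.2 ⟨z, congrArg Subtype.val hz⟩
    · rw [Submodule.span_singleton_le_iff_mem, hw]
      exact v.2
  -- The coframe values of a generator `w` of the line are its homogeneous coordinates.
  refine ⟨fun j => M.coframe c j a w, ?_, ?_, fun i hi => ?_⟩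
  · rw [← hwm]
    exact h2
  · by_contra! h
    simp only [h, zero_smul, Finset.sum_const_zero] at hwm
    rw [hwm, map_zero] at hw
    exact hv0 (Subtype.ext hw.symm)
  · refine M.proj_eq rfl ?_
    have h1 : w = M.coframe c i a w • M.vec c i a
        (fun j => M.coframe c (i.succAbove j) a w / M.coframe c i a w) := by
      conv_lhs => rw [hwm]
      rw [vec, Finset.smul_sum]
      refine Finset.sum_congr rfl fun j _ => ?_
      rw [smul_smul]
      congr 1
      refine Fin.succAboveCases i ?_ (fun l => ?_) j
      · simp
      · simp [mul_div_cancel₀ _ hi]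
    have h3 : Submodule.span 𝕜 {M.man.dpar c a w} = Submodule.span 𝕜 {M.man.dpar c a (M.vec c i a
        (fun j => M.coframe c (i.succAbove j) a w / M.coframe c i a w))} := by
      conv_lhs => rw [h1, map_smul]
      exact Submodule.span_singleton_smul_eq (IsUnit.mk0 _ hi) _
    exact h2.trans h3

/-- An analytic curve germ at `0` tangent to the distribution. -/
def Horizontal (γ : 𝕜 → M.man.Pt) : Prop :=
  ContMDiffAt 𝓘(𝕜, 𝕜) 𝓘(𝕜, E) ω γ 0 ∧ ∀ᶠ t in 𝓝 (0 : 𝕜), M.man.vel γ t ∈ M.ds (γ t)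

variable {M}

theorem eventually_contMDiffAt {γ : 𝕜 → M.man.Pt} (h : ContMDiffAt 𝓘(𝕜, 𝕜) 𝓘(𝕜, E) ω γ 0) :
    ∀ᶠ t in 𝓝 (0 : 𝕜), ContMDiffAt 𝓘(𝕜, 𝕜) 𝓘(𝕜, E) ω γ t :=
  (contMDiffAt_iff_contMDiffAt_nhds (by simp)).1 h

/-- The prolonged distribution is the preimage of the tautological line under the differential of
the projection, so the chain rule applies. -/
theorem vel_mem_ln {γ : 𝕜 → M.prolong.man.Pt} {t : 𝕜}
    (h : ContMDiffAt 𝓘(𝕜, 𝕜) 𝓘(𝕜, E × (Fin d → 𝕜)) ω γ t)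
    (h2 : M.prolong.man.vel γ t ∈ M.prolong.ds (γ t)) :
    M.man.vel (fun s => M.pr (γ s)) t ∈ M.ln (γ t) := by
  have h3 := mem_prolong_ds.1 h2
  have e := ParamManifold.vel_comp (M := M.prolong.man) (N := M.man)
    ((M.contMDiffAt_pr (γ t)).mdifferentiableAt (by simp)) (h.mdifferentiableAt (by simp))
  rw [e]
  exact h3

theorem Horizontal.eventually_vel_mem_ln {γ : 𝕜 → M.prolong.man.Pt}
    (h : M.prolong.Horizontal γ) :
    ∀ᶠ t in 𝓝 (0 : 𝕜), M.man.vel (fun s => M.pr (γ s)) t ∈ M.ln (γ t) := by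
  filter_upwards [h.2, eventually_contMDiffAt h.1] with t h2 h3
  exact vel_mem_ln h3 h2

theorem Horizontal.proj {γ : 𝕜 → M.prolong.man.Pt} (h : M.prolong.Horizontal γ) :
    M.Horizontal fun t => M.pr (γ t) := by
  refine ⟨(M.contMDiffAt_pr (γ 0)).comp 0 h.1, ?_⟩
  filter_upwards [h.eventually_vel_mem_ln] with t h2
  exact (γ t).line_le h2

/-- Horizontal curves of the prolongation are determined by their projections. -/
theorem Horizontal.eventuallyEq {γ γ' : 𝕜 → M.prolong.man.Pt} (h : M.prolong.Horizontal γ)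
    (h' : M.prolong.Horizontal γ') (hπ : (fun t => M.pr (γ t)) =ᶠ[𝓝 0] fun t => M.pr (γ' t))
    (h0 : ∀ᶠ t in 𝓝[≠] (0 : 𝕜), M.man.vel (fun t => M.pr (γ t)) t ≠ 0) : γ =ᶠ[𝓝 0] γ' := by
  -- Off `0` the common projected velocity is nonzero and spans both lines.
  have key : ∀ᶠ t in 𝓝[≠] (0 : 𝕜), γ t = γ' t := by
    filter_upwards [h0, nhdsWithin_le_nhds hπ.eventuallyEq_nhds,
      nhdsWithin_le_nhds h.eventually_vel_mem_ln,
      nhdsWithin_le_nhds h'.eventually_vel_mem_ln] with t h0 hπ h1 h2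
    rw [← ParamManifold.vel_congr hπ] at h2
    refine M.proj_eq hπ.eq_of_nhds ?_
    have aux : ∀ l : Submodule 𝕜 E, Module.finrank 𝕜 l = 1 → ∀ v ∈ l, v ≠ 0 →
        l = Submodule.span 𝕜 {v} := by
      intro l hl v hv hv0
      apply le_antisymm
      · intro x hx
        obtain ⟨z, hz⟩ := (finrank_eq_one_iff_of_nonzero' (⟨v, hv⟩ : l)
          (fun h => hv0 (congrArg Subtype.val h))).1 hl ⟨x, hx⟩
        exact Submodule.mem_span_singleton.2 ⟨z, congrArg Subtype.val hz⟩
      · rwa [Submodule.span_singleton_le_iff_mem]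
    exact (aux _ (γ t).finrank_line _ h1 h0).trans (aux _ (γ' t).finrank_line _ h2 h0).symm
  -- At `0` the velocity may vanish and continuity takes over. No Hausdorff property of `ℙD` is
  -- used: both curves are written in charts over the same `c`, and the limit is taken in a scalar
  -- identity between homogeneous coordinates.
  suffices hh : γ 0 = γ' 0 by
    rw [Filter.EventuallyEq, ← eventually_nhdsWithin_iff.trans
      (Filter.eventually_congr (Filter.Eventually.of_forall fun t => ?_))]
    · exact key
    · by_cases ht : t = 0
      · simp [ht, hh]
      · simp [ht]
  obtain ⟨c, i, hi⟩ : ∃ c i, γ 0 ∈ range (M.projPar (c, i)) := ⟨_, M.exists_projPar _⟩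
  obtain ⟨x0, hx0⟩ := hi
  have hb : M.pr (γ' 0) = M.man.par c x0.1 := by
    rw [← hπ.eq_of_nhds, ← hx0]; rfl
  obtain ⟨hh, -, ⟨i', hi'⟩, hq⟩ := M.exists_hom_coords (γ' 0) hb
  obtain ⟨a, ha, hac⟩ := ParamManifold.exists_curve_chart (M := M.prolong.man) (c := (c, i)) h.1
    ⟨x0, hx0⟩
  obtain ⟨b, hb, hbc⟩ := ParamManifold.exists_curve_chart (M := M.prolong.man) (c := (c, i')) h'.1
    ⟨_, (hq i' hi').symm⟩
  have hab : ∀ᶠ t in 𝓝 (0 : 𝕜), (a t).1 = (b t).1 := by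
    filter_upwards [hac, hbc, hπ] with t h1 h2 h3
    rw [h1, h2] at h3
    exact M.man.par_injective c h3
  have hhom : ∀ᶠ t in 𝓝[≠] (0 : 𝕜), ∀ j,
      hom i (a t).2 i' * hom i' (b t).2 j = hom i (a t).2 j := by
    filter_upwards [key, nhdsWithin_le_nhds hab, nhdsWithin_le_nhds hac,
      nhdsWithin_le_nhds hbc] with t h1 h2 h3 h4 j
    rw [h3, h4] at h1
    have h5 : Submodule.span 𝕜 {(M.man.dpar c (a t).1 (M.vec c i (a t).1 (a t).2) : E)} =
      Submodule.span 𝕜 {(M.man.dpar c (b t).1 (M.vec c i' (b t).1 (b t).2) : E)} :=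
      congrArg (fun q : M.Proj => (show Submodule 𝕜 E from q.line))
        (show M.projPar (c, i) (a t) = M.projPar (c, i') (b t) from h1)
    rw [← h2] at h5
    obtain ⟨z, hz⟩ := Submodule.mem_span_singleton.1 (h5 ▸ Submodule.mem_span_singleton_self _ :
      (M.man.dpar c (a t).1 (M.vec c i (a t).1 (a t).2) : E) ∈
        Submodule.span 𝕜 {(M.man.dpar c (a t).1 (M.vec c i' (a t).1 (b t).2) : E)})
    have hz' := M.man.dpar_injective c (a t).1 (((M.man.dpar c (a t).1).map_smul z _).trans hz)
    have h6 : ∀ j, z * hom i' (b t).2 j = hom i (a t).2 j := fun j => by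
      rw [← M.coframe_vec c i' j (a t).1, ← M.coframe_vec c i j (a t).1, ← hz', map_smul,
        smul_eq_mul]
    have h7 := h6 i'
    rw [hom_same, mul_one] at h7
    rw [← h7, h6]
  have hhom0 : ∀ j, hom i (a 0).2 i' * hom i' (b 0).2 j = hom i (a 0).2 j := by
    intro j
    have c1 : ∀ j, ContinuousAt (fun t => hom i (a t).2 j) 0 := fun j =>
      ((contDiff_hom (𝕜 := 𝕜) i j).continuous.comp continuous_snd).continuousAt.comp
        ha.continuousAt
    have c2 : ContinuousAt (fun t => hom i' (b t).2 j) 0 :=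
      ((contDiff_hom (𝕜 := 𝕜) i' j).continuous.comp continuous_snd).continuousAt.comp
        hb.continuousAt
    exact tendsto_nhds_unique_of_eventuallyEq
      (((c1 i').mul c2).tendsto.mono_left nhdsWithin_le_nhds)
      ((c1 j).tendsto.mono_left nhdsWithin_le_nhds) (hhom.mono fun t ht => ht j)
  rw [hac.eq_of_nhds, hbc.eq_of_nhds]
  -- The case `j = i` of the limit identity has right-hand side `1`, so the proportionality factor
  -- survives in the limit.
  have hz0 : hom i (a 0).2 i' ≠ 0 := by
    intro hz
    have := hhom0 i
    rw [hz, zero_mul, hom_same] at this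
    exact zero_ne_one this
  refine M.proj_eq (congrArg (M.man.par c) hab.self_of_nhds) ?_
  change Submodule.span 𝕜 {(M.man.dpar c (a 0).1 (M.vec c i (a 0).1 (a 0).2) : E)} =
    Submodule.span 𝕜 {(M.man.dpar c (b 0).1 (M.vec c i' (b 0).1 (b 0).2) : E)}
  rw [← hab.self_of_nhds]
  have hv : M.vec c i (a 0).1 (a 0).2 = hom i (a 0).2 i' • M.vec c i' (a 0).1 (b 0).2 := by
    rw [vec, vec, Finset.smul_sum]
    exact Finset.sum_congr rfl fun j _ => by rw [smul_smul, hhom0]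
  rw [hv]
  have := (M.man.dpar c (a 0).1).map_smul (hom i (a 0).2 i') (M.vec c i' (a 0).1 (b 0).2)
  refine (congrArg (fun x : E => Submodule.span 𝕜 {x}) this).trans ?_
  exact Submodule.span_singleton_smul_eq (IsUnit.mk0 _ hz0) _

end DistManifold

/-! ### Local symmetries of a distribution and their prolongations. -/

namespace DistManifold

variable {𝕜 E : Type u} [RCLike 𝕜] [NormedAddCommGroup E] [NormedSpace 𝕜 E] {d : ℕ}
  (M : DistManifold 𝕜 E d)

/-- The differential of a map of the manifold into itself, as a map of the model space. -/
noncomputable def dmap (φ : M.man.Pt → M.man.Pt) (p : M.man.Pt) : E →L[𝕜] E :=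
  mfderiv 𝓘(𝕜, E) 𝓘(𝕜, E) φ p

/-- A pair of mutually inverse local symmetries of the distribution. -/
structure SymmPair (φ χ : M.man.Pt → M.man.Pt) (U V : Set M.man.Pt) : Prop where
  isOpen_source : IsOpen U
  isOpen_target : IsOpen V
  mapsTo : MapsTo φ U V
  mapsTo' : MapsTo χ V U
  left_inv : ∀ p ∈ U, χ (φ p) = p
  right_inv : ∀ p ∈ V, φ (χ p) = p
  contMDiffAt : ∀ p ∈ U, ContMDiffAt 𝓘(𝕜, E) 𝓘(𝕜, E) ω φ p
  contMDiffAt' : ∀ p ∈ V, ContMDiffAt 𝓘(𝕜, E) 𝓘(𝕜, E) ω χ p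
  dist_le : ∀ p ∈ U, ∀ v ∈ M.ds p, M.dmap φ p v ∈ M.ds (φ p)
  dist_le' : ∀ p ∈ V, ∀ v ∈ M.ds p, M.dmap χ p v ∈ M.ds (χ p)

namespace SymmPair

variable {M} {φ χ : M.man.Pt → M.man.Pt} {U V : Set M.man.Pt}

theorem symm (h : M.SymmPair φ χ U V) : M.SymmPair χ φ V U :=
  ⟨h.2, h.1, h.4, h.3, h.6, h.5, h.8, h.7, h.10, h.9⟩

theorem dmap_dmap (h : M.SymmPair φ χ U V) {p : M.man.Pt} (hp : p ∈ U) (v : E) :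
    M.dmap χ (φ p) (M.dmap φ p v) = v := by
  have h1 := mfderiv_comp p ((h.contMDiffAt' _ (h.mapsTo hp)).mdifferentiableAt (by simp))
    ((h.contMDiffAt p hp).mdifferentiableAt (by simp))
  have h2 : χ ∘ φ =ᶠ[𝓝 p] id := by
    filter_upwards [h.isOpen_source.mem_nhds hp] with x hx
    exact h.left_inv x hx
  rw [h2.mfderiv_eq, mfderiv_id] at h1
  exact (DFunLike.congr_fun h1 v).symm

theorem dmap_injective (h : M.SymmPair φ χ U V) {p : M.man.Pt} (hp : p ∈ U) :
    Function.Injective (M.dmap φ p) :=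
  Function.LeftInverse.injective (h.dmap_dmap hp)

/-- Injectivity of the differential and invariance of the distribution are the two conditions that
rule out the dummy value of `prolongMap`. -/
theorem prolongMap_spec (h : M.SymmPair φ χ U V) {q : M.prolong.man.Pt} (hq : M.pr q ∈ U) :
    M.pr (M.prolongMap φ q) = φ (M.pr q) ∧ M.ln (M.prolongMap φ q) =
      Submodule.map (M.dmap φ (M.pr q)).toLinearMap (M.ln q) := by
  have h1 : Module.finrank 𝕜 ((M.lineOf q).map
      (mfderiv 𝓘(𝕜, E) 𝓘(𝕜, E) φ (M.pr q)).toLinearMap) = 1 ∧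
      (M.lineOf q).map (mfderiv 𝓘(𝕜, E) 𝓘(𝕜, E) φ (M.pr q)).toLinearMap ≤ M.dist (φ (M.pr q)) := by
    refine ⟨?_, ?_⟩
    · exact ((Submodule.equivMapOfInjective (M.dmap φ (M.pr q)).toLinearMap
        (h.dmap_injective hq) (M.ln q)).finrank_eq).symm.trans q.finrank_line
    · rintro _ ⟨v, hv, rfl⟩
      exact h.dist_le _ hq v (q.line_le hv)
  have e : M.prolongMap φ q = (⟨φ (M.π q), (M.lineOf q).map
      (mfderiv 𝓘(𝕜, E) 𝓘(𝕜, E) φ (M.π q)).toLinearMap, h1.1, h1.2⟩ : M.Proj) := dif_pos h1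
  exact ⟨congrArg M.pr e, congrArg M.ln e⟩

theorem pr_prolongMap (h : M.SymmPair φ χ U V) {q : M.prolong.man.Pt} (hq : M.pr q ∈ U) :
    M.pr (M.prolongMap φ q) = φ (M.pr q) := (h.prolongMap_spec hq).1

theorem ln_prolongMap (h : M.SymmPair φ χ U V) {q : M.prolong.man.Pt} (hq : M.pr q ∈ U) :
    M.ln (M.prolongMap φ q) =
      Submodule.map (M.dmap φ (M.pr q)).toLinearMap (M.ln q) :=
  (h.prolongMap_spec hq).2

theorem prolongMap_left_inv (h : M.SymmPair φ χ U V) {q : M.prolong.man.Pt} (hq : M.pr q ∈ U) :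
    M.prolongMap χ (M.prolongMap φ q) = q := by
  have h1 : M.pr (M.prolongMap φ q) ∈ V := h.pr_prolongMap hq ▸ h.mapsTo hq
  refine prolong_ext ?_ ?_
  · exact (h.symm.pr_prolongMap h1).trans ((congrArg χ (h.pr_prolongMap hq)).trans
      (h.left_inv _ hq))
  · refine (h.symm.ln_prolongMap h1).trans ?_
    rw [h.ln_prolongMap hq, h.pr_prolongMap hq, ← Submodule.map_comp]
    convert! Submodule.map_id _
    ext v
    exact h.dmap_dmap hq v

/-- In charts the prolonged map consists of the local expression `f` of `φ` and of quotients of the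
coframe values `C` of the image under `df` of the spanning vector, all of them analytic. -/
theorem contMDiffAt_prolongMap (h : M.SymmPair φ χ U V) {q : M.prolong.man.Pt}
    (hq : M.pr q ∈ U) :
    ContMDiffAt 𝓘(𝕜, E × (Fin d → 𝕜)) 𝓘(𝕜, E × (Fin d → 𝕜)) ω (M.prolongMap φ) q := by
  obtain ⟨c, i, x, rfl⟩ : ∃ c i x, M.prolong.man.par (M.pidx c i) x = q :=
    ⟨_, _, M.prolong.man.mem_range q⟩
  obtain ⟨c', hr⟩ : ∃ c', φ (M.man.par c x.1) ∈ range (M.man.par c') := ⟨_, M.man.mem_range _⟩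
  set f : E → E := fun a => M.man.chart c' (φ (M.man.par c a)) with hf
  change M.man.par c x.1 ∈ U at hq
  have hcU : ∀ᶠ a in 𝓝 x.1, M.man.par c a ∈ U :=
    (M.man.contMDiff_par c).continuous.continuousAt (h.isOpen_source.mem_nhds hq)
  have hcr : ∀ᶠ a in 𝓝 x.1, φ (M.man.par c a) ∈ range (M.man.par c') :=
    ((h.contMDiffAt _ hq).comp x.1 (M.man.contMDiff_par c).contMDiffAt).continuousAt
      ((M.man.isOpen_range_par c').mem_nhds hr)
  have hfd : ∀ a, M.man.par c a ∈ U → φ (M.man.par c a) ∈ range (M.man.par c') →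
      ContDiffAt 𝕜 ω f a := fun a ha hr =>
    ((M.man.contMDiffAt_chart c' hr).comp a
      ((h.contMDiffAt _ ha).comp a (M.man.contMDiff_par c).contMDiffAt)).contDiffAt
  set C : Fin (d + 1) → E × (Fin d → 𝕜) → 𝕜 := fun j y =>
    M.coframe c' j (f y.1) (fderiv 𝕜 f y.1 (M.vec c i y.1 y.2)) with hC
  have hCd : ∀ j, ContDiffAt 𝕜 ω (C j) x := by
    intro j
    have h1 : ContDiffAt 𝕜 ω (fun y : E × (Fin d → 𝕜) => f y.1) x :=
      (hfd _ hq hr).comp x contDiffAt_fst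
    have h2 : ContDiffAt 𝕜 ω (fun y : E × (Fin d → 𝕜) => fderiv 𝕜 f y.1) x :=
      ((hfd _ hq hr).fderiv_right (m := ω) le_top).comp x contDiffAt_fst
    exact ((M.contDiff_coframe c' j).contDiffAt.comp x h1).clm_apply
      (h2.clm_apply (M.contDiff_vec c i).contDiffAt)
  -- The homogeneous coordinates `g` of the image point agree with `C` only up to a factor `z`,
  -- which cancels in the quotients. It is nonzero because the differentials are injective.
  have key : ∀ y : E × (Fin d → 𝕜), M.man.par c y.1 ∈ U →
      φ (M.man.par c y.1) ∈ range (M.man.par c') →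
      (∀ᶠ a in 𝓝 y.1, φ (M.man.par c a) ∈ range (M.man.par c')) →
      ∃ g : Fin (d + 1) → 𝕜, (∃ z : 𝕜, z ≠ 0 ∧ ∀ j, C j y = z * g j) ∧ (∃ l, g l ≠ 0) ∧ ∀ l, g l ≠ 0 →
        M.prolongMap φ (M.prolong.man.par (M.pidx c i) y) =
          M.prolong.man.par (M.pidx c' l) (f y.1, fun j => g (l.succAbove j) / g l) := by
    intro y hy1 hy2 hy3
    have hb : M.pr (M.prolongMap φ (M.prolong.man.par (M.pidx c i) y)) =
        M.man.par c' (f y.1) := (h.pr_prolongMap (q := M.prolong.man.par (M.pidx c i) y) hy1).trans (M.man.par_chart c' hy2).symm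
    obtain ⟨g, hg1, hg2, hg3⟩ := M.exists_hom_coords _ hb
    refine ⟨g, ?_, hg2, hg3⟩
    have hch : M.dmap φ (M.man.par c y.1) (M.dP c y.1 (M.vec c i y.1 y.2)) =
        M.dP c' (f y.1) (fderiv 𝕜 f y.1 (M.vec c i y.1 y.2)) := by
      have e1 := mfderiv_comp y.1 ((h.contMDiffAt _ hy1).mdifferentiableAt (by simp))
        (M.man.mdifferentiableAt_par c y.1)
      have e2 := mfderiv_comp y.1 (M.man.mdifferentiableAt_par c' (f y.1))
        (((hfd _ hy1 hy2).differentiableAt (by simp)).mdifferentiableAt)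
      have e3 : φ ∘ M.man.par c =ᶠ[𝓝 y.1] M.man.par c' ∘ f := by
        filter_upwards [hy3] with a ha
        exact (M.man.par_chart c' ha).symm
      have e4 := e3.mfderiv_eq (I := 𝓘(𝕜, E)) (I' := 𝓘(𝕜, E))
      rw [mfderiv_eq_fderiv] at e2
      exact DFunLike.congr_fun (e1.symm.trans (e4.trans e2)) (M.vec c i y.1 y.2)
    rw [h.ln_prolongMap (q := M.prolong.man.par (M.pidx c i) y) hy1, ln_par, Submodule.map_span, image_singleton] at hg1
    have hm := Submodule.mem_span_singleton_self (R := 𝕜)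
      ((M.dmap φ (M.man.par c y.1)) (M.dP c y.1 (M.vec c i y.1 y.2)))
    have hm2 : M.dmap φ (M.man.par c y.1) (M.dP c y.1 (M.vec c i y.1 y.2)) ∈
      Submodule.span 𝕜 {M.dP c' (f y.1) (∑ j, g j • M.frame c' j (f y.1))} := hg1 ▸ hm
    obtain ⟨z, hz⟩ := Submodule.mem_span_singleton.1 hm2
    rw [hch, ← map_smul] at hz
    have hz1 := M.dP_injective _ _ hz
    refine ⟨z, ?_, fun j => ?_⟩
    · rintro rfl
      rw [zero_smul] at hz1
      rw [← hz1, map_zero] at hch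
      have := h.dmap_injective hy1 (hch.trans (map_zero _).symm)
      exact M.vec_ne_zero c i y.1 y.2 (M.dP_injective _ _ (this.trans (map_zero _).symm))
    · simp only [hC]
      rw [← hz1, map_smul, M.coframe_sum, smul_eq_mul]
  -- This index gives a target chart valid at `x`, hence near `x` by continuity.
  obtain ⟨i', hC0⟩ : ∃ i', C i' x ≠ 0 := by
    obtain ⟨g, ⟨z, hz, hg⟩, ⟨l, hl⟩, -⟩ := key x hq hr hcr
    exact ⟨l, hg l ▸ mul_ne_zero hz hl⟩
  have hev : ∀ᶠ y in 𝓝 x, M.prolongMap φ (M.prolong.man.par (M.pidx c i) y) =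
      M.prolong.man.par (M.pidx c' i') (f y.1, fun j => C (i'.succAbove j) y / C i' y) := by
    filter_upwards [continuous_fst.continuousAt.eventually hcU,
      continuous_fst.continuousAt.eventually hcr.eventually_nhds,
      (hCd i').continuousAt.eventually_ne hC0] with y hy1 hy2 hy3
    obtain ⟨g, ⟨z, hz, hg⟩, -, hg2⟩ := key y hy1 hy2.self_of_nhds hy2
    have hgi : g i' ≠ 0 := fun h0 => hy3 (by rw [hg, h0, mul_zero])
    rw [hg2 i' hgi]
    congr 2
    ext j
    rw [hg, hg, mul_div_mul_left _ _ hz]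
  have hG : ContDiffAt 𝕜 ω (fun y : E × (Fin d → 𝕜) =>
      (f y.1, fun j => C (i'.succAbove j) y / C i' y)) x :=
    ((hfd _ hq hr).comp x contDiffAt_fst).prodMk
      (contDiffAt_pi.2 fun j => (hCd _).div (hCd i') hC0)
  have hx := M.prolong.man.chart_par (M.pidx c i) x
  have hG' := (M.prolong.man.contMDiff_par (M.pidx c' i')).contMDiffAt.comp x hG.contMDiffAt
  rw [← hx] at hG'
  refine (hG'.comp (M.prolong.man.par (M.pidx c i) x)
    (M.prolong.man.contMDiffAt_chart (M.pidx c i) (mem_range_self x))).congr_of_eventuallyEq ?_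
  have hcont := (M.prolong.man.contMDiffAt_chart (M.pidx c i) (mem_range_self x)).continuousAt
  rw [ContinuousAt, hx] at hcont
  filter_upwards [hcont.eventually hev, (M.prolong.man.isOpen_range_par (M.pidx c i)).mem_nhds
    (mem_range_self x)] with p hp hpr
  rw [M.prolong.man.par_chart _ hpr] at hp
  exact hp

theorem dpr_dmap (h : M.SymmPair φ χ U V) {q : M.prolong.man.Pt} (hq : M.pr q ∈ U)
    (v : E × (Fin d → 𝕜)) :
    M.dpr (M.prolongMap φ q) (M.prolong.dmap (M.prolongMap φ) q v) =
      M.dmap φ (M.pr q) (M.dpr q v) := by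
  have e1 := mfderiv_comp q ((M.contMDiffAt_pr (M.prolongMap φ q)).mdifferentiableAt (by simp))
    ((h.contMDiffAt_prolongMap hq).mdifferentiableAt (by simp))
  have e2 := mfderiv_comp q ((h.contMDiffAt _ hq).mdifferentiableAt (by simp))
    ((M.contMDiffAt_pr q).mdifferentiableAt (by simp))
  have e3 : M.pr ∘ M.prolongMap φ =ᶠ[𝓝 q] φ ∘ M.pr := by
    filter_upwards [(M.contMDiffAt_pr q).continuousAt (h.isOpen_source.mem_nhds hq)] with p hp
    exact h.pr_prolongMap hp
  have e4 := e3.mfderiv_eq (I := 𝓘(𝕜, E × (Fin d → 𝕜))) (I' := 𝓘(𝕜, E))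
  exact DFunLike.congr_fun (e1.symm.trans (e4.trans e2)) v

/-- Symmetries lift one level. The prolonged distribution is preserved because the prolonged map
covers `φ` and carries the tautological line to the tautological line. -/
theorem prolong (h : M.SymmPair φ χ U V) :
    M.prolong.SymmPair (M.prolongMap φ) (M.prolongMap χ) (M.pr ⁻¹' U) (M.pr ⁻¹' V) where
  isOpen_source := h.isOpen_source.preimage
    (continuous_iff_continuousAt.2 fun q => (M.contMDiffAt_pr q).continuousAt)
  isOpen_target := h.isOpen_target.preimage
    (continuous_iff_continuousAt.2 fun q => (M.contMDiffAt_pr q).continuousAt)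
  mapsTo q hq := by
    rw [mem_preimage, h.pr_prolongMap hq]
    exact h.mapsTo hq
  mapsTo' q hq := by
    rw [mem_preimage, h.symm.pr_prolongMap hq]
    exact h.mapsTo' hq
  left_inv _ hq := h.prolongMap_left_inv hq
  right_inv _ hq := h.symm.prolongMap_left_inv hq
  contMDiffAt _ hq := h.contMDiffAt_prolongMap hq
  contMDiffAt' _ hq := h.symm.contMDiffAt_prolongMap hq
  dist_le q hq v hv := by
    rw [mem_prolong_ds] at hv ⊢
    rw [h.dpr_dmap hq, h.ln_prolongMap hq]
    exact Submodule.mem_map_of_mem hv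
  dist_le' q hq v hv := by
    rw [mem_prolong_ds] at hv ⊢
    rw [h.symm.dpr_dmap hq, h.symm.ln_prolongMap hq]
    exact Submodule.mem_map_of_mem hv

theorem vel_comp (h : M.SymmPair φ χ U V) {γ : 𝕜 → M.man.Pt} {t : 𝕜}
    (hγ : ContMDiffAt 𝓘(𝕜, 𝕜) 𝓘(𝕜, E) ω γ t) (ht : γ t ∈ U) :
    M.man.vel (fun s => φ (γ s)) t = M.dmap φ (γ t) (M.man.vel γ t) :=
  ParamManifold.vel_comp ((h.contMDiffAt _ ht).mdifferentiableAt (by simp))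
    (hγ.mdifferentiableAt (by simp))

theorem horizontal_comp (h : M.SymmPair φ χ U V) {γ : 𝕜 → M.man.Pt} (hγ : M.Horizontal γ)
    (h0 : γ 0 ∈ U) : M.Horizontal fun t => φ (γ t) := by
  refine ⟨(h.contMDiffAt _ h0).comp 0 hγ.1, ?_⟩
  filter_upwards [hγ.2, eventually_contMDiffAt hγ.1,
    hγ.1.continuousAt (h.isOpen_source.mem_nhds h0)] with t h1 h2 h3
  rw [h.vel_comp h2 h3]
  exact h.dist_le _ h3 _ h1

end SymmPair

end DistManifold

/-! ### Vertical lines and the tangency hyperplane in coordinates. -/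

theorem hasDerivAt_add_smul {𝕜 E : Type u} [RCLike 𝕜] [NormedAddCommGroup E] [NormedSpace 𝕜 E]
    (x v : E) : HasDerivAt (fun t : 𝕜 => x + t • v) v 0 := by
  simpa using ((hasDerivAt_id (0 : 𝕜)).smul_const v).const_add x

namespace ParamManifold

variable {𝕜 E : Type u} [RCLike 𝕜] [NormedAddCommGroup E] [NormedSpace 𝕜 E]
  {M : ParamManifold 𝕜 E}

variable (M) in
/-- The tangent vectors to a subset, in the model space. -/
def ts (S : Set M.Pt) (p : M.Pt) : Set E := M.tangentSet S p

theorem mem_ts {S : Set M.Pt} {p : M.Pt} {v : E} :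
    v ∈ M.ts S p ↔ ∃ γ : 𝕜 → M.Pt, γ 0 = p ∧
      ContMDiffAt 𝓘(𝕜, 𝕜) 𝓘(𝕜, E) ω γ 0 ∧ (∀ᶠ t in 𝓝 0, γ t ∈ S) ∧ M.vel γ 0 = v := Iff.rfl

end ParamManifold

namespace DistManifold

variable {𝕜 E : Type u} [RCLike 𝕜] [NormedAddCommGroup E] [NormedSpace 𝕜 E] {d : ℕ}
  (M : DistManifold 𝕜 E d)

theorem prolong_frame_same (c : M.man.ι) (i : Fin (d + 1)) (x : E × (Fin d → 𝕜)) :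
    M.prolong.frame (M.pidx c i) i x = (M.vec c i x.1 x.2, 0) :=
  congrFun (M.projFrame_same (c, i)) x

theorem prolong_frame_succAbove (c : M.man.ι) (i : Fin (d + 1)) (l : Fin d)
    (x : E × (Fin d → 𝕜)) : M.prolong.frame (M.pidx c i) (i.succAbove l) x = (0, Pi.single l 1) :=
  congrFun (M.projFrame_succAbove (c, i) l) x

/-- The homogeneous coordinate of index `i` multiplies the lifted direction, and the others are
fibre velocities. Both the equation of verticality and the differential equations of the integral
curves are read off from this. -/
theorem prolong_vec (c : M.man.ι) (i j : Fin (d + 1)) (x : E × (Fin d → 𝕜)) (u : Fin d → 𝕜) :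
    M.prolong.vec (M.pidx c i) j x u =
      (hom j u i • M.vec c i x.1 x.2, fun l => hom j u (i.succAbove l)) := by
  rw [vec, Fin.sum_univ_succAbove _ i]
  simp only [prolong_frame_same, prolong_frame_succAbove]
  ext l
  · simp [Prod.fst_sum]
  · simp [Prod.snd_sum, Pi.single_apply]

/-- A point over `ℙD` is vertical when its line is tangent to the fibers of `ℙD → Z`. -/
def Vert (q : M.prolong.prolong.man.Pt) : Prop :=
  ∀ v ∈ M.prolong.ln q, M.dpr (M.prolong.pr q) v = 0

variable {M}

/-- The projection kills the fibre directions, which leaves `hom j x.2 i` times a nonzero vector. -/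
theorem vert_par {c : M.man.ι} {i j : Fin (d + 1)} {x : (E × (Fin d → 𝕜)) × (Fin d → 𝕜)} :
    M.Vert (M.prolong.prolong.man.par (M.prolong.pidx (M.pidx c i) j) x) ↔
      hom j x.2 i = 0 := by
  unfold Vert
  have h2 : M.dpr (M.prolong.man.par (M.pidx c i) x.1) (M.prolong.dP (M.pidx c i) x.1
      (M.prolong.vec (M.pidx c i) j x.1 x.2)) =
      hom j x.2 i • M.dP c x.1.1 (M.vec c i x.1.1 x.1.2) := by
    rw [dpr_dP, prolong_vec, map_smul]
  have h3 : M.dP c x.1.1 (M.vec c i x.1.1 x.1.2) ≠ 0 := fun h =>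
    M.vec_ne_zero c i x.1.1 x.1.2 (M.dP_injective _ _ (h.trans (map_zero _).symm))
  rw [ln_par, pr_par]
  constructor
  · intro h
    have := h _ (Submodule.mem_span_singleton_self _)
    rw [h2] at this
    exact (smul_eq_zero.1 this).resolve_right h3
  · intro h v hv
    obtain ⟨z, rfl⟩ := Submodule.mem_span_singleton.1 hv
    rw [map_smul, h2, h, zero_smul, smul_zero]

theorem dpr_eq_zero_of_mem_ts {z : M.prolong.man.Pt} {b : M.man.Pt} {v : E × (Fin d → 𝕜)}
    (h : v ∈ M.prolong.man.ts {q | M.pr q = b} z) : M.dpr z v = 0 := by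
  obtain ⟨γ, rfl, hγ, hS, rfl⟩ := ParamManifold.mem_ts.1 h
  have e := ParamManifold.vel_comp (M := M.prolong.man) (N := M.man)
    ((M.contMDiffAt_pr (γ 0)).mdifferentiableAt (by simp)) (hγ.mdifferentiableAt (by simp))
  refine e.symm.trans ?_
  have h2 : (fun s => M.pr (γ s)) =ᶠ[𝓝 0] fun _ => b := hS
  rw [ParamManifold.vel_congr h2]
  have h3 := mfderiv_const (I := 𝓘(𝕜, 𝕜)) (I' := 𝓘(𝕜, E)) (c := b) (x := (0 : 𝕜))
  exact DFunLike.congr_fun h3 (1 : 𝕜)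

/-- A chart vector over a vertical `v` has zero base component, so the straight segment in its
direction stays in the fibre. -/
theorem mem_ts_of_dpr_eq_zero {z : M.prolong.man.Pt} {v : E × (Fin d → 𝕜)}
    (h : M.dpr z v = 0) : v ∈ M.prolong.man.ts {q | M.pr q = M.pr z} z := by
  obtain ⟨c, i, x, rfl⟩ : ∃ c i x, M.prolong.man.par (M.pidx c i) x = z :=
    ⟨_, _, M.prolong.man.mem_range z⟩
  obtain ⟨w, rfl⟩ := M.prolong.exists_dP_eq (M.pidx c i) x v
  rw [dpr_dP] at h
  have hw : w.1 = 0 := M.dP_injective _ _ (h.trans (map_zero _).symm)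
  have hd := hasDerivAt_add_smul (𝕜 := 𝕜) x w
  refine ParamManifold.mem_ts.2 ⟨fun t => M.prolong.man.par (M.pidx c i) (x + t • w),
    by simp, ?_, ?_, ?_⟩
  · exact ParamManifold.contMDiffAt_par_comp (M := M.prolong.man) _
      (contDiff_const.add (contDiff_id.smul contDiff_const)).contDiffAt
  · refine Filter.Eventually.of_forall fun t => ?_
    simp [hw]
  · rw [M.prolong.vel_par _ hd]
    simp

/-- The tangency hyperplane at a vertical point, in coordinates. -/
theorem tangent_vert_iff {c : M.man.ι} {i j : Fin (d + 1)} {a : E} {u v w : Fin d → 𝕜}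
    (hij : j ≠ i) (hv : hom j v i = 0) :
    (∀ y ∈ M.prolong.prolong.ln (M.prolong.prolong.prolong.man.par
        (M.prolong.prolong.pidx (M.prolong.pidx (M.pidx c i) j) j) (((a, u), v), w)),
      y ∈ M.prolong.prolong.man.ts
        {z | M.pr (M.prolong.pr z) = M.man.par c a ∧ M.Vert z}
        (M.prolong.prolong.man.par (M.prolong.pidx (M.pidx c i) j) ((a, u), v))) ↔
      hom j w i = 0 := by
  obtain ⟨l, hl⟩ : ∃ l, j.succAbove l = i := Fin.exists_succAbove_eq hij.symm
  have hhom : ∀ v : Fin d → 𝕜, hom j v i = v l := fun v => by rw [← hl, hom_succAbove]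
  rw [hhom] at hv ⊢
  rw [ln_par, prolong_vec, prolong_vec, hom_same, one_smul]
  dsimp only
  rw [hhom, hv, zero_smul]
  simp only [hom_succAbove]
  set h : Fin d → 𝕜 := fun l => hom j v (i.succAbove l)
  constructor
  · intro H
    obtain ⟨γ, h0, hγ, hS, hvel⟩ := ParamManifold.mem_ts.1
      (H _ (Submodule.mem_span_singleton_self _))
    obtain ⟨A, hA, hAγ⟩ := ParamManifold.exists_curve_chart (M := M.prolong.prolong.man)
      (c := M.prolong.pidx (M.pidx c i) j) hγ (h0 ▸ mem_range_self _)
    have hA' := (hA.differentiableAt (by simp)).hasDerivAt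
    rw [ParamManifold.vel_congr hAγ, M.prolong.prolong.vel_par _ hA'] at hvel
    have hA0 : A 0 = ((a, u), v) := M.prolong.prolong.man.par_injective _
      (hAγ.eq_of_nhds.symm.trans h0)
    rw [hA0] at hvel
    have hvel := M.prolong.prolong.dP_injective _ _ hvel
    -- A curve of vertical points has vanishing `l`-th fibre coordinate, whose derivative at `0` is
    -- `w l`.
    have hz : (fun t => (A t).2 l) =ᶠ[𝓝 0] fun _ => 0 := by
      filter_upwards [hAγ, hS] with t h1 h2
      rw [h1] at h2
      rw [← hhom (A t).2]
      exact vert_par.1 h2.2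
    have h3 : HasDerivAt (fun t => (A t).2 l) ((deriv A 0).2 l) 0 :=
      hasDerivAt_pi.1 (hA'.snd) l
    have h4 := h3.unique ((hasDerivAt_const (0 : 𝕜) (0 : 𝕜)).congr_of_eventuallyEq hz)
    rw [hvel] at h4
    exact h4
  · intro hw y hy
    obtain ⟨z, rfl⟩ := Submodule.mem_span_singleton.1 hy
    have hd := hasDerivAt_add_smul (𝕜 := 𝕜) (((a, u), v) : (E × (Fin d → 𝕜)) × (Fin d → 𝕜))
      (z • ((0, h), w))
    -- Conversely, `v l = w l = 0` makes the straight segment consist of vertical points over the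
    -- fixed base point `a`.
    refine ParamManifold.mem_ts.2 ⟨fun t => M.prolong.prolong.man.par
      (M.prolong.pidx (M.pidx c i) j) (((a, u), v) + t • z • ((0, h), w)), by simp, ?_, ?_, ?_⟩
    · exact ParamManifold.contMDiffAt_par_comp (M := M.prolong.prolong.man) _
        (contDiff_const.add (contDiff_id.smul contDiff_const)).contDiffAt
    · refine Filter.Eventually.of_forall fun t => ⟨?_, ?_⟩
      · simp
      · rw [vert_par, hhom]
        simp [hv, hw]
    · rw [M.prolong.prolong.vel_par _ hd, map_smul]
      simp

end DistManifold

theorem ParamManifold.contMDiffAt_par_map {𝕜 E : Type u} [RCLike 𝕜] [NormedAddCommGroup E]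
    [NormedSpace 𝕜 E] (M : ParamManifold 𝕜 E) (c : M.ι) {f : E → E} {x : E}
    (h : ContDiffAt 𝕜 ω f x) :
    ContMDiffAt 𝓘(𝕜, E) 𝓘(𝕜, E) ω (fun y => M.par c (f y)) x :=
  (M.contMDiff_par c).contMDiffAt.comp x h.contMDiffAt

/-! ### Vertical and critical points of the tower. -/

namespace Monster

open DistManifold

variable {𝕜 : Type u} [RCLike 𝕜] {d : ℕ}

theorem isVertical_iff {k : ℕ} {q : P 𝕜 d (k + 2)} :
    IsVertical (k + 2) q ↔ (tower 𝕜 d k).Vert q := Iff.rfl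

/-- Lines of the tower lie in the distribution by construction, so only tangency has to be required.
-/
theorem mem_babyMonster_succ {i j : ℕ} {p : P 𝕜 d (i + 1)} {q : P 𝕜 d (i + 1 + (j + 1))} :
    q ∈ babyMonster p (j + 1) ↔ proj (i + 1 + j) q ∈ babyMonster p j ∧
      ∀ v ∈ (tower 𝕜 d (i + 1 + j)).ln q,
        v ∈ (tower 𝕜 d (i + 1 + j)).man.ts (babyMonster p j) (proj (i + 1 + j) q) :=
  ⟨fun h => ⟨h.1, fun v hv => (h.2 v hv).2⟩,
    fun h => ⟨h.1, fun v hv => ⟨(tower 𝕜 d (i + 1 + j)).ln_le q hv, h.2 v hv⟩⟩⟩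

theorem babyMonster_congr {i : ℕ} {p p' : P 𝕜 d (i + 1)} (h : proj i p = proj i p') (j : ℕ) :
    babyMonster p j = babyMonster p' j := by
  induction j with
  | zero =>
    ext q
    change proj i q = proj i p ↔ proj i q = proj i p'
    rw [h]
  | succ j ih =>
    ext q
    rw [mem_babyMonster_succ, mem_babyMonster_succ, ih]

/-- The tangent vectors to a fibre are the kernel of the projection, so the first critical
hyperplane is the vertical one. -/
theorem mem_babyMonster_one {i : ℕ} {p : P 𝕜 d (i + 1)} {q : P 𝕜 d (i + 1 + 1)} :
    q ∈ babyMonster p 1 ↔ proj i (proj (i + 1) q) = proj i p ∧ (tower 𝕜 d i).Vert q := by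
  refine mem_babyMonster_succ.trans (and_congr_right fun h => ?_)
  change proj i (proj (i + 1) q) = proj i p at h
  refine forall_congr' fun v => imp_congr_right fun hv => ⟨fun h2 => ?_, fun h2 => ?_⟩
  · exact dpr_eq_zero_of_mem_ts (M := tower 𝕜 d i) (b := proj i p) h2
  · have h3 := mem_ts_of_dpr_eq_zero (M := tower 𝕜 d i) h2
    have h4 : babyMonster p 0 =
        {q' | (tower 𝕜 d i).pr q' = (tower 𝕜 d i).pr ((tower 𝕜 d i).prolong.pr q)} := by
      ext q'
      exact iff_of_eq (congrArg (proj i q' = ·) h.symm)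
    change v ∈ (tower 𝕜 d (i + 1)).man.ts (babyMonster p 0) (proj (i + 1) q)
    rw [h4]
    exact h3

/-- A baby Monster either has just been born at the preceding level, and then gives vertical lines,
or already contains the projection of the point at a positive stage. -/
theorem isCritical_cases {k : ℕ} {q : P 𝕜 d (k + 1)} (h : IsCritical q) :
    IsVertical (k + 1) q ∨ IsCritical (proj k q) := by
  obtain ⟨i, j, p, q', hq, he⟩ := h
  obtain rfl : i + 1 + j = k := by
    have := congrArg Sigma.fst he
    simp only at this
    omega
  obtain rfl : q' = q := eq_of_heq (Sigma.mk.inj he).2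
  cases j with
  | zero => exact Or.inl (mem_babyMonster_one.1 hq).2
  | succ j => exact Or.inr ⟨i, j, p, _, (mem_babyMonster_succ.1 hq).1, rfl⟩

/-- Baby Monsters of fibres at level `i + 2` give only vertical points, and those of fibres at level
at most `i` would make the projection to level `i + 1` critical. Only the fibre at level `i + 1` is
left. -/
theorem isCritical_iff_mem {i : ℕ} {q : P 𝕜 d (i + 3)} (hv : ¬ IsVertical (i + 3) q)
    (hc : ¬ IsCritical (proj (i + 1) (proj (i + 2) q))) :
    IsCritical q ↔ q ∈ babyMonster (proj (i + 1) (proj (i + 2) q)) 2 := by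
  refine ⟨?_, fun h => ⟨i, 1, _, q, h, rfl⟩⟩
  rintro ⟨i', j, p, q', hq, he⟩
  have hi : i' + 1 + (j + 1) = i + 3 := congrArg Sigma.fst he
  match j, q', hq, he, hi with
  | 0, q', hq, he, hi =>
    obtain rfl : i' = i + 1 := by omega
    obtain rfl : q' = q := eq_of_heq (Sigma.mk.inj he).2
    exact absurd (mem_babyMonster_one.1 hq).2 hv
  | 1, q', hq, he, hi =>
    obtain rfl : i' = i := by omega
    obtain rfl : q' = q := eq_of_heq (Sigma.mk.inj he).2
    have h0 := (mem_babyMonster_succ.1 (mem_babyMonster_succ.1 hq).1).1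
    rwa [babyMonster_congr (p := proj (i' + 1) (proj (i' + 2) q')) h0]
  | j + 2, q', hq, he, hi =>
    obtain rfl : i = i' + 1 + j := by omega
    obtain rfl : q' = q := eq_of_heq (Sigma.mk.inj he).2
    exact absurd ⟨i', j, p, _, (mem_babyMonster_succ.1 (mem_babyMonster_succ.1 hq).1).1, rfl⟩ hc

theorem not_isVertical_of_letter {k : ℕ} {q : P 𝕜 d k} (h : letter q = Letter.R) :
    ¬ IsVertical k q := fun hv => by
  simp [letter, hv] at h

theorem not_isCritical_of_letter {k : ℕ} {q : P 𝕜 d k} (h : letter q = Letter.R) :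
    ¬ IsCritical q := fun hv => by
  simp only [letter, hv, if_true] at h
  split_ifs at h

theorem letter_eq_R {k : ℕ} {q : P 𝕜 d k} (h : ¬ IsVertical k q) (h' : ¬ IsCritical q) :
    letter q = Letter.R := by
  simp [letter, h, h']

theorem letter_eq_V {k : ℕ} {q : P 𝕜 d k} : letter q = Letter.V ↔ IsVertical k q := by
  unfold letter
  split_ifs <;> simp_all

/-! ### Prolongations of local diffeomorphisms -/

variable (𝕜 d) in
/-- The chart of `𝕜ⁿ`. -/
def bidx : (base 𝕜 d).man.ι := ()

theorem base_chart (a : (base 𝕜 d).man.Pt) : (base 𝕜 d).man.chart (bidx 𝕜 d) a = a :=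
  (base 𝕜 d).man.chart_par (bidx 𝕜 d) a

theorem contMDiffAt_base {ψ : (Fin (d + 1) → 𝕜) → (Fin (d + 1) → 𝕜)} {x : (base 𝕜 d).man.Pt}
    (h : ContDiffAt 𝕜 ω ψ x) :
    ContMDiffAt (M := (base 𝕜 d).man.Pt) (M' := (base 𝕜 d).man.Pt)
      𝓘(𝕜, Fin (d + 1) → 𝕜) 𝓘(𝕜, Fin (d + 1) → 𝕜) ω ψ x := by
  have h1 := (base 𝕜 d).man.contMDiffAt_chart (bidx 𝕜 d) (p := x) ⟨x, rfl⟩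
  have h2 : ContMDiffAt (M' := (base 𝕜 d).man.Pt) 𝓘(𝕜, Fin (d + 1) → 𝕜)
      𝓘(𝕜, Fin (d + 1) → 𝕜) ω (fun y => (base 𝕜 d).man.par (bidx 𝕜 d) (ψ y)) x :=
    (base 𝕜 d).man.contMDiffAt_par_map (bidx 𝕜 d) h
  have h3 : ContMDiffAt (M' := (base 𝕜 d).man.Pt) 𝓘(𝕜, Fin (d + 1) → 𝕜)
      𝓘(𝕜, Fin (d + 1) → 𝕜) ω (fun y => (base 𝕜 d).man.par (bidx 𝕜 d) (ψ y))
      ((base 𝕜 d).man.chart (bidx 𝕜 d) x) := (base_chart x).symm ▸ h2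
  refine (h3.comp x h1).congr_of_eventuallyEq ?_
  refine Filter.Eventually.of_forall fun y => ?_
  exact (congrArg ψ (base_chart y)).symm

theorem isOpen_base {U : Set (Fin (d + 1) → 𝕜)} (h : IsOpen U) :
    @IsOpen (base 𝕜 d).man.Pt _ U := by
  have hc : Continuous ((base 𝕜 d).man.chart (bidx 𝕜 d)) := continuous_iff_continuousAt.2 fun x =>
    ((base 𝕜 d).man.contMDiffAt_chart (bidx 𝕜 d) (p := x) ⟨x, rfl⟩).continuousAt
  have e : (base 𝕜 d).man.chart (bidx 𝕜 d) ⁻¹' U = U := by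
    ext x
    exact iff_of_eq (congrArg (· ∈ U) (base_chart x))
  exact e ▸ h.preimage hc

/-- A local analytic diffeomorphism of `𝕜ⁿ`. -/
def IsAnalyticDiffeo (ψ : OpenPartialHomeomorph (Fin (d + 1) → 𝕜) (Fin (d + 1) → 𝕜)) : Prop :=
  AnalyticOnNhd 𝕜 ψ ψ.source ∧ AnalyticOnNhd 𝕜 ψ.symm ψ.target

variable {ψ : OpenPartialHomeomorph (Fin (d + 1) → 𝕜) (Fin (d + 1) → 𝕜)}

theorem IsAnalyticDiffeo.symm (hψ : IsAnalyticDiffeo ψ) : IsAnalyticDiffeo ψ.symm :=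
  ⟨hψ.2, by simpa using hψ.1⟩

theorem IsAnalyticDiffeo.symmPair (hψ : IsAnalyticDiffeo ψ) : ∀ k : ℕ, (tower 𝕜 d k).SymmPair
    (prolongation ψ k) (prolongation ψ.symm k) (toBase k ⁻¹' ψ.source) (toBase k ⁻¹' ψ.target)
  | 0 =>
    { isOpen_source := isOpen_base ψ.open_source
      isOpen_target := isOpen_base ψ.open_target
      mapsTo := fun _ hp => ψ.map_source hp
      mapsTo' := fun _ hp => ψ.map_target hp
      left_inv := fun _ hp => ψ.left_inv hp
      right_inv := fun _ hp => ψ.right_inv hp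
      contMDiffAt := fun p hp => contMDiffAt_base (hψ.1 p hp).contDiffAt
      contMDiffAt' := fun p hp => contMDiffAt_base (hψ.2 p hp).contDiffAt
      dist_le := fun _ _ _ _ => trivial
      dist_le' := fun _ _ _ _ => trivial }
  | k + 1 => (hψ.symmPair k).prolong

theorem proj_prolongation (hψ : IsAnalyticDiffeo ψ) {k : ℕ} {q : P 𝕜 d (k + 1)}
    (hq : toBase (k + 1) q ∈ ψ.source) :
    proj k (prolongation ψ (k + 1) q) = prolongation ψ k (proj k q) :=
  (hψ.symmPair k).pr_prolongMap hq

theorem toBase_prolongation (hψ : IsAnalyticDiffeo ψ) : ∀ {k : ℕ} {q : P 𝕜 d k},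
    toBase k q ∈ ψ.source → toBase k (prolongation ψ k q) = ψ (toBase k q)
  | 0, _, _ => rfl
  | k + 1, q, hq => (congrArg (toBase k) (proj_prolongation hψ hq)).trans
      (toBase_prolongation hψ (q := proj k q) hq)

theorem toBase_prolongation_mem (hψ : IsAnalyticDiffeo ψ) {k : ℕ} {q : P 𝕜 d k}
    (hq : toBase k q ∈ ψ.source) : toBase k (prolongation ψ k q) ∈ ψ.symm.source :=
  (hψ.symmPair k).mapsTo hq

theorem prolongation_symm (hψ : IsAnalyticDiffeo ψ) {k : ℕ} {q : P 𝕜 d k}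
    (hq : toBase k q ∈ ψ.source) : prolongation ψ.symm k (prolongation ψ k q) = q :=
  (hψ.symmPair k).left_inv q hq

theorem isVertical_prolongation (hψ : IsAnalyticDiffeo ψ) : ∀ {k : ℕ} {q : P 𝕜 d k},
    toBase k q ∈ ψ.source → IsVertical k q → IsVertical k (prolongation ψ k q)
  | 0, _, _, h => h
  | 1, _, _, h => h
  | k + 2, q, hq, h => by
    rw [isVertical_iff] at h ⊢
    intro v hv
    have hS := hψ.symmPair k
    have e1 := (hψ.symmPair (k + 1)).pr_prolongMap (q := q) hq
    have hv' : v ∈ (tower 𝕜 d k).prolong.ln ((tower 𝕜 d k).prolong.prolongMap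
      (prolongation ψ (k + 1)) q) := hv
    have e2 := (hψ.symmPair (k + 1)).ln_prolongMap (q := q) hq
    obtain ⟨w, hw, rfl⟩ := (e2 ▸ hv' : v ∈ Submodule.map _ _)
    have e3 := hS.dpr_dmap (q := (tower 𝕜 d k).prolong.pr q) hq w
    rw [h w hw, map_zero] at e3
    exact (congrArg (fun z => (tower 𝕜 d k).dpr z _) e1).trans e3

/-- A whole baby Monster sits over one point of the base, so the domain condition on a
diffeomorphism holds on all of it at once. -/
theorem toBase_of_mem_babyMonster {i : ℕ} {p : P 𝕜 d (i + 1)} : ∀ {j : ℕ}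
    {q : P 𝕜 d (i + 1 + j)}, q ∈ babyMonster p j → toBase (i + 1 + j) q = toBase (i + 1) p
  | 0, _, hq => congrArg (toBase i) hq
  | j + 1, q, hq => toBase_of_mem_babyMonster (q := proj (i + 1 + j) q) (mem_babyMonster_succ.1 hq).1

/-- Tangency is defined by curves, and the prolonged map carries curves in one baby Monster to
curves in the other, by induction on the stage. -/
theorem prolongation_mem_babyMonster (hψ : IsAnalyticDiffeo ψ) {i : ℕ} {p : P 𝕜 d (i + 1)}
    (hp : toBase (i + 1) p ∈ ψ.source) : ∀ {j : ℕ} {q : P 𝕜 d (i + 1 + j)},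
    q ∈ babyMonster p j →
      prolongation ψ (i + 1 + j) q ∈ babyMonster (prolongation ψ (i + 1) p) j
  | 0, q, hq => by
    have hq' : toBase (i + 1) q ∈ ψ.source := (toBase_of_mem_babyMonster hq).symm ▸ hp
    change proj i (prolongation ψ (i + 1) q) = proj i (prolongation ψ (i + 1) p)
    rw [proj_prolongation hψ hq', proj_prolongation hψ hp]
    exact congrArg _ hq
  | j + 1, q, hq => by
    have hq' : toBase (i + 1 + (j + 1)) q ∈ ψ.source := (toBase_of_mem_babyMonster hq).symm ▸ hp
    have h := mem_babyMonster_succ.1 hq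
    have hS := hψ.symmPair (i + 1 + j)
    have e1 : proj (i + 1 + j) (prolongation ψ (i + 1 + (j + 1)) q) =
      prolongation ψ (i + 1 + j) (proj (i + 1 + j) q) := proj_prolongation hψ hq'
    refine mem_babyMonster_succ.2 ⟨?_, ?_⟩
    · rw [e1]
      exact prolongation_mem_babyMonster hψ hp h.1
    · intro v hv
      rw [e1]
      have e2 := hS.ln_prolongMap (q := q) hq'
      obtain ⟨w, hw, rfl⟩ := (e2 ▸ hv : v ∈ Submodule.map _ _)
      obtain ⟨γ, h0, hγ, hγS, hγv⟩ := ParamManifold.mem_ts.1 (h.2 w hw)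
      have hγ0 : γ 0 ∈ toBase (i + 1 + j) ⁻¹' ψ.source := h0 ▸ hq'
      refine ParamManifold.mem_ts.2 ⟨fun t => prolongation ψ (i + 1 + j) (γ t), ?_,
        (hS.contMDiffAt _ hγ0).comp 0 hγ, ?_, ?_⟩
      · exact congrArg (prolongation ψ (i + 1 + j)) h0
      · filter_upwards [hγS] with t ht
        exact prolongation_mem_babyMonster hψ hp ht
      · rw [hS.vel_comp hγ hγ0, hγv, h0]
        rfl

theorem isCritical_prolongation (hψ : IsAnalyticDiffeo ψ) {k : ℕ} {q : P 𝕜 d k}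
    (hq : toBase k q ∈ ψ.source) (h : IsCritical q) : IsCritical (prolongation ψ k q) := by
  obtain ⟨i, j, p, q', hq', he⟩ := h
  obtain rfl : i + 1 + (j + 1) = k := congrArg Sigma.fst he
  obtain rfl : q' = q := eq_of_heq (Sigma.mk.inj he).2
  have hp : toBase (i + 1) p ∈ ψ.source := toBase_of_mem_babyMonster hq' ▸ hq
  exact ⟨i, j, _, _, prolongation_mem_babyMonster hψ hp hq', rfl⟩

theorem letter_prolongation (hψ : IsAnalyticDiffeo ψ) {k : ℕ} {q : P 𝕜 d k}
    (hq : toBase k q ∈ ψ.source) : letter (prolongation ψ k q) = letter q := by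
  have hv : IsVertical k (prolongation ψ k q) ↔ IsVertical k q :=
    ⟨fun h => prolongation_symm hψ hq ▸
      isVertical_prolongation hψ.symm (toBase_prolongation_mem hψ hq) h,
      isVertical_prolongation hψ hq⟩
  have hc : IsCritical (prolongation ψ k q) ↔ IsCritical q :=
    ⟨fun h => prolongation_symm hψ hq ▸
      isCritical_prolongation hψ.symm (toBase_prolongation_mem hψ hq) h,
      isCritical_prolongation hψ hq⟩
  classical exact if_congr hv rfl (if_congr hc rfl rfl)

theorem code_prolongation (hψ : IsAnalyticDiffeo ψ) : ∀ {k : ℕ} {q : P 𝕜 d k},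
    toBase k q ∈ ψ.source → code k (prolongation ψ k q) = code k q
  | 0, _, _ => rfl
  | k + 1, q, hq => by
    change code k (proj k (prolongation ψ (k + 1) q)) ++ [letter (prolongation ψ (k + 1) q)] =
      code k (proj k q) ++ [letter q]
    rw [letter_prolongation hψ hq, proj_prolongation hψ hq,
      code_prolongation hψ (q := proj k q) hq]

/-- This is the easy half of the theorem: an orbit meeting an RVT class is contained in it. -/
theorem code_eq_of_equivalent {k : ℕ} {p q : P 𝕜 d k} (h : Equivalent p q) :
    code k q = code k p := by
  obtain ⟨ψ, h1, h2, h3, rfl⟩ := h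
  exact code_prolongation ⟨h1, h2⟩ h3

end Monster

/-! ### Global integral curves by quadrature. -/

theorem Polynomial.exists_derivative_eq {𝕜 : Type u} [RCLike 𝕜] (p : Polynomial 𝕜) (c : 𝕜) :
    ∃ q : Polynomial 𝕜, q.derivative = p ∧ q.eval 0 = c := by
  obtain ⟨q, hq⟩ : ∃ q : Polynomial 𝕜, q.derivative = p := by
    induction p using Polynomial.induction_on' with
    | add p q hp hq =>
      obtain ⟨p', rfl⟩ := hp
      obtain ⟨q', rfl⟩ := hq
      exact ⟨p' + q', Polynomial.derivative_add⟩
    | monomial n a =>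
      refine ⟨Polynomial.monomial (n + 1) (a / (n + 1)), ?_⟩
      rw [Polynomial.derivative_monomial]
      have : (n : 𝕜) + 1 ≠ 0 := Nat.cast_add_one_ne_zero n
      push_cast
      rw [div_mul_cancel₀ _ this]
  exact ⟨q + Polynomial.C (c - q.eval 0), by simp [hq], by simp⟩

namespace DistManifold

variable {𝕜 E : Type u} [RCLike 𝕜] [NormedAddCommGroup E] [NormedSpace 𝕜 E] {d : ℕ}
  (M : DistManifold 𝕜 E d)

/-- In each chart, there are global integral curves of the distribution with polynomial
coefficients with respect to the frame. -/
def HasIntegralCurves : Prop := ∀ (c : M.man.ι) (p : Fin (d + 1) → Polynomial 𝕜) (a₀ : E),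
  ∃ a : 𝕜 → E, a 0 = a₀ ∧ ContDiff 𝕜 ω a ∧
    ∀ t, HasDerivAt a (∑ j, (p j).eval t • M.frame c j (a t)) t

variable {M}

/-- The system is triangular, so no existence theorem for differential equations is needed. The
fibre coordinates are antiderivatives `U` of the given polynomials, and they turn the coefficients
one level down into products of polynomials. -/
theorem HasIntegralCurves.prolong (h : M.HasIntegralCurves) : M.prolong.HasIntegralCurves := by
  intro c p a₀
  obtain ⟨c, i, rfl⟩ := M.exists_pidx c
  choose U hU hU0 using fun l => Polynomial.exists_derivative_eq (p (i.succAbove l)) (a₀.2 l)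
  obtain ⟨b, hb0, hbc, hb⟩ := h c
    (fun j => p i * i.insertNth (α := fun _ => Polynomial 𝕜) 1 U j) a₀.1
  refine ⟨fun t => (b t, fun l => (U l).eval t), ?_, ?_, fun t => ?_⟩
  · exact Prod.ext hb0 (funext hU0)
  · exact hbc.prodMk (contDiff_pi.2 fun l => by simpa using (U l).contDiff_aeval (𝕜 := 𝕜) ω)
  · have hu : HasDerivAt (fun t l => (U l).eval t) (fun l => (p (i.succAbove l)).eval t) t :=
      hasDerivAt_pi.2 fun l => hU l ▸ (U l).hasDerivAt t
    convert! (hb t).prodMk hu using 1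
    have hh : ∀ j, (i.insertNth (α := fun _ => Polynomial 𝕜) 1 U j).eval t =
        hom i (fun l => (U l).eval t) j := by
      intro j
      refine Fin.succAboveCases i ?_ (fun l => ?_) j <;> simp
    rw [Fin.sum_univ_succAbove _ i]
    simp only [prolong_frame_same, prolong_frame_succAbove, Polynomial.eval_mul, hh, mul_smul,
      ← Finset.smul_sum]
    ext l
    · simp [Prod.fst_sum, vec]
    · simp [Prod.snd_sum, Pi.single_apply]

theorem horizontal_par {c : M.man.ι} {a : 𝕜 → E} {h : 𝕜 → Fin (d + 1) → 𝕜}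
    (ha : ContDiffAt 𝕜 ω a 0)
    (h' : ∀ᶠ t in 𝓝 0, HasDerivAt a (∑ j, h t j • M.frame c j (a t)) t) :
    M.Horizontal fun t => M.man.par c (a t) := by
  refine ⟨ParamManifold.contMDiffAt_par_comp c ha, ?_⟩
  filter_upwards [h'] with t ht
  rw [M.vel_par c ht, mem_ds_par]
  exact Submodule.sum_mem _ fun j _ => Submodule.smul_mem _ _ (Submodule.subset_span ⟨j, rfl⟩)

theorem Horizontal.comp {γ : 𝕜 → M.man.Pt} (h : M.Horizontal γ) {τ : 𝕜 → 𝕜}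
    (hτ : ContDiffAt 𝕜 ω τ 0) (h0 : τ 0 = 0) : M.Horizontal fun t => γ (τ t) := by
  have hc : Filter.Tendsto τ (𝓝 0) (𝓝 0) := by
    simpa [ContinuousAt, h0] using hτ.continuousAt
  have h1 : ContMDiffAt 𝓘(𝕜, 𝕜) 𝓘(𝕜, E) ω γ (τ 0) := h0.symm ▸ h.1
  refine ⟨h1.comp 0 hτ.contMDiffAt, ?_⟩
  filter_upwards [hc.eventually h.2, hc.eventually (eventually_contMDiffAt h.1),
    hτ.eventually (by simp)] with t h2 h3 h4
  have e := mfderiv_comp t (h3.mdifferentiableAt (by simp))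
    ((h4.differentiableAt (by simp)).mdifferentiableAt)
  rw [mfderiv_eq_fderiv] at e
  have e2 : M.man.vel (fun t => γ (τ t)) t = deriv τ t • M.man.vel γ (τ t) := by
    refine (DFunLike.congr_fun e (1 : 𝕜)).trans ?_
    have e3 := (mfderiv 𝓘(𝕜, 𝕜) 𝓘(𝕜, E) γ (τ t)).map_smul (deriv τ t) (1 : 𝕜)
    refine Eq.trans ?_ e3
    change (mfderiv 𝓘(𝕜, 𝕜) 𝓘(𝕜, E) γ (τ t)) _ = _
    exact congrArg _ (by simp : (fderiv 𝕜 τ t) 1 = deriv τ t • (1 : 𝕜))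
  rw [e2]
  exact Submodule.smul_mem _ _ h2

end DistManifold

/-! ### Horizontal curves in the tower are determined by their base curves. -/

namespace Monster

open DistManifold

variable {𝕜 : Type u} [RCLike 𝕜] {d : ℕ}

theorem hasIntegralCurves_base : (base 𝕜 d).HasIntegralCurves := by
  intro c p a₀
  choose U hU hU0 using fun l => Polynomial.exists_derivative_eq (p l) (a₀ l)
  refine ⟨fun t l => (U l).eval t, funext hU0,
    contDiff_pi.2 fun l => by simpa using (U l).contDiff_aeval (𝕜 := 𝕜) ω, fun t => ?_⟩
  refine hasDerivAt_pi.2 fun l => ?_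
  convert! (U l).hasDerivAt t using 1
  simp [base, hU, Pi.single_apply]

theorem hasIntegralCurves : ∀ k : ℕ, (tower 𝕜 d k).HasIntegralCurves
  | 0 => hasIntegralCurves_base
  | k + 1 => (hasIntegralCurves k).prolong

theorem vel_ne_zero_of_toBase : ∀ {k : ℕ} {γ : 𝕜 → P 𝕜 d k} {t : 𝕜},
    ContMDiffAt 𝓘(𝕜, 𝕜) 𝓘(𝕜, Model 𝕜 d k) ω γ t →
    (tower 𝕜 d 0).man.vel (fun s => toBase k (γ s)) t ≠ 0 → (tower 𝕜 d k).man.vel γ t ≠ 0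
  | 0, _, _, _, h => h
  | k + 1, γ, t, hγ, h => by
    have h1 := vel_ne_zero_of_toBase (γ := fun s => (tower 𝕜 d k).pr (γ s))
      (((tower 𝕜 d k).contMDiffAt_pr (γ t)).comp t hγ) h
    intro h2
    have e := ParamManifold.vel_comp (M := (tower 𝕜 d k).prolong.man) (N := (tower 𝕜 d k).man)
      (((tower 𝕜 d k).contMDiffAt_pr (γ t)).mdifferentiableAt (by simp))
      (hγ.mdifferentiableAt (by simp))
    rw [e] at h1
    refine h1 ((congrArg ((tower 𝕜 d k).dpr (γ t)) h2).trans (map_zero _))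

/-- Induction on the level with `Horizontal.eventuallyEq`. A nonzero velocity in the base forces
nonzero velocities at all levels above, so the hypothesis propagates. -/
theorem eventuallyEq_of_toBase : ∀ {k : ℕ} {γ γ' : 𝕜 → P 𝕜 d k},
    (tower 𝕜 d k).Horizontal γ → (tower 𝕜 d k).Horizontal γ' →
    (fun t => toBase k (γ t)) =ᶠ[𝓝 0] (fun t => toBase k (γ' t)) →
    (∀ᶠ t in 𝓝[≠] (0 : 𝕜), (tower 𝕜 d 0).man.vel (fun s => toBase k (γ s)) t ≠ 0) →
    γ =ᶠ[𝓝 0] γ'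
  | 0, _, _, _, _, h, _ => h
  | k + 1, γ, γ', h1, h2, h3, h4 => by
    have h5 := eventuallyEq_of_toBase h1.proj h2.proj h3 h4
    refine h1.eventuallyEq h2 h5 ?_
    filter_upwards [h4, nhdsWithin_le_nhds (eventually_contMDiffAt h1.proj.1)] with t h6 h7
    exact vel_ne_zero_of_toBase h7 h6

/-- The image of `γ` under the prolonged diffeomorphism and `γ'` are horizontal lifts of the same
base curve `x`. Their germs agree, in particular at `0`. -/
theorem equivalent_of_horizontal {k : ℕ} {γ γ' : 𝕜 → P 𝕜 d k}
    (h : (tower 𝕜 d k).Horizontal γ) (h' : (tower 𝕜 d k).Horizontal γ')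
    {ψ : OpenPartialHomeomorph (Fin (d + 1) → 𝕜) (Fin (d + 1) → 𝕜)} (hψ : IsAnalyticDiffeo ψ)
    (h0 : toBase k (γ 0) ∈ ψ.source) {x : 𝕜 → Fin (d + 1) → 𝕜}
    (hx : ∀ᶠ t in 𝓝 0, ψ (toBase k (γ t)) = x t) (hx' : ∀ᶠ t in 𝓝 0, toBase k (γ' t) = x t)
    (hd : ∀ᶠ t in 𝓝[≠] 0, DifferentiableAt 𝕜 x t ∧ deriv x t ≠ 0) :
    Equivalent (γ 0) (γ' 0) := by
  refine ⟨ψ, hψ.1, hψ.2, h0, ?_⟩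
  have hS := hψ.symmPair k
  have h1 := hS.horizontal_comp h h0
  have hxe : (fun t => toBase k (prolongation ψ k (γ t))) =ᶠ[𝓝 0] x := by
    filter_upwards [hx, h.1.continuousAt (hS.isOpen_source.mem_nhds h0)] with t h2 h3
    rw [toBase_prolongation hψ h3, h2]
  refine (eventuallyEq_of_toBase h1 h' (hxe.trans (Filter.EventuallyEq.symm hx')) ?_).eq_of_nhds
  filter_upwards [hd, nhdsWithin_le_nhds hxe.eventuallyEq_nhds] with t h2 h3
  have e1 : (base 𝕜 d).man.vel (fun t => toBase k (prolongation ψ k (γ t))) t =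
      (base 𝕜 d).dP (bidx 𝕜 d) (x t) (deriv x t) :=
    (ParamManifold.vel_congr h3).trans ((base 𝕜 d).vel_par (bidx 𝕜 d) h2.1.hasDerivAt)
  refine fun h0 => h2.2 ((base 𝕜 d).dP_injective (bidx 𝕜 d) (x t) ?_)
  exact (e1.symm.trans h0).trans (map_zero _).symm

end Monster

/-! ### Analytic germs: parity, order of vanishing, iterated integrals. -/

section Germs

variable {𝕜 F : Type u} [RCLike 𝕜] [NormedAddCommGroup F] [NormedSpace 𝕜 F]

theorem tendsto_neg_nhds_zero : Filter.Tendsto (fun t : 𝕜 => -t) (𝓝 0) (𝓝 0) := by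
  simpa using (continuous_neg (G := 𝕜)).tendsto 0

theorem AnalyticAt.comp_neg {f : 𝕜 → F} (h : AnalyticAt 𝕜 f 0) :
    AnalyticAt 𝕜 (fun t => f (-t)) 0 :=
  AnalyticAt.comp_of_eq h (analyticAt_id.neg) (by simp)

/-- An even analytic germ is an analytic germ in the square of the variable. -/
theorem AnalyticAt.exists_eq_comp_sq [CompleteSpace F] {f : 𝕜 → F} (h : AnalyticAt 𝕜 f 0)
    (heven : ∀ᶠ t in 𝓝 0, f (-t) = f t) :
    ∃ g : 𝕜 → F, AnalyticAt 𝕜 g 0 ∧ ∀ᶠ t in 𝓝 0, f t = g (t ^ 2) := by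
  obtain ⟨p, r₀, hp⟩ := id h
  -- The series in `s = t²` keeps the even coefficients of `p`. Bounds on `‖p_(2n)‖ r^(2n)` give it
  -- radius at least `r²`.
  let q : FormalMultilinearSeries 𝕜 𝕜 F := fun n =>
    ContinuousMultilinearMap.mkPiRing 𝕜 (Fin n) (p.coeff (2 * n))
  have hq : 0 < q.radius := by
    obtain ⟨r, hr0, hr⟩ := ENNReal.lt_iff_exists_nnreal_btwn.1 (hp.r_pos.trans_le hp.r_le)
    obtain ⟨C, -, hC⟩ := p.norm_mul_pow_le_of_lt_radius hr
    have hle : ((r ^ 2 : NNReal) : ENNReal) ≤ q.radius := by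
      refine q.le_radius_of_bound C fun n => ?_
      have := hC (2 * n)
      rw [FormalMultilinearSeries.norm_apply_eq_norm_coef] at this
      simp only [q, ContinuousMultilinearMap.norm_mkPiRing]
      rw [NNReal.coe_pow, ← pow_mul]
      exact this
    refine lt_of_lt_of_le ?_ hle
    have : 0 < r := by exact_mod_cast hr0
    exact_mod_cast pow_pos this 2
  refine ⟨q.sum, (q.hasFPowerSeriesOnBall hq).analyticAt, ?_⟩
  have hs := hasFPowerSeriesAt_iff.1 hp.hasFPowerSeriesAt
  filter_upwards [hs, tendsto_neg_nhds_zero.eventually hs, heven] with t h1 h2 h3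
  rw [zero_add] at h1 h2
  rw [h3] at h2
  -- Averaging the series at `t` and `-t` kills the odd terms without any appeal to uniqueness of
  -- coefficients.
  have h4 : HasSum (fun n => (2 : 𝕜)⁻¹ • (t ^ n • p.coeff n + (-t) ^ n • p.coeff n)) (f t) := by
    convert! (h1.add h2).const_smul (2 : 𝕜)⁻¹ using 1
    rw [← two_smul 𝕜, smul_smul, inv_mul_cancel₀ two_ne_zero, one_smul]
  have hinj : Function.Injective fun n : ℕ => 2 * n := fun a b h => by simpa using h
  rw [← hinj.hasSum_iff] at h4
  · have h5 := h4.tsum_eq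
    rw [← h5]
    refine tsum_congr fun n => ?_
    simp only [Function.comp, q, ContinuousMultilinearMap.mkPiRing_apply, Finset.prod_const,
      Finset.card_univ, Fintype.card_fin]
    rw [(even_two_mul n).neg_pow, ← two_smul 𝕜, smul_smul, inv_mul_cancel₀ two_ne_zero, one_smul,
      pow_mul]
  · intro n hn
    have : Odd n := by
      rw [← Nat.not_even_iff_odd]
      rintro ⟨m, rfl⟩
      exact hn ⟨m, by simp; ring⟩
    rw [this.neg_pow]
    simp

theorem AnalyticAt.exists_eq_smul {f : 𝕜 → F} (h : AnalyticAt 𝕜 f 0) (h0 : f 0 = 0) :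
    ∃ g : 𝕜 → F, AnalyticAt 𝕜 g 0 ∧ (∀ t, f t = t • g t) ∧ g 0 = deriv f 0 := by
  obtain ⟨p, hp⟩ := id h
  refine ⟨dslope f 0, ⟨_, hp.has_fpower_series_dslope_fslope⟩, fun t => ?_, dslope_same f 0⟩
  have := sub_smul_dslope f 0 t
  rw [sub_zero, h0, sub_zero] at this
  exact this.symm

theorem AnalyticAt.eventually_hasDerivAt [CompleteSpace F] {f : 𝕜 → F} (h : AnalyticAt 𝕜 f 0) :
    ∀ᶠ t in 𝓝 0, HasDerivAt f (deriv f t) t :=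
  h.eventually_analyticAt.mono fun _ ht => ht.differentiableAt.hasDerivAt

/-- Integration raises the order of vanishing by one. -/
theorem AnalyticAt.exists_eq_pow_smul_of_deriv [CompleteSpace F] {f : 𝕜 → F}
    (hf : AnalyticAt 𝕜 f 0) (h0 : f 0 = 0) (N : ℕ) : ∀ {h : 𝕜 → F}, AnalyticAt 𝕜 h 0 →
    (∀ᶠ t in 𝓝 0, HasDerivAt f (t ^ N • h t) t) →
    ∃ g : 𝕜 → F, AnalyticAt 𝕜 g 0 ∧ (∀ᶠ t in 𝓝 0, f t = t ^ (N + 1) • g t) ∧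
      ((N + 1 : ℕ) : 𝕜) • g 0 = h 0 := by
  -- The leading value comes from differentiating `t^(N+1) g`, cancelling `t^N` off `0` and letting
  -- `t` tend to `0`.
  have hval : ∀ (N : ℕ) {h g : 𝕜 → F}, AnalyticAt 𝕜 h 0 → AnalyticAt 𝕜 g 0 →
      (∀ᶠ t in 𝓝 0, HasDerivAt f (t ^ N • h t) t) →
      (∀ᶠ t in 𝓝 0, f t = t ^ (N + 1) • g t) → ((N + 1 : ℕ) : 𝕜) • g 0 = h 0 := by
    intro N h g hh hg hd he
    have key : ∀ᶠ t in 𝓝[≠] (0 : 𝕜), ((N + 1 : ℕ) : 𝕜) • g t + t • deriv g t = h t := by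
      filter_upwards [nhdsWithin_le_nhds hd, nhdsWithin_le_nhds (Filter.EventuallyEq.eventuallyEq_nhds he),
        nhdsWithin_le_nhds hg.eventually_hasDerivAt, self_mem_nhdsWithin] with t h1 h2 h3 h4
      have h5 := ((hasDerivAt_pow (N + 1) t).smul h3).congr_of_eventuallyEq h2
      have h6 := h1.unique h5
      have h7 : t ^ N • (((N + 1 : ℕ) : 𝕜) • g t + t • deriv g t) = t ^ N • h t := by
        rw [h6, smul_add, smul_smul, smul_smul, add_comm, add_tsub_cancel_right, pow_succ,
          mul_comm (t ^ N) ((N + 1 : ℕ) : 𝕜)]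
      exact smul_right_injective F (pow_ne_zero N h4) h7
    have c1 : ContinuousAt (fun t => ((N + 1 : ℕ) : 𝕜) • g t + t • deriv g t) 0 :=
      (hg.continuousAt.const_smul _).add (continuousAt_id.smul hg.deriv.continuousAt)
    have := tendsto_nhds_unique_of_eventuallyEq (c1.tendsto.mono_left nhdsWithin_le_nhds)
      (hh.continuousAt.tendsto.mono_left nhdsWithin_le_nhds) key
    simpa using this
  induction N with
  | zero =>
    intro h hh hd
    obtain ⟨g, hg, hfg, -⟩ := hf.exists_eq_smul h0
    have he : ∀ᶠ t in 𝓝 0, f t = t ^ (0 + 1) • g t := Filter.Eventually.of_forall fun t => by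
      rw [hfg t, zero_add, pow_one]
    exact ⟨g, hg, he, hval 0 hh hg hd he⟩
  | succ N ih =>
    intro h hh hd
    -- Moving one factor `t` into `h` makes the leading value of `g` vanish, so a further factor `t`
    -- splits off.
    obtain ⟨g, hg, hfg, hg0⟩ := ih (h := fun t => t • h t) (analyticAt_id.smul hh) (by
      filter_upwards [hd] with t ht
      rwa [smul_smul, ← pow_succ])
    rw [zero_smul] at hg0
    obtain ⟨g', hg', hgg', -⟩ := hg.exists_eq_smul
      ((smul_eq_zero.1 hg0).resolve_left (Nat.cast_ne_zero.2 (Nat.succ_ne_zero N)))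
    have he : ∀ᶠ t in 𝓝 0, f t = t ^ (N + 1 + 1) • g' t := by
      filter_upwards [hfg] with t ht
      rw [ht, hgg', smul_smul, ← pow_succ]
    exact ⟨g', hg', he, hval (N + 1) hh hg' hd he⟩

/-- `Y` is obtained from `u` by `n + 1` integrations against `lam(t) dt`. -/
def IterInt (lam : 𝕜 → 𝕜) : ℕ → (𝕜 → F) → (𝕜 → F) → Prop
  | 0, Y, u => AnalyticAt 𝕜 u 0 ∧ AnalyticAt 𝕜 Y 0 ∧ ∀ᶠ t in 𝓝 0, HasDerivAt Y (lam t • u t) t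
  | n + 1, Y, u => ∃ V, IterInt lam n Y V ∧ AnalyticAt 𝕜 u 0 ∧
      ∀ᶠ t in 𝓝 0, HasDerivAt V (lam t • u t) t

theorem IterInt.analyticAt_right {lam : 𝕜 → 𝕜} : ∀ {n : ℕ} {Y u : 𝕜 → F},
    IterInt lam n Y u → AnalyticAt 𝕜 u 0
  | 0, _, _, h => h.1
  | _ + 1, _, _, ⟨_, _, h, _⟩ => h

theorem IterInt.analyticAt_left {lam : 𝕜 → 𝕜} : ∀ {n : ℕ} {Y u : 𝕜 → F},
    IterInt lam n Y u → AnalyticAt 𝕜 Y 0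
  | 0, _, _, h => h.2.1
  | _ + 1, _, _, ⟨_, h, _⟩ => h.analyticAt_left

/-- Substitution rule: the form `lam dt` pulls back under `τ` to `lam' dt`, at each of the
integrations. -/
theorem IterInt.comp {lam lam' τ : 𝕜 → 𝕜} (hτ : AnalyticAt 𝕜 τ 0) (h0 : τ 0 = 0)
    (hl : ∀ᶠ t in 𝓝 0, deriv τ t * lam (τ t) = lam' t) : ∀ {n : ℕ} {Y u : 𝕜 → F},
    IterInt lam n Y u → IterInt lam' n (fun t => Y (τ t)) (fun t => u (τ t)) := by
  have hc : Filter.Tendsto τ (𝓝 0) (𝓝 0) := by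
    simpa [ContinuousAt, h0] using hτ.continuousAt
  have aux : ∀ {V u : 𝕜 → F}, (∀ᶠ t in 𝓝 0, HasDerivAt V (lam t • u t) t) →
      ∀ᶠ t in 𝓝 0, HasDerivAt (fun t => V (τ t)) (lam' t • u (τ t)) t := by
    intro V u h
    filter_upwards [hc.eventually h, hτ.eventually_hasDerivAt, hl] with t h1 h2 h3
    rw [← h3, mul_smul]
    exact HasDerivAt.scomp t h1 h2
  intro n
  induction n with
  | zero =>
    rintro Y u ⟨h1, h2, h3⟩
    exact ⟨h1.comp_of_eq hτ h0, h2.comp_of_eq hτ h0, aux h3⟩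
  | succ n ih =>
    rintro Y u ⟨V, h1, h2, h3⟩
    exact ⟨_, ih h1, h2.comp_of_eq hτ h0, aux h3⟩

/-- The odd part of an `(n + 1)`-fold integral against `2κt dt`. -/
theorem IterInt.odd_part [CompleteSpace F] {κ : 𝕜} (hκ : κ ≠ 0) : ∀ {n : ℕ} {Y u : 𝕜 → F},
    IterInt (fun t => 2 * κ * t) n Y u → ∀ {N : ℕ} {g : 𝕜 → F}, AnalyticAt 𝕜 g 0 → g 0 ≠ 0 →
    (∀ᶠ t in 𝓝 0, u t - u (-t) = t ^ N • g t) →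
    ∃ G : 𝕜 → F, AnalyticAt 𝕜 G 0 ∧ G 0 ≠ 0 ∧
      ∀ᶠ t in 𝓝 0, Y t - Y (-t) = t ^ (N + 2 * n + 2) • G t := by
  -- One integration: since `2κt` is odd, `V(t) - V(-t)` has derivative `2κt (u(t) - u(-t))`. The
  -- order goes up by two, one from the factor `t` and one from integrating.
  have aux : ∀ {V u : 𝕜 → F}, AnalyticAt 𝕜 V 0 →
      (∀ᶠ t in 𝓝 0, HasDerivAt V ((2 * κ * t) • u t) t) →
      ∀ {N : ℕ} {g : 𝕜 → F}, AnalyticAt 𝕜 g 0 → g 0 ≠ 0 →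
      (∀ᶠ t in 𝓝 0, u t - u (-t) = t ^ N • g t) →
      ∃ G : 𝕜 → F, AnalyticAt 𝕜 G 0 ∧ G 0 ≠ 0 ∧
        ∀ᶠ t in 𝓝 0, V t - V (-t) = t ^ (N + 2) • G t := by
    intro V u hV hd N g hg hg0 he
    obtain ⟨G, hG, hVG, hG0⟩ := AnalyticAt.exists_eq_pow_smul_of_deriv
      (f := fun t => V t - V (-t)) (hV.sub hV.comp_neg) (by simp) (N + 1)
      (h := fun t => (2 * κ) • g t) (analyticAt_const.smul hg) (by
        filter_upwards [hd, tendsto_neg_nhds_zero.eventually hd, he] with t h1 h2 h3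
        have h4 := h1.sub (HasDerivAt.scomp t h2 (hasDerivAt_neg t))
        convert! h4 using 1
        rw [pow_succ, mul_comm, mul_smul, smul_comm (t ^ N), ← h3]
        module)
    refine ⟨G, hG, fun h => ?_, hVG⟩
    rw [h, smul_zero] at hG0
    exact (smul_ne_zero (mul_ne_zero two_ne_zero hκ) hg0) hG0.symm
  intro n
  induction n with
  | zero =>
    rintro Y u ⟨-, h2, h3⟩ N g hg hg0 he
    exact aux h2 h3 hg hg0 he
  | succ n ih =>
    rintro Y u ⟨V, h1, -, h3⟩ N g hg hg0 he
    obtain ⟨G, hG, hG0, hGe⟩ := aux h1.analyticAt_right h3 hg hg0 he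
    obtain ⟨G', hG', hG0', hGe'⟩ := ih h1 hG hG0 hGe
    refine ⟨G', hG', hG0', ?_⟩
    rwa [show N + 2 * (n + 1) + 2 = N + 2 + 2 * n + 2 by ring]

/-- The odd part of `u` has order exactly `1`, so that of `Y` has order `1 + 2(n + 1) = 2n + 3`. The
even part, and the odd part divided by `t^(2n+3)`, are even germs and hence germs in `t²`. -/
theorem IterInt.normal_form [CompleteSpace F] {κ : 𝕜} (hκ : κ ≠ 0) {n : ℕ} {Y u : 𝕜 → F}
    (h : IterInt (fun t => 2 * κ * t) n Y u) (hu : deriv u 0 ≠ 0) :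
    ∃ A B : 𝕜 → F, AnalyticAt 𝕜 A 0 ∧ AnalyticAt 𝕜 B 0 ∧ B 0 ≠ 0 ∧
      ∀ᶠ t in 𝓝 0, Y t = A (t ^ 2) + t ^ (2 * n + 3) • B (t ^ 2) := by
  have hua := h.analyticAt_right
  have hY := h.analyticAt_left
  obtain ⟨g, hg, hge, hg0⟩ := (hua.sub hua.comp_neg).exists_eq_smul (by simp)
  have hd : deriv (u - fun t => u (-t)) 0 = (2 : 𝕜) • deriv u 0 := by
    have h1 := hua.differentiableAt.hasDerivAt
    have h2 : HasDerivAt u (deriv u 0) (-0) := by simpa using h1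
    refine (h1.sub (HasDerivAt.scomp (0 : 𝕜) h2 (hasDerivAt_neg 0))).deriv.trans ?_
    module
  rw [hd] at hg0
  obtain ⟨G, hG, hG0, hGe⟩ := h.odd_part hκ (N := 1) hg
    (hg0 ▸ smul_ne_zero two_ne_zero hu) (Filter.Eventually.of_forall fun t => by
      rw [pow_one]; exact hge t)
  obtain ⟨A, hA, hAe⟩ := (hY.add hY.comp_neg).exists_eq_comp_sq
    (Filter.Eventually.of_forall fun t => by simp [add_comm])
  have hodd : Odd (1 + 2 * n + 2) := ⟨n + 1, by ring⟩
  obtain ⟨B, hB, hBe⟩ := hG.exists_eq_comp_sq (by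
    filter_upwards [hGe, tendsto_neg_nhds_zero.eventually hGe] with t h1 h2
    by_cases ht : t = 0
    · simp [ht]
    · rw [neg_neg, hodd.neg_pow, neg_smul, ← neg_sub, neg_inj, h1] at h2
      exact (smul_right_injective F (pow_ne_zero _ ht) h2).symm)
  refine ⟨fun s => (2 : 𝕜)⁻¹ • A s, fun s => (2 : 𝕜)⁻¹ • B s, analyticAt_const.smul hA,
    analyticAt_const.smul hB, ?_, ?_⟩
  · have := hBe.self_of_nhds
    rw [zero_pow two_ne_zero] at this
    exact smul_ne_zero (inv_ne_zero two_ne_zero) (this ▸ hG0)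
  · filter_upwards [hAe, hGe, hBe] with t h1 h2 h3
    have h1' : Y t + Y (-t) = A (t ^ 2) := h1
    rw [smul_comm, ← h3, ← h1', show 2 * n + 3 = 1 + 2 * n + 2 by ring, ← h2, ← smul_add,
      add_add_sub_cancel, ← two_smul 𝕜, smul_smul, inv_mul_cancel₀ two_ne_zero, one_smul]

theorem AnalyticAt.exists_localInverse {f : 𝕜 → 𝕜} {x : 𝕜} (hf : AnalyticAt 𝕜 f x)
    (hf' : deriv f x ≠ 0) : ∃ g : 𝕜 → 𝕜, AnalyticAt 𝕜 g (f x) ∧ g (f x) = x ∧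
      ∀ᶠ y in 𝓝 (f x), f (g y) = y :=
  ⟨_, hf.analyticAt_localInverse hf', HasStrictFDerivAt.localInverse_apply_image ..,
    HasStrictDerivAt.eventually_right_inverse ..⟩

/-- A function with a nondegenerate critical point is quadratic in a suitable coordinate. -/
theorem exists_quadratic_coordinate {x lam : 𝕜 → 𝕜} (hx : AnalyticAt 𝕜 x 0)
    (hlam : AnalyticAt 𝕜 lam 0) (hd : ∀ᶠ t in 𝓝 0, HasDerivAt x (lam t) t) (h0 : lam 0 = 0)
    (h1 : deriv lam 0 ≠ 0) :
    ∃ (τ : 𝕜 → 𝕜) (κ : 𝕜), AnalyticAt 𝕜 τ 0 ∧ τ 0 = 0 ∧ deriv τ 0 ≠ 0 ∧ κ ≠ 0 ∧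
      (∀ᶠ t in 𝓝 0, x (τ t) = x 0 + κ * t ^ 2) ∧
      ∀ᶠ t in 𝓝 0, deriv τ t * lam (τ t) = 2 * κ * t := by
  obtain ⟨h, hh, hlh, hh0⟩ := hlam.exists_eq_smul h0
  obtain ⟨g, hg, hxg, hg0⟩ := AnalyticAt.exists_eq_pow_smul_of_deriv
    (f := fun t => x t - x 0) (hx.sub analyticAt_const) (by simp) 1 hh (by
      filter_upwards [hd] with t ht
      rw [pow_one, ← hlh]
      exact ht.sub_const _)
  have hg0' : g 0 ≠ 0 := by
    intro h2
    rw [h2, smul_zero, hh0] at hg0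
    exact h1 hg0.symm
  -- `r` is the branch of the square root at `1`. With `S = t r(g/g(0))` one has `x = x(0) + g(0)
  -- S²`, and `τ` is the inverse of `S`. Keeping `κ = g 0` avoids a root of `g(0)`, which need not
  -- exist over the reals.
  obtain ⟨r, hr, hr1, hr2⟩ := AnalyticAt.exists_localInverse (f := fun z : 𝕜 => z ^ 2) (x := 1)
    (analyticAt_id.pow 2) (by simp)
  simp only [one_pow] at hr hr1 hr2
  set S : 𝕜 → 𝕜 := fun t => t * r (g t / g 0) with hS
  have hgd : AnalyticAt 𝕜 (fun t => g t / g 0) 0 := hg.div analyticAt_const hg0'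
  have hgd1 : g 0 / g 0 = 1 := div_self hg0'
  have hrg : AnalyticAt 𝕜 (fun t => r (g t / g 0)) 0 := hr.comp_of_eq hgd hgd1
  have hSa : AnalyticAt 𝕜 S 0 := analyticAt_id.mul hrg
  have hS0 : S 0 = 0 := by simp [hS]
  have hS' : deriv S 0 = 1 := by
    refine ((hasDerivAt_id (0 : 𝕜)).mul hrg.differentiableAt.hasDerivAt).deriv.trans ?_
    simp [hgd1, hr1]
  obtain ⟨τ, hτ, hτ0, hτS⟩ := hSa.exists_localInverse (by simp [hS'])
  rw [hS0] at hτ hτ0 hτS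
  have hc : Filter.Tendsto τ (𝓝 0) (𝓝 0) := by
    simpa [ContinuousAt, hτ0] using hτ.continuousAt
  have hxτ : ∀ᶠ t in 𝓝 0, x (τ t) = x 0 + g 0 * t ^ 2 := by
    have hgt : Filter.Tendsto (fun t => g t / g 0) (𝓝 0) (𝓝 1) := by
      simpa [ContinuousAt, hgd1] using hgd.continuousAt
    filter_upwards [hτS, hc.eventually hxg, hc.eventually (hgt.eventually hr2)] with t h3 h4 h5
    rw [sub_eq_iff_eq_add'] at h4
    have h6 : t ^ 2 = τ t ^ 2 * (g (τ t) / g 0) := by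
      conv_lhs => rw [← h3]
      simp only [hS, mul_pow, h5]
    rw [h4, h6, smul_eq_mul]
    field_simp
    ring
  refine ⟨τ, g 0, hτ, hτ0, ?_, hg0', hxτ, ?_⟩
  · intro h3
    have h4 := hτ.differentiableAt.hasDerivAt
    have h5 : HasDerivAt S 1 (τ 0) := hτ0.symm ▸ hS' ▸ hSa.differentiableAt.hasDerivAt
    have h6 := (h5.comp 0 h4).congr_of_eventuallyEq (f₁ := id) (by
      filter_upwards [hτS] with t ht using ht.symm)
    have := h6.unique (hasDerivAt_id 0)
    rw [h3, mul_zero] at this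
    exact zero_ne_one this
  · filter_upwards [Filter.EventuallyEq.eventuallyEq_nhds hxτ, hc.eventually hd, hτ.eventually_hasDerivAt] with t h3 h4 h5
    have h6 := (h4.comp t h5).congr_of_eventuallyEq h3.symm
    have h7 := ((hasDerivAt_pow 2 t).const_mul (g 0)).const_add (x 0)
    rw [mul_comm, h6.unique h7]
    simp
    ring

end Germs

/-! ### Equivalence of cusps of the same order. -/

section Straightening

variable {𝕜 : Type u} [RCLike 𝕜] {d : ℕ}

/-- A fibered analytic diffeomorphism germ taking the standard cusp to a given one. -/
theorem exists_cusp_straightening (hd : 0 < d) {A B : 𝕜 → Fin d → 𝕜} (hA : AnalyticAt 𝕜 A 0)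
    (hB : AnalyticAt 𝕜 B 0) (hB0 : B 0 ≠ 0) {κ : 𝕜} (hκ : κ ≠ 0) (x₀ : 𝕜) (N : ℕ) :
    ∃ Φ : OpenPartialHomeomorph (𝕜 × (Fin d → 𝕜)) (𝕜 × (Fin d → 𝕜)),
      AnalyticOnNhd 𝕜 Φ Φ.source ∧ AnalyticOnNhd 𝕜 Φ.symm Φ.target ∧
      ∀ᶠ t : 𝕜 in 𝓝 0, (t ^ 2, t ^ N • (Pi.single ⟨0, hd⟩ 1 : Fin d → 𝕜)) ∈ Φ.source ∧
        Φ (t ^ 2, t ^ N • (Pi.single ⟨0, hd⟩ 1 : Fin d → 𝕜)) =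
          (x₀ + κ * t ^ 2, A (t ^ 2) + t ^ N • B (t ^ 2)) := by
  obtain ⟨l, hl⟩ : ∃ l, B 0 l ≠ 0 := Function.ne_iff.1 hB0
  have hBl : ContinuousAt (fun s => B s l) 0 := (continuous_apply l).continuousAt.comp hB.continuousAt
  obtain ⟨V, hV, hVo, hV0⟩ := eventually_nhds_iff.1
    (hA.eventually_analyticAt.and (hB.eventually_analyticAt.and (hBl.eventually_ne hl)))
  let π := Equiv.swap (⟨0, hd⟩ : Fin d) l
  have hππ : ∀ j, π (π j) = j := fun j => Equiv.swap_apply_self _ _ _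
  have hπl : π l = ⟨0, hd⟩ := Equiv.swap_apply_right _ _
  let e : Fin d → 𝕜 := Pi.single l 1
  have hel : e l = 1 := Pi.single_eq_same _ _
  -- Over each `p.1` the map is affine in the fibre: coordinates `0` and `l` are swapped, and then
  -- the basis vector `e` is replaced by `B p.1`. It is invertible where `B p.1 l ≠ 0`, and `g`
  -- solves the `l`-th equation first.
  let f : 𝕜 × (Fin d → 𝕜) → 𝕜 × (Fin d → 𝕜) := fun p =>
    (x₀ + κ * p.1, fun j => A p.1 j + (p.2 (π j) + p.2 (π l) * (B p.1 j - e j)))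
  let s : 𝕜 × (Fin d → 𝕜) → 𝕜 := fun p => (p.1 - x₀) / κ
  let g : 𝕜 × (Fin d → 𝕜) → 𝕜 × (Fin d → 𝕜) := fun p =>
    (s p, fun j => p.2 (π j) - A (s p) (π j) -
      (p.2 l - A (s p) l) / B (s p) l * (B (s p) (π j) - e (π j)))
  have hco : ∀ (p : 𝕜 × (Fin d → 𝕜)) j, AnalyticAt 𝕜 (fun p : 𝕜 × (Fin d → 𝕜) => p.2 j) p :=
    fun p j => ((ContinuousLinearMap.proj (R := 𝕜) j).comp
      (ContinuousLinearMap.snd 𝕜 𝕜 (Fin d → 𝕜))).analyticAt p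
  have hpi : ∀ {C : 𝕜 → Fin d → 𝕜} {r : 𝕜 × (Fin d → 𝕜) → 𝕜} {p : 𝕜 × (Fin d → 𝕜)},
      AnalyticAt 𝕜 C (r p) → AnalyticAt 𝕜 r p → ∀ j, AnalyticAt 𝕜 (fun p => C (r p) j) p :=
    fun hC hr j => analyticAt_pi_iff.1 (hC.comp hr) j
  have hs : ∀ p, AnalyticAt 𝕜 s p := fun p =>
    (analyticAt_fst.sub analyticAt_const).div analyticAt_const hκ
  have hf : AnalyticOnNhd 𝕜 f {p | p.1 ∈ V} := by
    intro p hp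
    have h := hV p.1 hp
    refine (analyticAt_const.add (analyticAt_const.mul analyticAt_fst)).prod
      (analyticAt_pi_iff.2 fun j => ?_)
    exact (hpi h.1 analyticAt_fst j).add ((hco p _).add ((hco p _).mul
      ((hpi h.2.1 analyticAt_fst j).sub analyticAt_const)))
  have hg : AnalyticOnNhd 𝕜 g {p | s p ∈ V} := by
    intro p hp
    have h := hV (s p) hp
    refine (hs p).prod (analyticAt_pi_iff.2 fun j => ?_)
    exact ((hco p _).sub (hpi h.1 (hs p) _)).sub ((((hco p _).sub (hpi h.1 (hs p) _)).div
      (hpi h.2.1 (hs p) _) h.2.2).mul ((hpi h.2.1 (hs p) _).sub analyticAt_const))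
  have hsf : ∀ p, s (f p) = p.1 := fun p => by
    simp only [s, f]
    field_simp
    ring
  refine ⟨{ toFun := f, invFun := g, source := {p | p.1 ∈ V}, target := {p | s p ∈ V}
            map_source' := fun p hp => by
              rw [mem_ofPred_eq, hsf]
              exact hp
            map_target' := fun p hp => hp
            left_inv' := fun p hp => ?_
            right_inv' := fun p hp => ?_
            open_source := hVo.preimage continuous_fst
            open_target := hVo.preimage
              (continuous_iff_continuousAt.2 fun p => (hs p).continuousAt)
            continuousOn_toFun := hf.continuousOn
            continuousOn_invFun := hg.continuousOn }, hf, hg, ?_⟩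
  · have hb := (hV p.1 hp).2.2
    refine Prod.ext (hsf p) (funext fun j => ?_)
    change (f p).2 (π j) - A (s (f p)) (π j) - ((f p).2 l - A (s (f p)) l) / B (s (f p)) l *
      (B (s (f p)) (π j) - e (π j)) = p.2 j
    rw [hsf]
    simp only [f, hππ, hel]
    field_simp
    ring
  · have hb := (hV (s p) hp).2.2
    refine Prod.ext ?_ (funext fun j => ?_)
    · change x₀ + κ * s p = p.1
      simp only [s]
      field_simp
      ring
    · simp only [f, g, hππ, hel]
      field_simp
      ring
  · have ht : Filter.Tendsto (fun t : 𝕜 => t ^ 2) (𝓝 0) (𝓝 0) := by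
      simpa using (continuous_pow (M := 𝕜) 2).tendsto 0
    filter_upwards [ht (hVo.mem_nhds hV0)] with t h
    refine ⟨h, Prod.ext rfl (funext fun j => ?_)⟩
    have h1 : (Pi.single ⟨0, hd⟩ 1 : Fin d → 𝕜) (π j) = e j := by
      by_cases hj : j = l
      · subst hj
        rw [hπl, hel, Pi.single_eq_same]
      · have : π j ≠ ⟨0, hd⟩ := fun h => hj (π.injective (h.trans hπl.symm))
        simp [e, Pi.single_eq_of_ne this, Pi.single_eq_of_ne hj]
    change A (t ^ 2) j + (t ^ N * (Pi.single ⟨0, hd⟩ 1 : Fin d → 𝕜) (π j) +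
      t ^ N * (Pi.single ⟨0, hd⟩ 1 : Fin d → 𝕜) (π l) * (B (t ^ 2) j - e j)) = _
    rw [h1, hπl, Pi.single_eq_same]
    simp
    ring

/-- Insertion of a coordinate. -/
noncomputable def insertCoord (i : Fin (d + 1)) :
    (𝕜 × (Fin d → 𝕜)) ≃L[𝕜] (Fin (d + 1) → 𝕜) :=
  LinearEquiv.toContinuousLinearEquiv
    { toFun := fun p => i.insertNth (α := fun _ => 𝕜) p.1 p.2
      invFun := fun x => (x i, fun l => x (i.succAbove l))
      map_add' := fun p q => by
        ext j
        refine Fin.succAboveCases i ?_ (fun l => ?_) j <;> simp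
      map_smul' := fun z p => by
        ext j
        refine Fin.succAboveCases i ?_ (fun l => ?_) j <;> simp
      left_inv := fun p => by ext <;> simp
      right_inv := fun x => by
        ext j
        refine Fin.succAboveCases i ?_ (fun l => ?_) j <;> simp }

/-- Any two cusps of the same order are related by a local analytic diffeomorphism. -/
theorem exists_diffeo_of_cusps (hd : 0 < d) {i i' : Fin (d + 1)} {A B A' B' : 𝕜 → Fin d → 𝕜}
    (hA : AnalyticAt 𝕜 A 0) (hB : AnalyticAt 𝕜 B 0) (hB0 : B 0 ≠ 0)
    (hA' : AnalyticAt 𝕜 A' 0) (hB' : AnalyticAt 𝕜 B' 0) (hB0' : B' 0 ≠ 0) {κ κ' x₀ x₀' : 𝕜}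
    (hκ : κ ≠ 0) (hκ' : κ' ≠ 0) {N : ℕ} {X X' : 𝕜 → Fin (d + 1) → 𝕜}
    (hX : ∀ᶠ t in 𝓝 0, X t i = x₀ + κ * t ^ 2 ∧
      (fun l => X t (i.succAbove l)) = A (t ^ 2) + t ^ N • B (t ^ 2))
    (hX' : ∀ᶠ t in 𝓝 0, X' t i' = x₀' + κ' * t ^ 2 ∧
      (fun l => X' t (i'.succAbove l)) = A' (t ^ 2) + t ^ N • B' (t ^ 2)) :
    ∃ ψ : OpenPartialHomeomorph (Fin (d + 1) → 𝕜) (Fin (d + 1) → 𝕜),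
      Monster.IsAnalyticDiffeo ψ ∧ ∀ᶠ t in 𝓝 0, X t ∈ ψ.source ∧ ψ (X t) = X' t := by
  obtain ⟨Φ, h1, h2, h3⟩ := exists_cusp_straightening hd hA hB hB0 hκ x₀ N
  obtain ⟨Φ', h1', h2', h3'⟩ := exists_cusp_straightening hd hA' hB' hB0' hκ' x₀' N
  let I := (insertCoord (𝕜 := 𝕜) i).toHomeomorph.toOpenPartialHomeomorph
  let I' := (insertCoord (𝕜 := 𝕜) i').toHomeomorph.toOpenPartialHomeomorph
  have key : ∀ {F G H : Type u} [NormedAddCommGroup F] [NormedSpace 𝕜 F] [NormedAddCommGroup G]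
      [NormedSpace 𝕜 G] [NormedAddCommGroup H] [NormedSpace 𝕜 H] (a : OpenPartialHomeomorph F G)
      (b : OpenPartialHomeomorph G H), AnalyticOnNhd 𝕜 a a.source → AnalyticOnNhd 𝕜 b b.source →
      AnalyticOnNhd 𝕜 (a.trans b) (a.trans b).source := by
    intro F G H _ _ _ _ _ _ a b ha hb x hx
    rw [OpenPartialHomeomorph.trans_source] at hx
    exact (hb _ hx.2).comp (ha _ hx.1)
  have hI : ∀ s, AnalyticOnNhd 𝕜 I s := fun s x _ => (insertCoord (𝕜 := 𝕜) i).analyticAt x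
  have hIs : ∀ s, AnalyticOnNhd 𝕜 I.symm s := fun s x _ =>
    (insertCoord (𝕜 := 𝕜) i).symm.analyticAt x
  have hI' : ∀ s, AnalyticOnNhd 𝕜 I' s := fun s x _ => (insertCoord (𝕜 := 𝕜) i').analyticAt x
  have hIs' : ∀ s, AnalyticOnNhd 𝕜 I'.symm s := fun s x _ =>
    (insertCoord (𝕜 := 𝕜) i').symm.analyticAt x
  -- The first cusp is taken to the standard one, and the standard one to the second.
  refine ⟨(I.symm.trans Φ.symm).trans (Φ'.trans I'), ⟨?_, ?_⟩, ?_⟩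
  · exact key _ _ (key _ _ (hIs _) h2) (key _ _ h1' (hI' _))
  · exact key (Φ'.trans I').symm (I.symm.trans Φ.symm).symm
      (key I'.symm Φ'.symm (hIs' _) h2') (key Φ I h1 (hI _))
  · filter_upwards [h3, h3', hX, hX'] with t e1 e2 e3 e4
    have e5 : I.symm (X t) = Φ (t ^ 2, t ^ N • (Pi.single ⟨0, hd⟩ 1 : Fin d → 𝕜)) := by
      rw [e1.2, ← e3.1, ← e3.2]
      rfl
    have e6 : X' t = I' (Φ' (t ^ 2, t ^ N • (Pi.single ⟨0, hd⟩ 1 : Fin d → 𝕜))) := by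
      rw [e2.2, ← e4.1, ← e4.2]
      exact ((insertCoord i').apply_symm_apply (X' t)).symm
    have e7 : (I.symm.trans Φ.symm) (X t) =
        (t ^ 2, t ^ N • (Pi.single ⟨0, hd⟩ 1 : Fin d → 𝕜)) := by
      rw [OpenPartialHomeomorph.trans_apply, e5, Φ.left_inv e1.1]
    constructor
    · rw [OpenPartialHomeomorph.trans_source, OpenPartialHomeomorph.trans_source,
        OpenPartialHomeomorph.trans_source]
      refine ⟨⟨mem_univ _, ?_⟩, ?_⟩
      · rw [mem_preimage, e5]
        exact Φ.map_source e1.1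
      · rw [mem_preimage, e7]
        exact ⟨e2.1, mem_univ _⟩
    · rw [OpenPartialHomeomorph.trans_apply, e7, e6]
      rfl

end Straightening

/-! ### Charts covering the class, and its equations there. -/

namespace DistManifold

variable {𝕜 E : Type u} [RCLike 𝕜] [NormedAddCommGroup E] [NormedSpace 𝕜 E] {d : ℕ}
  {M : DistManifold 𝕜 E d}

theorem hom_div (i j : Fin (d + 1)) (h : Fin (d + 1) → 𝕜) (hj : h j ≠ 0) :
    hom j (fun l => h (j.succAbove l) / h j) i = h i / h j := by
  refine Fin.succAboveCases j ?_ (fun l => ?_) i <;> simp [hj]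

/-- Non-verticality is the nonvanishing of the homogeneous coordinate of index `i`, so the same
index can be used again. -/
theorem exists_par_of_not_vert {c : M.man.ι} {i : Fin (d + 1)} {q : M.prolong.prolong.man.Pt}
    {x : E × (Fin d → 𝕜)} (hx : M.prolong.pr q = M.prolong.man.par (M.pidx c i) x)
    (hq : ¬ M.Vert q) :
    ∃ u, q = M.prolong.prolong.man.par (M.prolong.pidx (M.pidx c i) i) (x, u) := by
  obtain ⟨h, -, ⟨j, hj⟩, hh⟩ := M.prolong.exists_hom_coords q hx
  by_cases hi : h i = 0
  · rw [hh j hj, vert_par, hom_div _ _ _ hj, hi, zero_div] at hq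
    exact absurd rfl hq
  · exact ⟨_, hh i hi⟩

theorem exists_par_of_vert {c : M.man.ι} {i : Fin (d + 1)} {q : M.prolong.prolong.man.Pt}
    {x : E × (Fin d → 𝕜)} (hx : M.prolong.pr q = M.prolong.man.par (M.pidx c i) x)
    (hq : M.Vert q) :
    ∃ j u, j ≠ i ∧ q = M.prolong.prolong.man.par (M.prolong.pidx (M.pidx c i) j) (x, u) := by
  obtain ⟨h, -, ⟨j, hj⟩, hh⟩ := M.prolong.exists_hom_coords q hx
  rw [hh j hj, vert_par, hom_div _ _ _ hj] at hq
  refine ⟨j, _, ?_, hh j hj⟩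
  rintro rfl
  exact hj ((div_eq_zero_iff.1 hq).resolve_right hj)

end DistManifold

namespace Monster

open DistManifold

variable {𝕜 : Type u} [RCLike 𝕜] {d : ℕ}

theorem wordRVR_succ (k m : ℕ) : wordRVR k (m + 1) = wordRVR k m ++ [Letter.R] := by
  simp [wordRVR, List.replicate_succ']

theorem code_succ_eq_iff {k : ℕ} {q : P 𝕜 d (k + 1)} {w : List Letter} {a : Letter} :
    code (k + 1) q = w ++ [a] ↔ code k (proj k q) = w ∧ letter q = a := by
  change code k (proj k q) ++ [letter q] = w ++ [a] ↔ _
  constructor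
  · intro h
    have := List.append_inj' h rfl
    exact ⟨this.1, by simpa using this.2⟩
  · rintro ⟨rfl, rfl⟩
    rfl

theorem not_isCritical_zero (q : P 𝕜 d 0) : ¬ IsCritical q := by
  rintro ⟨i, j, p, q', -, he⟩
  have : i + 1 + (j + 1) = 0 := congrArg Sigma.fst he
  omega

variable (𝕜 d) in
/-- The chart with distinguished index `i` at all levels. -/
noncomputable def stdIdx (i : Fin (d + 1)) : ∀ k : ℕ, (tower 𝕜 d k).man.ι
  | 0 => bidx 𝕜 d
  | k + 1 => (tower 𝕜 d k).pidx (stdIdx i k) i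

variable (𝕜 d) in
/-- The chart with distinguished index `i` at the first `n + 1` levels, then `j`. -/
noncomputable def cuspIdx (i j : Fin (d + 1)) (n : ℕ) : ∀ m : ℕ, (tower 𝕜 d (n + 1 + 1 + m)).man.ι
  | 0 => (tower 𝕜 d (n + 1)).pidx (stdIdx 𝕜 d i (n + 1)) j
  | m + 1 => (tower 𝕜 d (n + 1 + 1 + m)).pidx (cuspIdx i j n m) j

/-- Repeating the index makes the relevant homogeneous coordinate `1`, which excludes verticality.
Criticality is then excluded by descent through `isCritical_cases`. -/
theorem letter_std (i : Fin (d + 1)) : ∀ (k : ℕ) (x : Model 𝕜 d (k + 1)),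
    letter ((tower 𝕜 d (k + 1)).man.par (stdIdx 𝕜 d i (k + 1)) x) = Letter.R
  | 0, x => letter_eq_R (fun h => h) fun h => (isCritical_cases h).elim (fun h => h)
      (not_isCritical_zero _)
  | k + 1, x => by
    have hv : ¬ IsVertical (k + 2) ((tower 𝕜 d (k + 2)).man.par (stdIdx 𝕜 d i (k + 2)) x) := by
      intro h
      have := (vert_par (M := tower 𝕜 d k)).1 h
      rw [hom_same] at this
      exact one_ne_zero this
    refine letter_eq_R hv fun h => (isCritical_cases h).elim hv ?_
    exact not_isCritical_of_letter (letter_std i k x.1)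

theorem code_std (i : Fin (d + 1)) : ∀ (k : ℕ) (x : Model 𝕜 d k),
    code k ((tower 𝕜 d k).man.par (stdIdx 𝕜 d i k) x) = List.replicate k Letter.R
  | 0, _ => rfl
  | k + 1, x => by
    rw [List.replicate_succ']
    exact code_succ_eq_iff.2 ⟨code_std i k x.1, letter_std i k x⟩

theorem exists_std_chart : ∀ {k : ℕ} {q : P 𝕜 d (k + 1)},
    code (k + 1) q = List.replicate (k + 1) Letter.R →
    ∃ i x, q = (tower 𝕜 d (k + 1)).man.par (stdIdx 𝕜 d i (k + 1)) x
  | 0, q, _ => by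
    obtain ⟨h, -, ⟨i, hi⟩, hh⟩ := (tower 𝕜 d 0).exists_hom_coords (c := bidx 𝕜 d) q
      (a := proj 0 q) rfl
    exact ⟨i, _, hh i hi⟩
  | k + 1, q, hq => by
    rw [List.replicate_succ', code_succ_eq_iff] at hq
    obtain ⟨i, x, hx⟩ := exists_std_chart hq.1
    obtain ⟨u, hu⟩ := exists_par_of_not_vert (M := tower 𝕜 d k) hx
      (not_isVertical_of_letter hq.2)
    exact ⟨i, (x, u), hu⟩

/-- The letter `V` forces the index to change from `i` to some `j ≠ i`. The later letters `R` allow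
`j` to be kept. -/
theorem exists_cusp_chart {n : ℕ} : ∀ {m : ℕ} {q : P 𝕜 d (n + 1 + 1 + m)},
    code (n + 1 + 1 + m) q = wordRVR (n + 1) m →
    ∃ i j, j ≠ i ∧ ∃ x, q = (tower 𝕜 d (n + 1 + 1 + m)).man.par (cuspIdx 𝕜 d i j n m) x
  | 0, q, hq => by
    have hq' := code_succ_eq_iff.1 hq
    obtain ⟨i, x, hx⟩ := exists_std_chart hq'.1
    obtain ⟨j, u, hij, hu⟩ := exists_par_of_vert (M := tower 𝕜 d n) hx (letter_eq_V.1 hq'.2)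
    exact ⟨i, j, hij, (x, u), hu⟩
  | 1, q, hq => by
    rw [wordRVR_succ] at hq
    have hq' := code_succ_eq_iff.1 hq
    obtain ⟨i, j, hij, x, hx⟩ := exists_cusp_chart (m := 0) hq'.1
    obtain ⟨u, hu⟩ := exists_par_of_not_vert (M := tower 𝕜 d (n + 1)) hx
      (not_isVertical_of_letter hq'.2)
    exact ⟨i, j, hij, (x, u), hu⟩
  | m + 2, q, hq => by
    rw [wordRVR_succ] at hq
    have hq' := code_succ_eq_iff.1 hq
    obtain ⟨i, j, hij, x, hx⟩ := exists_cusp_chart (m := m + 1) hq'.1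
    obtain ⟨u, hu⟩ := exists_par_of_not_vert (M := tower 𝕜 d (n + 1 + 1 + m)) hx
      (not_isVertical_of_letter hq'.2)
    exact ⟨i, j, hij, (x, u), hu⟩

/-- The coordinate conditions describing the class `RⁿVRᵐ`. -/
def CuspCoords (i j : Fin (d + 1)) (n : ℕ) : ∀ m : ℕ, Model 𝕜 d (n + 1 + 1 + m) → Prop
  | 0, x => hom j (Prod.snd (α := Model 𝕜 d (n + 1)) x) i = 0
  | 1, x => CuspCoords i j n 0 (Prod.fst (β := Fin d → 𝕜) x) ∧
      hom j (Prod.snd (α := Model 𝕜 d (n + 1 + 1)) x) i ≠ 0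
  | m + 2, x => CuspCoords i j n (m + 1) (Prod.fst (β := Fin d → 𝕜) x)

theorem not_isVertical_cusp {i j : Fin (d + 1)} {n : ℕ} : ∀ {m : ℕ}
    (x : Model 𝕜 d (n + 1 + 1 + (m + 1))), ¬ IsVertical (n + 1 + 1 + (m + 1))
      ((tower 𝕜 d (n + 1 + 1 + (m + 1))).man.par (cuspIdx 𝕜 d i j n (m + 1)) x)
  | 0, x => fun h => by
    have := (vert_par (M := tower 𝕜 d (n + 1))).1 h
    rw [hom_same] at this
    exact one_ne_zero this
  | m + 1, x => fun h => by
    have := (vert_par (M := tower 𝕜 d (n + 1 + 1 + m))).1 h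
    rw [hom_same] at this
    exact one_ne_zero this

/-- Right after `V` the only critical hyperplane to avoid in this chart comes from the fibre at
level `n + 1`, and `tangent_vert_iff` gives its equation. -/
theorem letter_cusp_one {i j : Fin (d + 1)} (hij : j ≠ i) {n : ℕ} {a : Model 𝕜 d n}
    {u v w : Fin d → 𝕜} (hv : hom j v i = 0) :
    letter ((tower 𝕜 d (n + 1 + 1 + 1)).man.par (cuspIdx 𝕜 d i j n 1) (((a, u), v), w)) =
      Letter.R ↔ hom j w i ≠ 0 := by
  set q : P 𝕜 d (n + 3) :=
    (tower 𝕜 d (n + 1 + 1 + 1)).man.par (cuspIdx 𝕜 d i j n 1) (((a, u), v), w) with hq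
  have hnv : ¬ IsVertical (n + 3) q := not_isVertical_cusp (m := 0) _
  have hnc : ¬ IsCritical (proj (n + 1) (proj (n + 2) q)) :=
    not_isCritical_of_letter (letter_std i n (a, u))
  have hc : IsCritical q ↔ hom j w i = 0 := by
    rw [isCritical_iff_mem hnv hnc, mem_babyMonster_succ,
      ← tangent_vert_iff (M := tower 𝕜 d n) (c := stdIdx 𝕜 d i n) (a := a) (u := u) (w := w)
        hij hv]
    have hS : babyMonster (proj (n + 1) (proj (n + 2) q)) 1 =
        {z | (tower 𝕜 d n).pr ((tower 𝕜 d n).prolong.pr z) =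
          (tower 𝕜 d n).man.par (stdIdx 𝕜 d i n) a ∧ (tower 𝕜 d n).Vert z} :=
      Set.ext fun z => mem_babyMonster_one
    rw [hS]
    exact and_iff_right ⟨rfl, vert_par.2 hv⟩
  exact Iff.trans ⟨not_isCritical_of_letter, letter_eq_R hnv⟩ (not_congr hc)

/-- One equation accounts for `V` and one inequality for the `R` after it. Further letters are
automatically `R` in this chart, since the points are not vertical and lie over regular points. -/
theorem code_cusp {i j : Fin (d + 1)} (hij : j ≠ i) {n : ℕ} : ∀ {m : ℕ}
    {x : Model 𝕜 d (n + 1 + 1 + m)},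
    code (n + 1 + 1 + m) ((tower 𝕜 d (n + 1 + 1 + m)).man.par (cuspIdx 𝕜 d i j n m) x) =
      wordRVR (n + 1) m ↔ CuspCoords i j n m x
  | 0, x => by
    refine (code_succ_eq_iff (w := List.replicate (n + 1) Letter.R)).trans ?_
    refine (and_iff_right (code_std i (n + 1) x.1)).trans ?_
    refine letter_eq_V.trans ?_
    exact vert_par (M := tower 𝕜 d n)
  | 1, x => by
    rw [wordRVR_succ]
    refine code_succ_eq_iff.trans ?_
    refine (and_congr_left' (code_cusp hij (m := 0) (x := x.1))).trans (and_congr_right fun h => ?_)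
    exact letter_cusp_one hij h
  | m + 2, x => by
    rw [wordRVR_succ]
    refine code_succ_eq_iff.trans ?_
    refine Iff.trans ?_ (code_cusp hij (m := m + 1) (x := x.1))
    refine and_iff_left_of_imp fun h => ?_
    rw [wordRVR_succ] at h
    have hl := (code_succ_eq_iff.1 h).2
    have hv := not_isVertical_cusp (i := i) (j := j) (m := m + 1) x
    exact letter_eq_R hv fun hc => (isCritical_cases hc).elim hv (not_isCritical_of_letter hl)

end Monster

/-! ### The cusp through a point of the class. -/

namespace DistManifold

variable {𝕜 E : Type u} [RCLike 𝕜] [NormedAddCommGroup E] [NormedSpace 𝕜 E] {d : ℕ}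
  {M : DistManifold 𝕜 E d}

theorem hasDerivAt_of_prolong_vec {c : M.man.ι} {i j : Fin (d + 1)} {a : 𝕜 → E × (Fin d → 𝕜)}
    {w : Fin d → 𝕜} {z t : 𝕜} (h : HasDerivAt a (z • M.prolong.vec (M.pidx c i) j (a t) w) t) :
    HasDerivAt (fun s => (a s).1) (z • hom j w i • M.vec c i (a t).1 (a t).2) t ∧
      HasDerivAt (fun s => (a s).2) (z • fun l => hom j w (i.succAbove l)) t := by
  rw [prolong_vec] at h
  exact ⟨h.fst, h.snd⟩

theorem hasDerivAt_of_prolong_frame {c : M.man.ι} {i : Fin (d + 1)} {a : 𝕜 → E × (Fin d → 𝕜)}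
    {t : 𝕜} (h : HasDerivAt a (M.prolong.frame (M.pidx c i) i (a t)) t) :
    HasDerivAt (fun s => (a s).1) (M.vec c i (a t).1 (a t).2) t := by
  rw [prolong_frame_same] at h
  exact h.fst

theorem analyticAt_hom {v : 𝕜 → Fin d → 𝕜} (hv : AnalyticAt 𝕜 v 0) (i j : Fin (d + 1)) :
    AnalyticAt 𝕜 (fun t => hom j (v t) i) 0 :=
  ((contDiff_hom j i).contDiffAt.comp 0 hv.contDiffAt).analyticAt

theorem exists_hom_eq_apply {i j : Fin (d + 1)} (hij : j ≠ i) :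
    ∃ l, ∀ v : Fin d → 𝕜, hom j v i = v l := by
  obtain ⟨l, rfl⟩ := Fin.exists_succAbove_eq hij.symm
  exact ⟨l, fun v => hom_succAbove j v l⟩

end DistManifold

namespace Monster

open DistManifold

variable {𝕜 : Type u} [RCLike 𝕜] {d : ℕ}

theorem base_vec (i : Fin (d + 1)) (a : Fin (d + 1) → 𝕜) (u : Fin d → 𝕜) :
    (base 𝕜 d).vec (bidx 𝕜 d) i a u = hom i u := by
  ext l
  simp [vec, base, Pi.single_apply]

theorem hasDerivAt_of_base_vec {i : Fin (d + 1)} {e : 𝕜 → Fin (d + 1) → 𝕜} {u : Fin d → 𝕜} {z t : 𝕜}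
    (h : HasDerivAt e (z • (base 𝕜 d).vec (bidx 𝕜 d) i (e t) u) t) (j : Fin (d + 1)) :
    HasDerivAt (fun s => e s j) (z * hom i u j) t := by
  rw [base_vec] at h
  exact hasDerivAt_pi.1 h j

/-- The projection to `𝕜ⁿ` of a curve tangent to the distinguished frame field. -/
theorem exists_base_curve (i : Fin (d + 1)) {lam : 𝕜 → 𝕜} : ∀ (n : ℕ) {e : 𝕜 → Model 𝕜 d n}
    {u : 𝕜 → Fin d → 𝕜}, AnalyticAt 𝕜 e 0 → AnalyticAt 𝕜 u 0 →
    (∀ t, HasDerivAt e (lam t • (tower 𝕜 d n).vec (stdIdx 𝕜 d i n) i (e t) (u t)) t) →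
    ∃ X : 𝕜 → Fin (d + 1) → 𝕜,
      (∀ t, toBase n ((tower 𝕜 d n).man.par (stdIdx 𝕜 d i n) (e t)) = X t) ∧
      (∀ t, HasDerivAt (fun s => X s i) (lam t) t) ∧ AnalyticAt 𝕜 X 0 ∧
      IterInt lam n (fun t l => X t (i.succAbove l)) u
  | 0, e, u, he, hu, hd => by
    have hd' : ∀ t j, HasDerivAt (fun s => (e s : Fin (d + 1) → 𝕜) j) (lam t * hom i (u t) j) t :=
      fun t j => hasDerivAt_of_base_vec (hd t) j
    have he' : AnalyticAt (F := Fin (d + 1) → 𝕜) 𝕜 e 0 := he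
    refine ⟨e, fun t => rfl, fun t => by simpa using hd' t i, he', hu, ?_, ?_⟩
    · exact analyticAt_pi_iff.2 fun l => analyticAt_pi_iff.1 he' _
    · refine Filter.Eventually.of_forall fun t => hasDerivAt_pi.2 fun l => ?_
      simpa using hd' t (i.succAbove l)
  | n + 1, e, u, he, hu, hd => by
    have hd' : ∀ t, HasDerivAt (fun s => (e s).1) (lam t • (tower 𝕜 d n).vec (stdIdx 𝕜 d i n) i
        (e t).1 (e t).2) t ∧ HasDerivAt (fun s => (e s).2) (lam t • u t) t := by
      intro t
      have := hasDerivAt_of_prolong_vec (M := tower 𝕜 d n) (hd t)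
      simpa using this
    have he1 : AnalyticAt 𝕜 (fun s => (e s).1) 0 := analyticAt_fst.comp he
    have he2 : AnalyticAt 𝕜 (fun s => (e s).2) 0 := analyticAt_snd.comp he
    obtain ⟨X, h1, h2, h3, h4⟩ := exists_base_curve i n he1 he2 fun t => (hd' t).1
    -- The top fibre coordinate of `e` is the intermediate function of the additional integration.
    exact ⟨X, h1, h2, h3, _, h4, hu, Filter.Eventually.of_forall fun t => (hd' t).2⟩

/-- The index `j` repeats above the level of `V`, so the curve projects with unit speed factor. The
base curve can thus be computed just above `V`, where both coordinate conditions live. -/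
theorem exists_curve_first_cusp_level {i j : Fin (d + 1)} {n : ℕ} : ∀ {m : ℕ}
    {a : 𝕜 → Model 𝕜 d (n + 1 + 1 + m)} {w : 𝕜 → Fin d → 𝕜}, AnalyticAt 𝕜 a 0 →
    AnalyticAt 𝕜 w 0 →
    (∀ t, HasDerivAt a ((tower 𝕜 d (n + 1 + 1 + m)).vec (cuspIdx 𝕜 d i j n m) j (a t) (w t)) t) →
    CuspCoords i j n (m + 1) (a 0, w 0) →
    ∃ (a' : 𝕜 → Model 𝕜 d (n + 1 + 1)) (w' : 𝕜 → Fin d → 𝕜), AnalyticAt 𝕜 a' 0 ∧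
      AnalyticAt 𝕜 w' 0 ∧
      (∀ t, HasDerivAt a'
        ((tower 𝕜 d (n + 1 + 1)).vec (cuspIdx 𝕜 d i j n 0) j (a' t) (w' t)) t) ∧
      CuspCoords i j n 1 (a' 0, w' 0) ∧
      ∀ t, toBase (n + 1 + 1 + m) ((tower 𝕜 d (n + 1 + 1 + m)).man.par (cuspIdx 𝕜 d i j n m) (a t))
        = toBase (n + 1 + 1) ((tower 𝕜 d (n + 1 + 1)).man.par (cuspIdx 𝕜 d i j n 0) (a' t))
  | 0, a, w, ha, hw, hd, hc => ⟨a, w, ha, hw, hd, hc, fun _ => rfl⟩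
  | m + 1, a, w, ha, hw, hd, hc => by
    have hd' : ∀ t, HasDerivAt (fun s => (a s).1) ((tower 𝕜 d (n + 1 + 1 + m)).vec
        (cuspIdx 𝕜 d i j n m) j (a t).1 (a t).2) t := by
      intro t
      have h1 : HasDerivAt a ((1 : 𝕜) • (tower 𝕜 d (n + 1 + 1 + m)).prolong.vec
        ((tower 𝕜 d (n + 1 + 1 + m)).pidx (cuspIdx 𝕜 d i j n m) j) j (a t) (w t)) t := by
        rw [one_smul]
        exact hd t
      have := (hasDerivAt_of_prolong_vec h1).1
      rwa [hom_same, one_smul, one_smul] at this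
    have ha1 : AnalyticAt 𝕜 (fun s => (a s).1) 0 := analyticAt_fst.comp ha
    have ha2 : AnalyticAt 𝕜 (fun s => (a s).2) 0 := analyticAt_snd.comp ha
    exact exists_curve_first_cusp_level (m := m) (a := fun s => (a s).1) (w := fun s => (a s).2)
      ha1 ha2 hd' hc

/-- Every point of the class `RⁿVRᵐ`, `m ≥ 1`, lies on the prolongation of a cusp. -/
theorem exists_cusp_through {n m : ℕ} {q : P 𝕜 d (n + 1 + 1 + (m + 1))}
    (hq : code (n + 1 + 1 + (m + 1)) q = wordRVR (n + 1) (m + 1)) :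
    ∃ (γ : 𝕜 → P 𝕜 d (n + 1 + 1 + (m + 1))) (X : 𝕜 → Fin (d + 1) → 𝕜) (i : Fin (d + 1))
      (A B : 𝕜 → Fin d → 𝕜) (x₀ κ : 𝕜),
      (tower 𝕜 d (n + 1 + 1 + (m + 1))).Horizontal γ ∧ γ 0 = q ∧
      (∀ t, toBase (n + 1 + 1 + (m + 1)) (γ t) = X t) ∧
      (∀ᶠ t in 𝓝[≠] 0, DifferentiableAt 𝕜 X t ∧ deriv X t ≠ 0) ∧
      AnalyticAt 𝕜 A 0 ∧ AnalyticAt 𝕜 B 0 ∧ B 0 ≠ 0 ∧ κ ≠ 0 ∧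
      ∀ᶠ t in 𝓝 0, X t i = x₀ + κ * t ^ 2 ∧
        (fun l => X t (i.succAbove l)) = A (t ^ 2) + t ^ (2 * n + 3) • B (t ^ 2) := by
  obtain ⟨i, j, hij, x, rfl⟩ := exists_cusp_chart hq
  have hx := (code_cusp hij).1 hq
  set M := tower 𝕜 d (n + 1 + 1 + m) with hM
  -- The constant coefficients select the `j`-th frame field, which covers the tautological
  -- direction one level down.
  obtain ⟨α, hα0, hα, hαd⟩ := hasIntegralCurves (𝕜 := 𝕜) (d := d) (n + 1 + 1 + (m + 1))
    (cuspIdx 𝕜 d i j n (m + 1)) (fun l => if l = j then 1 else 0) x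
  have hαd' : ∀ t, HasDerivAt (fun s => (α s).1) (M.vec (cuspIdx 𝕜 d i j n m) j
      (α t).1 (α t).2) t := by
    intro t
    have h1 : HasDerivAt α (M.prolong.frame (M.pidx (cuspIdx 𝕜 d i j n m) j) j (α t)) t := by
      have := hαd t
      simp only [apply_ite (Polynomial.eval t), Polynomial.eval_one, Polynomial.eval_zero,
        ite_smul, one_smul, zero_smul, Finset.sum_ite_eq', Finset.mem_univ, if_true] at this
      exact this
    exact hasDerivAt_of_prolong_frame h1
  have hαa : AnalyticAt 𝕜 α 0 := hα.contDiffAt.analyticAt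
  obtain ⟨a, w, ha, hw, had, hac, hat⟩ := exists_curve_first_cusp_level
    (analyticAt_fst.comp hαa) (analyticAt_snd.comp hαa) hαd' (by
      change CuspCoords i j n (m + 1) (α 0)
      rwa [hα0])
  set e : 𝕜 → Model 𝕜 d n := fun t => (a t).1.1
  set u : 𝕜 → Fin d → 𝕜 := fun t => (a t).1.2
  set v : 𝕜 → Fin d → 𝕜 := fun t => (a t).2
  set lam : 𝕜 → 𝕜 := fun t => hom j (v t) i
  have had1 : ∀ t, HasDerivAt (fun s => (a s).1) ((tower 𝕜 d (n + 1)).vec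
      (stdIdx 𝕜 d i (n + 1)) j (a t).1 (v t)) t ∧ HasDerivAt v (w t) t := by
    intro t
    have h1 : HasDerivAt a ((1 : 𝕜) • (tower 𝕜 d (n + 1)).prolong.vec
        ((tower 𝕜 d (n + 1)).pidx (stdIdx 𝕜 d i (n + 1)) j) j (a t) (w t)) t := by
      rw [one_smul]
      exact had t
    have := hasDerivAt_of_prolong_vec h1
    simpa using this
  have had2 : ∀ t, HasDerivAt e (lam t • (tower 𝕜 d n).vec (stdIdx 𝕜 d i n) i (e t) (u t)) t ∧
      HasDerivAt u (fun l => hom j (v t) (i.succAbove l)) t := by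
    intro t
    have h1 : HasDerivAt (fun s => (a s).1) ((1 : 𝕜) • (tower 𝕜 d n).prolong.vec
        ((tower 𝕜 d n).pidx (stdIdx 𝕜 d i n) i) j (a t).1 (v t)) t := by
      rw [one_smul]
      exact (had1 t).1
    have := hasDerivAt_of_prolong_vec h1
    rwa [one_smul, one_smul] at this
  have ha1 : AnalyticAt 𝕜 (fun s => (a s).1) 0 := analyticAt_fst.comp ha
  have hea : AnalyticAt 𝕜 e 0 := analyticAt_fst.comp ha1
  have hua : AnalyticAt 𝕜 u 0 := analyticAt_snd.comp ha1
  have hva : AnalyticAt 𝕜 v 0 := analyticAt_snd.comp ha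
  obtain ⟨X, hX, hXi, hXa, hXI⟩ := exists_base_curve i n hea hua fun t => (had2 t).1
  obtain ⟨l, hl⟩ := exists_hom_eq_apply (𝕜 := 𝕜) hij
  -- Here the letter `R` after `V` enters: `lam = v_l` has derivative `w_l`, which is nonzero at
  -- `0`.
  have hlam' : deriv lam 0 ≠ 0 := by
    have h1 : lam = fun t => v t l := funext fun t => hl (v t)
    have h2 : w 0 l ≠ 0 := by
      rw [← hl (w 0)]
      exact hac.2
    rw [h1, (hasDerivAt_pi.1 (had1 0).2 l).deriv]
    exact h2
  -- The component of `u'` belonging to the index `j ≠ i` is identically `1`.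
  have hu' : deriv u 0 ≠ 0 := by
    rw [(had2 0).2.deriv]
    obtain ⟨l', rfl⟩ := Fin.exists_succAbove_eq hij
    intro h
    have := congrFun h l'
    simp at this
  -- The `i`-th base coordinate has derivative `lam`, with a simple zero at `0` by `V` and `hlam'`.
  obtain ⟨τ, κ, hτ, hτ0, hτ', hκ, hxτ, hlτ⟩ := exists_quadratic_coordinate
    (analyticAt_pi_iff.1 hXa i) (analyticAt_hom hva i j) (Filter.Eventually.of_forall hXi)
    hac.1 hlam'
  have hdu : deriv (fun t => u (τ t)) 0 ≠ 0 := by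
    have h1 : HasDerivAt u (deriv u 0) (τ 0) := hτ0.symm ▸ hua.differentiableAt.hasDerivAt
    have h2 := HasDerivAt.scomp (0 : 𝕜) h1 hτ.differentiableAt.hasDerivAt
    have h3 : deriv (fun t => u (τ t)) 0 = deriv τ 0 • deriv u 0 := h2.deriv
    rw [h3]
    exact smul_ne_zero hτ' hu'
  obtain ⟨A, B, hA, hB, hB0, hAB⟩ := (hXI.comp hτ hτ0 hlτ).normal_form hκ hdu
  have hXτ : AnalyticAt 𝕜 (fun t => X (τ t)) 0 := hXa.comp_of_eq hτ hτ0
  refine ⟨fun t => (tower 𝕜 d (n + 1 + 1 + (m + 1))).man.par (cuspIdx 𝕜 d i j n (m + 1)) (α (τ t)),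
    fun t => X (τ t), i, A, B, X 0 i, κ, ?_, ?_, ?_, ?_, hA, hB, hB0, hκ, hxτ.and hAB⟩
  · exact (horizontal_par (M := tower 𝕜 d (n + 1 + 1 + (m + 1))) hα.contDiffAt
      (Filter.Eventually.of_forall hαd)).comp hτ.contDiffAt hτ0
  · change (tower 𝕜 d (n + 1 + 1 + (m + 1))).man.par _ (α (τ 0)) = _
    rw [hτ0, hα0]
  · exact fun t => (hat (τ t)).trans (hX (τ t))
  -- Off `0` the cusp is immersed, since its `i`-th coordinate has derivative `2κt`.
  · filter_upwards [nhdsWithin_le_nhds hXτ.eventually_hasDerivAt,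
      nhdsWithin_le_nhds (Filter.EventuallyEq.eventuallyEq_nhds hxτ), self_mem_nhdsWithin] with t h1 h2 h3
    refine ⟨h1.differentiableAt, fun h4 => ?_⟩
    rw [h4] at h1
    have h5 := (hasDerivAt_pi.1 h1 i).unique
      ((((hasDerivAt_pow 2 t).const_mul κ).const_add (X 0 i)).congr_of_eventuallyEq h2)
    simp only [Pi.zero_apply, Nat.cast_ofNat, Nat.add_one_sub_one, pow_one] at h5
    exact mul_ne_zero hκ (mul_ne_zero two_ne_zero h3) h5.symm

theorem equivalent_of_code (hd : 0 < d) {n m : ℕ} {q q' : P 𝕜 d (n + 1 + 1 + (m + 1))}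
    (hq : code (n + 1 + 1 + (m + 1)) q = wordRVR (n + 1) (m + 1))
    (hq' : code (n + 1 + 1 + (m + 1)) q' = wordRVR (n + 1) (m + 1)) : Equivalent q q' := by
  obtain ⟨γ, X, i, A, B, x₀, κ, hγ, rfl, hX, -, hA, hB, hB0, hκ, hXe⟩ := exists_cusp_through hq
  obtain ⟨γ', X', i', A', B', x₀', κ', hγ', rfl, hX', hXd', hA', hB', hB0', hκ', hXe'⟩ :=
    exists_cusp_through hq'
  obtain ⟨ψ, hψ, hψX⟩ := exists_diffeo_of_cusps hd hA hB hB0 hA' hB' hB0' hκ hκ' hXe hXe'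
  refine equivalent_of_horizontal hγ hγ' hψ (x := X') ?_ ?_ (Filter.Eventually.of_forall hX') hXd'
  · rw [hX]
    exact hψX.self_of_nhds.1
  · filter_upwards [hψX] with t ht
    rw [hX]
    exact ht.2

theorem Equivalent.proj {k : ℕ} {q q' : P 𝕜 d (k + 1)} (h : Equivalent q q') :
    Equivalent (proj k q) (proj k q') := by
  obtain ⟨ψ, h1, h2, h3, rfl⟩ := h
  exact ⟨ψ, h1, h2, h3, (proj_prolongation ⟨h1, h2⟩ h3).symm⟩

/-- Without a letter after `V` nothing provides `lam'(0) ≠ 0`. The points are lifted to the class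
with one more `R`, and the equivalence found there is projected. -/
theorem equivalent_of_code_zero (hd : 0 < d) {n : ℕ} {q q' : P 𝕜 d (n + 1 + 1)}
    (hq : code (n + 1 + 1) q = wordRVR (n + 1) 0)
    (hq' : code (n + 1 + 1) q' = wordRVR (n + 1) 0) : Equivalent q q' := by
  have key : ∀ {q : P 𝕜 d (n + 1 + 1)}, code (n + 1 + 1) q = wordRVR (n + 1) 0 →
      ∃ r : P 𝕜 d (n + 1 + 1 + 1), code (n + 1 + 1 + 1) r = wordRVR (n + 1) 1 ∧
        Monster.proj (n + 1 + 1) r = q := by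
    intro q hq
    obtain ⟨i, j, hij, x, rfl⟩ := exists_cusp_chart (m := 0) hq
    have hx := (code_cusp (m := 0) hij).1 hq
    obtain ⟨l, hl⟩ := exists_hom_eq_apply (𝕜 := 𝕜) hij
    refine ⟨(tower 𝕜 d (n + 1 + 1 + 1)).man.par (cuspIdx 𝕜 d i j n 1) (x, fun _ => 1),
      (code_cusp (m := 1) hij).2 ⟨hx, ?_⟩, rfl⟩
    change hom j (fun _ => (1 : 𝕜)) i ≠ 0
    rw [hl]
    exact one_ne_zero
  obtain ⟨r, hr, rfl⟩ := key hq
  obtain ⟨r', hr', rfl⟩ := key hq'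
  exact (equivalent_of_code (m := 0) hd hr hr').proj

theorem exists_cuspCoords {i j : Fin (d + 1)} (hij : j ≠ i) (n : ℕ) :
    ∀ m : ℕ, ∃ x : Model 𝕜 d (n + 1 + 1 + m), CuspCoords i j n m x := by
  obtain ⟨l, hl⟩ := exists_hom_eq_apply (𝕜 := 𝕜) hij
  have h0 : CuspCoords (𝕜 := 𝕜) i j n 0 (0, 0) := hl 0
  intro m
  induction m with
  | zero => exact ⟨_, h0⟩
  | succ m ih =>
    cases m with
    | zero =>
      refine ⟨((0, 0), fun _ => 1), h0, ?_⟩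
      change hom j (fun _ => (1 : 𝕜)) i ≠ 0
      rw [hl]
      exact one_ne_zero
    | succ m =>
      obtain ⟨x, hx⟩ := ih
      exact ⟨(x, 0), hx⟩

end Monster

theorem mainTheorem9 {𝕜 : Type u} [RCLike 𝕜] (d k m : ℕ) (hd : 1 ≤ d) (hk : 1 ≤ k) :
    ∃ p : Monster.P 𝕜 d (k + 1 + m),
      Monster.rvtClass 𝕜 d (k + 1 + m) (Monster.wordRVR k m) = Monster.orbit p := by
  obtain ⟨n, rfl⟩ : ∃ n, k = n + 1 := ⟨k - 1, by omega⟩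
  -- The dimension `d + 1` is at least two, so two distinct indices are available for a vertical
  -- point.
  have hij : Fin.last d ≠ 0 := fun h => by
    have := congrArg Fin.val h
    simp at this
    omega
  obtain ⟨x, hx⟩ := Monster.exists_cuspCoords (𝕜 := 𝕜) hij n m
  have hp := (Monster.code_cusp hij).2 hx
  refine ⟨_, Set.ext fun q => ⟨fun hq => ?_, fun hq => (Monster.code_eq_of_equivalent hq).trans hp⟩⟩
  cases m with
  | zero => exact Monster.equivalent_of_code_zero hd hp hq
  | succ m => exact Monster.equivalent_of_code hd hp hq
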